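/- Let $d\ge 1$, $j\in\{1,\dots,d\}$, and let $\alpha=(\alpha_1,\dots,\alpha_d)\in\mathbb R^d$ satisfy $\alpha_j>-3/2$ and $\alpha_i>-1$ for $i\ne j$. Put $|\alpha|=\alpha_1+\dots+\alpha_d$, let $e_j$ be the $j$th coordinate vector, and on $\mathbb R^d_+=(0,\infty)^d$ let $$d\mu_\alpha(x)=\Big(\prod_{i=1}^d x_i^{2\alpha_i+1}\Big)\,dx .$$ For $\beta\in(-1,\infty)^d$, $t>0$ and $x,y\in\mathbb R^d_+$ let $$G_t^{\beta,\ell}(x,y)=(\sinh 2t)^{-d}\exp\Big(-\tfrac12\coth(2t)\big(\|x\|^2+\|y\|^2\big)\Big)\prod_{i=1}^d (x_iy_i)^{-\beta_i}I_{\beta_i}\Big(\frac{x_iy_i}{\sinh 2t}\Big),$$ where $\|\cdot\|$ is the Euclidean norm and $I_\nu$ is the modified Bessel function of the first kind. The modified Laguerre semigroup of convolution type $\{\widetilde T_t^{\alpha,\ell,j}\}_{t\ge0}$ is given by $\widetilde T_0^{\alpha,\ell,j}=\mathrm{Id}$ and $$\widetilde T_t^{\alpha,\ell,j}f(x)=e^{-2t}\int_{\mathbb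 R^d_+}x_jy_j\,G_t^{\alpha+e_j,\ell}(x,y)f(y)\,d\mu_\alpha(y),\qquad x\in\mathbb R^d_+,\ t>0,$$ for $f\in L^1(\mu_\alpha)+L^\infty(\mu_\alpha)$ (real- or complex-valued). A family $\{T_t\}_{t\ge0}$ of linear operators mapping $L^1(\mu)+L^\infty(\mu)$ into the measurable functions, with $T_0=\mathrm{Id}$, is a symmetric diffusion semigroup if (i) for every $1\le p\le\infty$ each $T_t$ is a contraction on $L^p(\mu)$ and $\{T_t\}$ is a semigroup there; (ii) each $T_t$ is self-adjoint on $L^2(\mu)$; (iii) $T_tf\to f$ in $L^2(\mu)$ as $t\to0^+$ for every $f\in L^2(\mu)$. It is submarkovian if moreover $T_tf\ge0$ whenever $f\ge0$, and $T_t\mathbf 1\le\mathbf 1$, for all $t\ge 0$; it is Markovian if moreover $T_tf\ge 0$ whenever $f\ge 0$, and $T_t\mathbf 1=\mathbf 1$, for all $t\ge 0$. The family is called $L^p$-contractive if $\|T_tf\|_p\le\|f\|_p$ for all $1\le p\le\infty$, $t\ge0$ and $f\in L^2(\mu)\cap L^p(\mu)$. $\|\cdot\|_{p\to p}$ denotes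 the operator norm on $L^p(\mu_\alpha)$. Then the integral defining $\widetilde T_t^{\alpha,\ell,j}f(x)$ converges absolutely for all $t>0$, $f\in L^1(\mu_\alpha)+L^\infty(\mu_\alpha)$ and $x\in\mathbb R^d_+$, and the following holds. 1. If $\alpha_j\ge-1/2$, then $\{\widetilde T_t^{\alpha,\ell,j}\}$ is a submarkovian, but not Markovian, symmetric diffusion semigroup on $(\mathbb R^d_+,\mu_\alpha)$, and for all $1\le p\le\infty$ the operators map $L^p(\mu_\alpha)$ into itself with $$\|\widetilde T_t^{\alpha,\ell,j}\|_{p\to p}\le e^{-2t}(\cosh 2t)^{-(|\alpha|+d)},\qquad t>0.$$ 2. If $\alpha_j\in(-3/2,-1/2)$, then $\{\widetilde T_t^{\alpha,\ell,j}\}$ is not $L^p$-contractive, but there is a constant $c=c(\alpha)>1$ such that for all $1\le p\le\infty$ the operators map $L^p(\mu_\alpha)$ into itself with $$\|\widetilde T_t^{\alpha,\ell,j}\|_{p\to p}\le c\,e^{-2t}(\cosh 2t)^{-(|\alpha|+d)},\qquad t>0.$$ -/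

import Mathlib

open MeasureTheory Filter Topology
open scoped ENNReal ComplexOrder

namespace LaguerreSemigroup

noncomputable section

/-! ### Symmetric diffusion semigroups -/

/-- Membership in `L¹(μ) + L^∞(μ)`. -/
def MemL1AddLinf {X 𝕜 : Type*} [MeasurableSpace X] [RCLike 𝕜] (μ : Measure X)
    (f : X → 𝕜) : Prop :=
  ∃ g h : X → 𝕜, MemLp g 1 μ ∧ MemLp h ∞ μ ∧ f =ᵐ[μ] g + h

/-- `T` is (modulo null sets) a linear operator from `L¹(μ) + L^∞(μ)` to the space of
(almost everywhere) measurable functions. -/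
structure IsLinearOperator {X 𝕜 : Type*} [MeasurableSpace X] [RCLike 𝕜] (μ : Measure X)
    (T : (X → 𝕜) → X → 𝕜) : Prop where
  measurable : ∀ f, MemL1AddLinf μ f → AEStronglyMeasurable (T f) μ
  congr_ae : ∀ f g, MemL1AddLinf μ f → f =ᵐ[μ] g → T f =ᵐ[μ] T g
  map_add : ∀ f g, MemL1AddLinf μ f → MemL1AddLinf μ g → T (f + g) =ᵐ[μ] T f + T g
  map_smul : ∀ (c : 𝕜) f, MemL1AddLinf μ f → T (c • f) =ᵐ[μ] c • T f

/-- `T` maps `L^p(μ)` into itself. -/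
def MapsLp {X 𝕜 : Type*} [MeasurableSpace X] [RCLike 𝕜] (μ : Measure X) (p : ℝ≥0∞)
    (T : (X → 𝕜) → X → 𝕜) : Prop :=
  ∀ f, MemLp f p μ → MemLp (T f) p μ

/-- The operator norm `‖T‖_{p → p}` on `L^p(μ)`, with value `∞` if `T` is unbounded. -/
def lpOpNorm {X 𝕜 : Type*} [MeasurableSpace X] [RCLike 𝕜] (μ : Measure X) (p : ℝ≥0∞)
    (T : (X → 𝕜) → X → 𝕜) : ℝ≥0∞ :=
  sInf {C : ℝ≥0∞ | ∀ f, MemLp f p μ → eLpNorm (T f) p μ ≤ C * eLpNorm f p μ}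

/-- A symmetric diffusion semigroup `{T_t}_{t ≥ 0}` on `L¹(μ) + L^∞(μ)`; the values of `T t` for
negative `t` play no role. -/
structure IsSymmetricDiffusionSemigroup {X 𝕜 : Type*} [MeasurableSpace X] [RCLike 𝕜]
    (μ : Measure X) (T : ℝ → (X → 𝕜) → X → 𝕜) : Prop where
  linear : ∀ t, 0 ≤ t → IsLinearOperator μ (T t)
  zero : ∀ f, MemL1AddLinf μ f → T 0 f =ᵐ[μ] f
  contraction : ∀ p : ℝ≥0∞, 1 ≤ p → ∀ t, 0 ≤ t → ∀ f, MemLp f p μ →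
    MemLp (T t f) p μ ∧ eLpNorm (T t f) p μ ≤ eLpNorm f p μ
  semigroup : ∀ p : ℝ≥0∞, 1 ≤ p → ∀ s t, 0 ≤ s → 0 ≤ t → ∀ f, MemLp f p μ →
    T (s + t) f =ᵐ[μ] T s (T t f)
  selfAdjoint : ∀ t, 0 ≤ t → ∀ f g, MemLp f 2 μ → MemLp g 2 μ →
    ∫ x, T t f x * star (g x) ∂μ = ∫ x, f x * star (T t g x) ∂μ
  continuous : ∀ f, MemLp f 2 μ →
    Tendsto (fun t => eLpNorm (T t f - f) 2 μ) (𝓝[>] (0 : ℝ)) (𝓝 0)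

/-- Positivity: `T_t f ≥ 0` whenever `f ≥ 0`. -/
def IsPositive {X 𝕜 : Type*} [MeasurableSpace X] [RCLike 𝕜] (μ : Measure X)
    (T : ℝ → (X → 𝕜) → X → 𝕜) : Prop :=
  ∀ t, 0 ≤ t → ∀ f, MemL1AddLinf μ f → (∀ᵐ x ∂μ, 0 ≤ f x) → ∀ᵐ x ∂μ, 0 ≤ T t f x

/-- A Markovian symmetric diffusion semigroup: positive and conservative. -/
structure IsMarkovian {X 𝕜 : Type*} [MeasurableSpace X] [RCLike 𝕜] (μ : Measure X)
    (T : ℝ → (X → 𝕜) → X → 𝕜) : Prop where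
  diffusion : IsSymmetricDiffusionSemigroup μ T
  positive : IsPositive μ T
  conservative : ∀ t, 0 ≤ t → ∀ᵐ x ∂μ, T t (fun _ => 1) x = 1

/-- A submarkovian symmetric diffusion semigroup: positive with `T_t 1 ≤ 1`. -/
structure IsSubmarkovian {X 𝕜 : Type*} [MeasurableSpace X] [RCLike 𝕜] (μ : Measure X)
    (T : ℝ → (X → 𝕜) → X → 𝕜) : Prop where
  diffusion : IsSymmetricDiffusionSemigroup μ T
  positive : IsPositive μ T
  map_one_le : ∀ t, 0 ≤ t → ∀ᵐ x ∂μ, T t (fun _ => 1) x ≤ 1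

/-- `L^p`-contractivity (for all `1 ≤ p ≤ ∞` simultaneously):
`‖T_t f‖_p ≤ ‖f‖_p` for all `f ∈ L² ∩ L^p` and `t ≥ 0`. -/
def IsLpContractive {X 𝕜 : Type*} [MeasurableSpace X] [RCLike 𝕜] (μ : Measure X)
    (T : ℝ → (X → 𝕜) → X → 𝕜) : Prop :=
  ∀ p : ℝ≥0∞, 1 ≤ p → ∀ t, 0 ≤ t → ∀ f, MemLp f 2 μ → MemLp f p μ →
    eLpNorm (T t f) p μ ≤ eLpNorm f p μ

/-! ### Laguerre semigroups of convolution type -/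

/-- The modified Bessel function of the first kind `I_ν(z)`, for `ν > -1` and `z > 0`. -/
def besselI (ν z : ℝ) : ℝ :=
  ∑' k : ℕ, (z / 2) ^ (2 * (k : ℝ) + ν) / ((k.factorial : ℝ) * Real.Gamma ((k : ℝ) + ν + 1))

/-- The measure `dμ_α(x) = (∏ x_i ^ (2 α_i + 1)) dx` on the orthant `(0,∞)^d`, regarded as a
measure on `ℝ^d` that vanishes off the orthant. -/
def muAlpha {d : ℕ} (α : Fin d → ℝ) : Measure (Fin d → ℝ) :=
  (volume.restrict {x | ∀ i, 0 < x i}).withDensity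
    (fun x => ENNReal.ofReal (∏ i, x i ^ (2 * α i + 1)))

/-- The heat kernel `G_t^{α,ℓ}(x,y)` of the Laguerre operator of convolution type. -/
def heatKernel {d : ℕ} (α : Fin d → ℝ) (t : ℝ) (x y : Fin d → ℝ) : ℝ :=
  (Real.sinh (2 * t))⁻¹ ^ d *
    Real.exp (-(1 / 2) * (Real.cosh (2 * t) / Real.sinh (2 * t)) *
      ((∑ i, x i ^ 2) + ∑ i, y i ^ 2)) *
    ∏ i, (x i * y i) ^ (-α i) * besselI (α i) (x i * y i / Real.sinh (2 * t))

/-- The kernel `e^{-2t} x_j y_j G_t^{α+e_j,ℓ}(x,y)` of the modified semigroup. -/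
def modifiedKernel {d : ℕ} (α : Fin d → ℝ) (j : Fin d) (t : ℝ) (x y : Fin d → ℝ) : ℝ :=
  Real.exp (-2 * t) * (x j * y j * heatKernel (α + Pi.single j 1) t x y)

/-- The modified semigroup
`T̃_t^{α,ℓ,j} f(x) = e^{-2t} ∫ x_j y_j G_t^{α+e_j,ℓ}(x,y) f(y) dμ_α(y)`, `t > 0`, with `T̃_0 = Id`. -/
def modifiedSemigroup {𝕜 : Type*} [RCLike 𝕜] {d : ℕ} (α : Fin d → ℝ) (j : Fin d) (t : ℝ)
    (f : (Fin d → ℝ) → 𝕜) (x : Fin d → ℝ) : 𝕜 :=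
  if t = 0 then f x
  else ∫ y, modifiedKernel α j t x y • f y ∂(muAlpha α)

end

end LaguerreSemigroup

/-! Everything is read off the marginal masses of the kernel. The kernel of the semigroup is
nonnegative and symmetric on the orthant, so a bound C on its mass in one variable bounds the
operator by C on every L^p at once (Schur's test, `IsSymmKernel.eLpNorm_le`), while contractivity on
L^∞ forces the mass to be at most 1 almost everywhere. The kernel factors over the coordinates, so
only one-dimensional masses are needed.

The one-dimensional heat kernel maps Gaussians to Gaussians (`lintegral_halfKernel_mul_exp`). For i
≠ j this gives the mass cosh(2t)^(-(α_i+1)) times an exponential that is at most 1. In coordinate j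
the mass is x times the heat kernel of order ν = α_j + 1 applied to 1/y. Writing 1/y as a
superposition of Gaussians exp(-l y²) and substituting in l gives, with u = x²/sinh(4t), the value
cosh(2t)^(-ν) exp(-sinh(2t)² u) times `massProfile ν u` (`lintegral_modHalfKernel`).

Without the factor (1-w)^(ν-1/2), and with the integral over the whole half-line, the profile would
be exactly 1. Hence it is at most 1 for ν ≥ 1/2, which gives the first part; the total bound is then
strictly below 1 for t > 0, so constants are not preserved. For -1/2 < ν < 1/2 the profile is still
bounded, but it is at least 1 + (1/2-ν)/(2u) - O(u⁻²), which exceeds 1 for large u. Keeping u in a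
compact range where this happens and letting t tend to 0, all other factors tend to 1 and the mass
exceeds 1, so contractivity fails on L^∞.

The semigroup law is Weber's second exponential integral: both Bessel series are expanded,
integrated termwise and resummed by a Chu–Vandermonde identity for Gamma quotients
(`gamma_add_add_eq_sum`). For strong continuity, f ↦ f/x_j is an isometry of L²(μ_α) onto
L²(μ_{α+e_j}) which turns the operators into e^(-2t) times product heat operators. For those, a
Korovkin argument with Gaussian test functions gives pointwise convergence, the ground state
exp(-|x|²/2) gives domination, and density of compactly supported continuous functions finishes. -/

namespace LaguerreSemigroup

/-! ### Integral operators with symmetric nonnegative kernels -/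

section Kernel

/-- The integral operator with real kernel `K`. -/
noncomputable def kernelOp {X 𝕜 : Type*} [MeasurableSpace X] [RCLike 𝕜] (μ : Measure X)
    (K : X → X → ℝ) (f : X → 𝕜) (x : X) : 𝕜 :=
  ∫ y, K x y • f y ∂μ

/-- A nonnegative symmetric measurable kernel, bounded in each variable, whose marginal masses are
at most `C`. -/
structure IsSymmKernel {X : Type*} [MeasurableSpace X] (μ : Measure X) (K : X → X → ℝ)
    (C : NNReal) : Prop where
  meas : Measurable (Function.uncurry K)
  nonneg : ∀ x y, 0 ≤ K x y
  symm : ∀ x y, K x y = K y x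
  bdd : ∀ x, ∃ M, ∀ y, K x y ≤ M
  mass : ∀ x, ∫⁻ y, ENNReal.ofReal (K x y) ∂μ ≤ C

variable {X 𝕜 : Type*} [MeasurableSpace X] [RCLike 𝕜] {μ : Measure X}

theorem MemL1AddLinf.aestronglyMeasurable {f : X → 𝕜} (hf : MemL1AddLinf μ f) :
    AEStronglyMeasurable f μ := by
  obtain ⟨g, h, hg, hh, hfe⟩ := hf
  exact (hg.1.add hh.1).congr hfe.symm

theorem MemL1AddLinf.of_memLp_top {f : X → 𝕜} (hf : MemLp f ∞ μ) : MemL1AddLinf μ f :=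
  ⟨0, f, MemLp.zero, hf, by simp⟩

theorem MemL1AddLinf.congr {f g : X → 𝕜} (hf : MemL1AddLinf μ f) (h : f =ᵐ[μ] g) :
    MemL1AddLinf μ g := by
  obtain ⟨a, b, ha, hb, hab⟩ := hf
  exact ⟨a, b, ha, hb, h.symm.trans hab⟩

/-- Truncation at height 1: where |f| > 1 one has |f| ≤ |f|^p, so that piece is in L¹, and the rest
is bounded. -/
theorem MemL1AddLinf.of_memLp {p : ℝ≥0∞} (hp : 1 ≤ p) {f : X → 𝕜} (hf : MemLp f p μ) :
    MemL1AddLinf μ f := by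
  obtain rfl | hpt := eq_or_ne p ∞
  · exact .of_memLp_top hf
  obtain ⟨f', hf'm, hff'⟩ := hf.1
  have hf' : MemLp f' p μ := hf.ae_eq hff'
  refine MemL1AddLinf.congr ?_ hff'.symm
  set s : Set X := {x | 1 < ‖f' x‖} with hs
  have hsm : MeasurableSet s := measurableSet_lt measurable_const hf'm.measurable.norm
  refine ⟨s.indicator f', sᶜ.indicator f', ?_, ?_, ?_⟩
  · refine ⟨(hf'm.indicator hsm).aestronglyMeasurable, ?_⟩
    have hp0 : p ≠ 0 := (zero_lt_one.trans_le hp).ne'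
    have hlt := (eLpNorm_lt_top_iff_lintegral_rpow_enorm_lt_top hp0 hpt).1 hf'.2
    rw [eLpNorm_one_eq_lintegral_enorm]
    refine lt_of_le_of_lt (lintegral_mono fun x => ?_) hlt
    by_cases hx : x ∈ s
    · rw [Set.indicator_of_mem hx]
      have h1 : 1 ≤ ‖f' x‖ₑ := by
        rw [← ofReal_norm, ← ENNReal.ofReal_one]
        exact ENNReal.ofReal_le_ofReal (le_of_lt hx)
      have h2 : (1 : ℝ) ≤ p.toReal := by
        rw [← ENNReal.toReal_one]; exact ENNReal.toReal_mono hpt hp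
      calc ‖f' x‖ₑ = ‖f' x‖ₑ ^ (1 : ℝ) := by simp
        _ ≤ _ := ENNReal.rpow_le_rpow_of_exponent_le h1 h2
    · rw [Set.indicator_of_notMem hx]; simp
  · refine memLp_top_of_bound (hf'm.indicator hsm.compl).aestronglyMeasurable 1
      (Eventually.of_forall fun x => ?_)
    by_cases hx : x ∈ s
    · rw [Set.indicator_of_notMem (by simpa using hx)]; simp
    · rw [Set.indicator_of_mem (by simpa using hx)]; simpa [hs] using hx
  · rw [Set.indicator_self_add_compl]

variable {K : X → X → ℝ} {C : NNReal}

theorem IsSymmKernel.measurable_right (h : IsSymmKernel μ K C) (x : X) :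
    Measurable (K x) :=
  h.meas.comp measurable_prodMk_left

theorem IsSymmKernel.measurable_left (h : IsSymmKernel μ K C) (y : X) :
    Measurable fun x => K x y :=
  h.meas.comp (measurable_id.prodMk measurable_const)

theorem IsSymmKernel.integrable_right (h : IsSymmKernel μ K C) (x : X) :
    Integrable (K x) μ := by
  refine ⟨(h.measurable_right x).aestronglyMeasurable, ?_⟩
  rw [hasFiniteIntegral_iff_ofReal (Eventually.of_forall (h.nonneg x))]
  exact (h.mass x).trans_lt ENNReal.coe_lt_top

/-- `K x` is both bounded and integrable: boundedness pairs with the L¹ part of f, integrability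
with the L^∞ part. -/
theorem IsSymmKernel.integrable (h : IsSymmKernel μ K C) {f : X → 𝕜} (hf : MemL1AddLinf μ f)
    (x : X) : Integrable (fun y => K x y • f y) μ := by
  obtain ⟨a, b, ha, hb, hab⟩ := hf
  obtain ⟨M, hM⟩ := h.bdd x
  have h1 : Integrable (fun y => K x y • a y) μ := by
    refine (memLp_one_iff_integrable.1 ha).bdd_smul M
      (h.measurable_right x).aestronglyMeasurable (Eventually.of_forall fun y => ?_)
    rw [Real.norm_of_nonneg (h.nonneg x y)]; exact hM y
  have h2 : Integrable (fun y => K x y • b y) μ := by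
    obtain ⟨B, hB⟩ : ∃ B : ℝ, ∀ᵐ y ∂μ, ‖b y‖ ≤ B := by
      have := hb.2
      rw [eLpNorm_exponent_top] at this
      refine ⟨(eLpNormEssSup b μ).toReal, ?_⟩
      filter_upwards [ae_le_eLpNormEssSup (f := b) (μ := μ)] with y hy
      rw [← toReal_enorm]
      exact ENNReal.toReal_mono this.ne hy
    exact (h.integrable_right x).smul_bdd B hb.1 hB
  refine (h1.add h2).congr ?_
  filter_upwards [hab] with y hy
  rw [hy]; simp

theorem enorm_kernelOp_le (hK : ∀ x y, 0 ≤ K x y) (f : X → 𝕜) (x : X) :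
    ‖kernelOp μ K f x‖ₑ ≤ ∫⁻ y, ENNReal.ofReal (K x y) * ‖f y‖ₑ ∂μ := by
  refine (enorm_integral_le_lintegral_enorm _).trans (lintegral_mono fun y => ?_)
  rw [enorm_smul, Real.enorm_of_nonneg (hK x y)]

theorem kernelOp_congr_ae {f g : X → 𝕜} (hfg : f =ᵐ[μ] g) : kernelOp μ K f = kernelOp μ K g := by
  funext x
  refine integral_congr_ae ?_
  filter_upwards [hfg] with y hy
  rw [hy]

theorem IsSymmKernel.kernelOp_add (h : IsSymmKernel μ K C) {f g : X → 𝕜}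
    (hf : MemL1AddLinf μ f) (hg : MemL1AddLinf μ g) :
    kernelOp μ K (f + g) = kernelOp μ K f + kernelOp μ K g := by
  funext x
  simp only [kernelOp, Pi.add_apply, smul_add]
  exact integral_add (h.integrable hf x) (h.integrable hg x)

theorem kernelOp_smul (c : 𝕜) (f : X → 𝕜) : kernelOp μ K (c • f) = c • kernelOp μ K f := by
  funext x
  simp only [kernelOp, Pi.smul_apply]
  rw [← integral_smul]
  congr 1; funext y; rw [smul_comm]

theorem IsSymmKernel.aestronglyMeasurable [SFinite μ] (h : IsSymmKernel μ K C) {f : X → 𝕜}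
    (hf : AEStronglyMeasurable f μ) : AEStronglyMeasurable (kernelOp μ K f) μ := by
  rw [kernelOp_congr_ae hf.ae_eq_mk]
  refine StronglyMeasurable.aestronglyMeasurable ?_
  refine StronglyMeasurable.integral_prod_right' (f := fun z : X × X => K z.1 z.2 • hf.mk f z.2) ?_
  exact h.meas.stronglyMeasurable.smul (hf.stronglyMeasurable_mk.comp_measurable measurable_snd)

theorem IsSymmKernel.isLinearOperator [SFinite μ] (h : IsSymmKernel μ K C) :
    IsLinearOperator μ (kernelOp (𝕜 := 𝕜) μ K) where
  measurable f hf := h.aestronglyMeasurable hf.aestronglyMeasurable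
  congr_ae f g _ hfg := by rw [kernelOp_congr_ae hfg]
  map_add f g hf hg := by rw [h.kernelOp_add hf hg]
  map_smul c f _ := by rw [kernelOp_smul]

/-- Tonelli together with the bound on the marginal masses. -/
theorem IsSymmKernel.lintegral_lintegral_le [SFinite μ] (h : IsSymmKernel μ K C) {g : X → ℝ≥0∞}
    (hg : Measurable g) :
    ∫⁻ x, ∫⁻ y, ENNReal.ofReal (K x y) * g y ∂μ ∂μ ≤ C * ∫⁻ y, g y ∂μ := by
  have hm : Measurable fun z : X × X => ENNReal.ofReal (K z.1 z.2) := h.meas.ennreal_ofReal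
  rw [lintegral_lintegral_swap ((hm.mul (hg.comp measurable_snd)).aemeasurable)]
  rw [← lintegral_const_mul _ hg]
  refine lintegral_mono fun y => ?_
  rw [lintegral_mul_const _ (h.measurable_left y).ennreal_ofReal]
  gcongr
  simp_rw [fun x => h.symm x y]
  exact h.mass y

/-- Hölder's inequality against the constant 1 for the measure K(x,·)μ, whose total mass is at most
C. -/
theorem IsSymmKernel.lintegral_mul_rpow_le (h : IsSymmKernel μ K C) {g : X → ℝ≥0∞}
    (hg : Measurable g) {p : ℝ} (hp : 1 ≤ p) (x : X) :
    (∫⁻ y, ENNReal.ofReal (K x y) * g y ∂μ) ^ p ≤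
      C ^ (p - 1) * ∫⁻ y, ENNReal.ofReal (K x y) * g y ^ p ∂μ := by
  have hk : Measurable fun y => ENNReal.ofReal (K x y) := (h.measurable_right x).ennreal_ofReal
  obtain rfl | hp1 := hp.eq_or_lt
  · simp
  set ν := μ.withDensity fun y => ENNReal.ofReal (K x y)
  have e1 : ∫⁻ y, ENNReal.ofReal (K x y) * g y ∂μ = ∫⁻ y, g y ∂ν :=
    (lintegral_withDensity_eq_lintegral_mul _ hk hg).symm
  have e2 : ∫⁻ y, ENNReal.ofReal (K x y) * g y ^ p ∂μ = ∫⁻ y, g y ^ p ∂ν :=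
    (lintegral_withDensity_eq_lintegral_mul _ hk (hg.pow_const p)).symm
  have e3 : ν Set.univ ≤ C := by
    rw [withDensity_apply _ MeasurableSet.univ, Measure.restrict_univ]; exact h.mass x
  have hpq := Real.HolderConjugate.conjExponent hp1
  have hH := ENNReal.lintegral_mul_le_Lp_mul_Lq ν hpq hg.aemeasurable
    (g := fun _ => 1) aemeasurable_const
  simp only [Pi.mul_apply, mul_one, ENNReal.one_rpow, lintegral_const, one_mul] at hH
  rw [e1, e2]
  calc (∫⁻ y, g y ∂ν) ^ p
      ≤ ((∫⁻ y, g y ^ p ∂ν) ^ (1 / p) * ν Set.univ ^ (1 / p.conjExponent)) ^ p := by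
        gcongr
    _ = (∫⁻ y, g y ^ p ∂ν) * ν Set.univ ^ (p - 1) := by
        rw [ENNReal.mul_rpow_of_nonneg _ _ (by linarith), ← ENNReal.rpow_mul, ← ENNReal.rpow_mul,
          one_div_mul_cancel (by linarith), ENNReal.rpow_one]
        congr 2
        rw [Real.conjExponent]
        have : p - 1 ≠ 0 := by linarith
        field_simp
    _ ≤ C ^ (p - 1) * ∫⁻ y, g y ^ p ∂ν := by
        rw [mul_comm]
        gcongr

/-- Schur's test. -/
theorem IsSymmKernel.eLpNorm_le [SFinite μ] (h : IsSymmKernel μ K C) {p : ℝ≥0∞} (hp : 1 ≤ p)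
    {f : X → 𝕜} (hf : AEStronglyMeasurable f μ) :
    eLpNorm (kernelOp μ K f) p μ ≤ C * eLpNorm f p μ := by
  rw [kernelOp_congr_ae hf.ae_eq_mk, eLpNorm_congr_ae hf.ae_eq_mk]
  have hfm := hf.stronglyMeasurable_mk
  generalize hf.mk f = f at hfm
  have hg : Measurable fun y => ‖f y‖ₑ := hfm.measurable.enorm
  obtain rfl | hpt := eq_or_ne p ∞
  · rw [eLpNorm_exponent_top, eLpNorm_exponent_top]
    refine essSup_le_of_ae_le _ (Eventually.of_forall fun x => ?_)
    refine (enorm_kernelOp_le h.nonneg f x).trans ?_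
    calc ∫⁻ y, ENNReal.ofReal (K x y) * ‖f y‖ₑ ∂μ
        ≤ ∫⁻ y, ENNReal.ofReal (K x y) * eLpNormEssSup f μ ∂μ := by
          refine lintegral_mono_ae ?_
          filter_upwards [ae_le_eLpNormEssSup (f := f) (μ := μ)] with y hy
          gcongr
      _ ≤ C * eLpNormEssSup f μ := by
          rw [lintegral_mul_const _ (h.measurable_right x).ennreal_ofReal]
          gcongr
          exact h.mass x
  · have hp0 : p ≠ 0 := (zero_lt_one.trans_le hp).ne'
    have hp1 : (1 : ℝ) ≤ p.toReal := by
      rw [← ENNReal.toReal_one]; exact ENNReal.toReal_mono hpt hp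
    have hpp : 0 < p.toReal := by linarith
    rw [eLpNorm_eq_lintegral_rpow_enorm_toReal hp0 hpt,
      eLpNorm_eq_lintegral_rpow_enorm_toReal hp0 hpt]
    have key : ∫⁻ x, ‖kernelOp μ K f x‖ₑ ^ p.toReal ∂μ ≤
        (C : ℝ≥0∞) ^ p.toReal * ∫⁻ x, ‖f x‖ₑ ^ p.toReal ∂μ := by
      calc ∫⁻ x, ‖kernelOp μ K f x‖ₑ ^ p.toReal ∂μ
          ≤ ∫⁻ x, (C : ℝ≥0∞) ^ (p.toReal - 1) *
              ∫⁻ y, ENNReal.ofReal (K x y) * ‖f y‖ₑ ^ p.toReal ∂μ ∂μ := by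
            refine lintegral_mono fun x => ?_
            refine le_trans ?_ (h.lintegral_mul_rpow_le hg hp1 x)
            gcongr
            exact enorm_kernelOp_le h.nonneg f x
        _ ≤ (C : ℝ≥0∞) ^ (p.toReal - 1) * (C * ∫⁻ y, ‖f y‖ₑ ^ p.toReal ∂μ) := by
            rw [lintegral_const_mul']
            · gcongr
              exact h.lintegral_lintegral_le (hg.pow_const _)
            · exact ENNReal.rpow_ne_top_of_nonneg (by linarith) ENNReal.coe_ne_top
        _ = _ := by
            rw [← mul_assoc]
            congr 1
            nth_rewrite 2 [← ENNReal.rpow_one (C : ℝ≥0∞)]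
            rw [← ENNReal.rpow_add_of_nonneg _ _ (by linarith) zero_le_one, sub_add_cancel]
    calc _ ≤ ((C : ℝ≥0∞) ^ p.toReal * ∫⁻ x, ‖f x‖ₑ ^ p.toReal ∂μ) ^ (1 / p.toReal) := by
          gcongr
      _ = _ := by
          rw [ENNReal.mul_rpow_of_nonneg _ _ (by positivity), ← ENNReal.rpow_mul,
            mul_one_div_cancel hpp.ne', ENNReal.rpow_one]

theorem IsSymmKernel.memLp [SFinite μ] (h : IsSymmKernel μ K C) {p : ℝ≥0∞} (hp : 1 ≤ p)
    {f : X → 𝕜} (hf : MemLp f p μ) : MemLp (kernelOp μ K f) p μ :=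
  ⟨h.aestronglyMeasurable hf.1, (h.eLpNorm_le hp hf.1).trans_lt
    (ENNReal.mul_lt_top ENNReal.coe_lt_top hf.2)⟩

theorem kernelOp_ofReal (f : X → ℝ) (x : X) :
    kernelOp μ K (fun y => (f y : 𝕜)) x = ((kernelOp μ K f x : ℝ) : 𝕜) := by
  rw [kernelOp, kernelOp, ← integral_ofReal]
  congr 1; funext y
  rw [smul_eq_mul, RCLike.ofReal_mul, RCLike.real_smul_eq_coe_mul]

theorem kernelOp_nonneg (hK : ∀ x y, 0 ≤ K x y) {f : X → 𝕜} (hf : ∀ᵐ x ∂μ, 0 ≤ f x) (x : X) :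
    0 ≤ kernelOp μ K f x := by
  have : f =ᵐ[μ] fun y => ((RCLike.re (f y) : ℝ) : 𝕜) := by
    filter_upwards [hf] with y hy
    exact ((RCLike.nonneg_iff_exists_ofReal).1 hy).elim fun a ha => by rw [← ha.2]; simp
  rw [kernelOp_congr_ae this, kernelOp_ofReal, RCLike.ofReal_nonneg]
  refine integral_nonneg_of_ae ?_
  filter_upwards [hf] with y hy
  exact mul_nonneg (hK x y) (RCLike.nonneg_iff.1 hy).1

theorem IsSymmKernel.ofReal_kernelOp_one (h : IsSymmKernel μ K C) (x : X) :
    ENNReal.ofReal (kernelOp μ K (fun _ => (1 : ℝ)) x) = ∫⁻ y, ENNReal.ofReal (K x y) ∂μ := by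
  simp only [kernelOp, smul_eq_mul, mul_one]
  rw [ofReal_integral_eq_lintegral_ofReal (h.integrable_right x)
    (Eventually.of_forall (h.nonneg x))]

theorem IsSymmKernel.kernelOp_one_le (h : IsSymmKernel μ K C) (x : X) :
    kernelOp μ K (fun _ => (1 : ℝ)) x ≤ C := by
  have := (h.ofReal_kernelOp_one x).trans_le (h.mass x)
  exact_mod_cast (ENNReal.ofReal_le_iff_le_toReal ENNReal.coe_ne_top).1 this

/-- The Fubini hypothesis for self-adjointness. Integrating the norm in y leaves the operator
applied to |f|, times |g|, a product of two L² functions. -/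
theorem IsSymmKernel.integrable_prod [SFinite μ] (h : IsSymmKernel μ K C) {f g : X → 𝕜}
    (hf : MemLp f 2 μ) (hg : MemLp g 2 μ) :
    Integrable (fun z : X × X => K z.1 z.2 • f z.2 * star (g z.1)) (μ.prod μ) := by
  have hm : AEStronglyMeasurable (fun z : X × X => K z.1 z.2 • f z.2 * star (g z.1)) (μ.prod μ) :=
    (h.meas.aestronglyMeasurable.smul (hf.1.comp_snd)).mul
      (continuous_star.comp_aestronglyMeasurable hg.1.comp_fst)
  rw [integrable_prod_iff hm]
  constructor
  · refine Eventually.of_forall fun x => ?_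
    exact (h.integrable (.of_memLp (by norm_num) hf) x).mul_const (star (g x))
  · have hn : MemLp (fun y => ‖f y‖) 2 μ := hf.norm
    have := (h.memLp (by norm_num) hn).integrable_mul (hg.norm)
    refine this.congr (Eventually.of_forall fun x => ?_)
    simp only [kernelOp, Pi.mul_apply, norm_mul, norm_smul, norm_star, smul_eq_mul]
    rw [integral_mul_const]
    congr 2; funext y
    rw [Real.norm_of_nonneg (h.nonneg x y)]

theorem IsSymmKernel.selfAdjoint [SFinite μ] (h : IsSymmKernel μ K C) {f g : X → 𝕜}
    (hf : MemLp f 2 μ) (hg : MemLp g 2 μ) :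
    ∫ x, kernelOp μ K f x * star (g x) ∂μ = ∫ x, f x * star (kernelOp μ K g x) ∂μ := by
  have e1 : ∫ x, kernelOp μ K f x * star (g x) ∂μ =
      ∫ x, ∫ y, K x y • f y * star (g x) ∂μ ∂μ := by
    congr 1; funext x
    rw [kernelOp, integral_mul_const]
  rw [e1, integral_integral_swap (h.integrable_prod hf hg)]
  congr 1; funext y
  rw [kernelOp, RCLike.star_def, ← integral_conj, ← integral_const_mul]
  congr 1; funext x
  rw [h.symm x y, RCLike.conj_smul, mul_smul_comm, smul_mul_assoc]

/-- Stating the composition rule as a lower integral supplies the integrability of y ↦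
K₁(x,y)K₂(y,z) as well as its value; the dominating function for Fubini is then K(x,·)|f|. -/
theorem IsSymmKernel.kernelOp_comp [SFinite μ] {K₁ K₂ : X → X → ℝ} {C₁ C₂ : NNReal}
    (h : IsSymmKernel μ K C)
    (h₁ : IsSymmKernel μ K₁ C₁) (h₂ : IsSymmKernel μ K₂ C₂)
    (hcomp : ∀ x z, ∫⁻ y, ENNReal.ofReal (K₁ x y) * ENNReal.ofReal (K₂ y z) ∂μ =
      ENNReal.ofReal (K x z)) {f : X → 𝕜} (hf : MemL1AddLinf μ f) :
    kernelOp μ K f = kernelOp μ K₁ (kernelOp μ K₂ f) := by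
  have hcompR : ∀ x z, ∫ y, K₁ x y * K₂ y z ∂μ = K x z := by
    intro x z
    rw [integral_eq_lintegral_of_nonneg_ae
      (Eventually.of_forall fun y => mul_nonneg (h₁.nonneg _ _) (h₂.nonneg _ _))
      ((h₁.measurable_right x).mul (h₂.measurable_left z)).aestronglyMeasurable]
    simp_rw [ENNReal.ofReal_mul (h₁.nonneg x _), hcomp, ENNReal.toReal_ofReal (h.nonneg x z)]
  have hcompI : ∀ x z, Integrable (fun y => K₁ x y * K₂ y z) μ := by
    intro x z
    refine ⟨((h₁.measurable_right x).mul (h₂.measurable_left z)).aestronglyMeasurable, ?_⟩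
    rw [hasFiniteIntegral_iff_ofReal
      (Eventually.of_forall fun y => mul_nonneg (h₁.nonneg _ _) (h₂.nonneg _ _))]
    simp_rw [ENNReal.ofReal_mul (h₁.nonneg x _), hcomp]
    exact ENNReal.ofReal_lt_top
  funext x
  have hI : Integrable (fun w : X × X => K₁ x w.1 • K₂ w.1 w.2 • f w.2) (μ.prod μ) := by
    have hm : AEStronglyMeasurable (fun w : X × X => K₁ x w.1 • K₂ w.1 w.2 • f w.2) (μ.prod μ) :=
      ((h₁.measurable_right x).comp measurable_fst).aestronglyMeasurable.smul
        (h₂.meas.aestronglyMeasurable.smul (hf.aestronglyMeasurable.comp_snd))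
    rw [integrable_prod_iff' hm]
    constructor
    · refine Eventually.of_forall fun z => ?_
      simp only [smul_smul]
      exact (hcompI x z).smul_const (f z)
    · refine (h.integrable hf x).norm.congr (Eventually.of_forall fun z => ?_)
      simp only [smul_smul, norm_smul]
      rw [integral_mul_const, Real.norm_of_nonneg (h.nonneg x z), ← hcompR x z]
      congr 2; funext y
      rw [Real.norm_of_nonneg (mul_nonneg (h₁.nonneg _ _) (h₂.nonneg _ _))]
  have e : kernelOp μ K₁ (kernelOp μ K₂ f) x = ∫ y, ∫ z, K₁ x y • K₂ y z • f z ∂μ ∂μ := by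
    simp only [kernelOp, integral_smul]
  rw [e, integral_integral_swap hI, kernelOp]
  congr 1; funext z
  simp only [smul_smul]
  rw [integral_smul_const, hcompR]

/-- If the integral operator is a contraction on `L^∞` (tested on `L² ∩ L^∞`), then the marginal
masses are at most one. -/
theorem IsSymmKernel.mass_le_one_of_contractive [SigmaFinite μ] (h : IsSymmKernel μ K C)
    (hc : ∀ f : X → 𝕜, MemLp f 2 μ → MemLp f ∞ μ → eLpNorm (kernelOp μ K f) ∞ μ ≤ eLpNorm f ∞ μ) :
    ∀ᵐ x ∂μ, ∫⁻ y, ENNReal.ofReal (K x y) ∂μ ≤ 1 := by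
  -- The constant 1 need not lie in L², so contractivity is tested on indicators of an exhaustion by
  -- sets of finite measure; monotone convergence then recovers the full mass.
  set A := spanningSets μ
  have hA : ∀ n, MeasurableSet (A n) := measurableSet_spanningSets μ
  have key : ∀ n, ∀ᵐ x ∂μ, ∫⁻ y in A n, ENNReal.ofReal (K x y) ∂μ ≤ 1 := by
    intro n
    set f : X → 𝕜 := (A n).indicator fun _ => 1
    have hμ : μ (A n) ≠ ∞ := (measure_spanningSets_lt_top μ n).ne
    have hle : eLpNorm f ∞ μ ≤ 1 := by
      rw [eLpNorm_exponent_top]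
      refine essSup_le_of_ae_le _ (Eventually.of_forall fun x => ?_)
      by_cases hx : x ∈ A n <;> simp [f, hx]
    have h1 := (hc f (memLp_indicator_const 2 (hA n) 1 (Or.inr hμ))
      (memLp_indicator_const ∞ (hA n) 1 (Or.inr hμ))).trans hle
    rw [eLpNorm_exponent_top] at h1
    filter_upwards [ae_le_eLpNormEssSup (f := kernelOp μ K f) (μ := μ)] with x hx
    have hx := hx.trans h1
    have e : kernelOp μ K f x = ((∫ y in A n, K x y ∂μ : ℝ) : 𝕜) := by
      have : f = fun y => (((A n).indicator (fun _ => (1 : ℝ)) y : ℝ) : 𝕜) := by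
        funext y
        by_cases hy : y ∈ A n <;> simp [f, hy]
      rw [this, kernelOp_ofReal, ← integral_indicator (hA n), kernelOp]
      congr 2; funext y
      by_cases hy : y ∈ A n <;> simp [hy]
    rw [← ofReal_integral_eq_lintegral_ofReal (h.integrable_right x).integrableOn
      (Eventually.of_forall (h.nonneg x))]
    rw [e] at hx
    refine le_trans (le_of_eq ?_) hx
    rw [← ofReal_norm, RCLike.norm_ofReal, abs_of_nonneg]
    exact integral_nonneg (h.nonneg x)
  filter_upwards [ae_all_iff.2 key] with x hx
  have : ∫⁻ y, ENNReal.ofReal (K x y) ∂μ =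
      ⨆ n, ∫⁻ y in A n, ENNReal.ofReal (K x y) ∂μ := by
    rw [← setLIntegral_iUnion_of_directed _ (monotone_spanningSets μ).directed_le]
    rw [iUnion_spanningSets, Measure.restrict_univ]
  rw [this]
  exact iSup_le hx

end Kernel

/-! ### The one-dimensional kernels -/

/-! ### Bessel series and Gamma-function identities -/

section Series

/-- The entire function `∑ z^k / (k! Γ(k + ν + 1))`, so that `I_ν(z) = (z/2)^ν F((z/2)²)`. -/
noncomputable def besselSeries (ν z : ℝ) : ℝ :=
  ∑' k : ℕ, z ^ k / ((k.factorial : ℝ) * Real.Gamma ((k : ℝ) + ν + 1))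

theorem gamma_nat_add_pos {ν : ℝ} (hν : -1 < ν) (k : ℕ) : 0 < Real.Gamma ((k : ℝ) + ν + 1) :=
  Real.Gamma_pos_of_pos (by have : (0 : ℝ) ≤ k := k.cast_nonneg; linarith)

/-- The Gamma factor alone makes the series converge. The version without k! is needed because a
Gaussian uses up the factorial in `besselSeries_mul_exp_le`. -/
theorem summable_pow_div_gamma {ν : ℝ} (hν : -1 < ν) {w : ℝ} (hw : 0 ≤ w) :
    Summable fun k : ℕ => w ^ k / Real.Gamma ((k : ℝ) + ν + 1) := by
  refine summable_of_ratio_norm_eventually_le (r := 1 / 2) (by norm_num) ?_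
  filter_upwards [eventually_ge_atTop (⌈2 * w⌉₊ + 1)] with k hk
  have hk' : 2 * w + 1 ≤ k := by
    calc 2 * w + 1 ≤ ⌈2 * w⌉₊ + 1 := by gcongr; exact Nat.le_ceil _
      _ ≤ k := by exact_mod_cast hk
  have hpos : 0 < (k : ℝ) + ν + 1 := by linarith
  have hG := gamma_nat_add_pos hν k
  have e : Real.Gamma (((k + 1 : ℕ) : ℝ) + ν + 1) =
      ((k : ℝ) + ν + 1) * Real.Gamma ((k : ℝ) + ν + 1) := by
    rw [← Real.Gamma_add_one hpos.ne']; push_cast; ring_nf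
  rw [e, Real.norm_of_nonneg (by positivity), Real.norm_of_nonneg (by positivity), pow_succ,
    mul_comm (w ^ k) w, mul_div_mul_comm]
  refine mul_le_mul_of_nonneg_right ?_ (by positivity)
  rw [div_le_iff₀ hpos]; linarith

theorem besselSeries_term_nonneg {ν : ℝ} (hν : -1 < ν) {z : ℝ} (hz : 0 ≤ z) (k : ℕ) :
    0 ≤ z ^ k / ((k.factorial : ℝ) * Real.Gamma ((k : ℝ) + ν + 1)) := by
  have := gamma_nat_add_pos hν k
  positivity

theorem summable_besselSeries {ν : ℝ} (hν : -1 < ν) {z : ℝ} (hz : 0 ≤ z) :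
    Summable fun k : ℕ => z ^ k / ((k.factorial : ℝ) * Real.Gamma ((k : ℝ) + ν + 1)) := by
  refine (summable_pow_div_gamma hν hz).of_nonneg_of_le (besselSeries_term_nonneg hν hz) fun k => ?_
  have := gamma_nat_add_pos hν k
  gcongr
  exact le_mul_of_one_le_left this.le (by exact_mod_cast k.factorial_pos)

theorem besselSeries_nonneg {ν : ℝ} (hν : -1 < ν) {z : ℝ} (hz : 0 ≤ z) : 0 ≤ besselSeries ν z :=
  tsum_nonneg (besselSeries_term_nonneg hν hz)

theorem ofReal_besselSeries {ν : ℝ} (hν : -1 < ν) {z : ℝ} (hz : 0 ≤ z) :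
    ENNReal.ofReal (besselSeries ν z) =
      ∑' k : ℕ, ENNReal.ofReal (z ^ k / ((k.factorial : ℝ) * Real.Gamma ((k : ℝ) + ν + 1))) :=
  ENNReal.ofReal_tsum_of_nonneg (besselSeries_term_nonneg hν hz) (summable_besselSeries hν hz)

theorem measurable_besselSeries_sq {ν : ℝ} (hν : -1 < ν) :
    Measurable fun z : ℝ => besselSeries ν (z ^ 2) := by
  have : (fun z : ℝ => besselSeries ν (z ^ 2)) = fun z => (∑' k : ℕ, ENNReal.ofReal
      ((z ^ 2) ^ k / ((k.factorial : ℝ) * Real.Gamma ((k : ℝ) + ν + 1)))).toReal := by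
    funext z
    rw [← ofReal_besselSeries hν (sq_nonneg z),
      ENNReal.toReal_ofReal (besselSeries_nonneg hν (sq_nonneg z))]
  rw [this]
  refine (Measurable.tsum fun k => ?_).ennreal_toReal
  fun_prop

theorem besselI_eq (ν : ℝ) {z : ℝ} (hz : 0 < z) :
    besselI ν z = (z / 2) ^ ν * besselSeries ν ((z / 2) ^ 2) := by
  rw [besselI, besselSeries, ← tsum_mul_left]
  congr 1; funext k
  rw [Real.rpow_add (by positivity), ← pow_mul, ← Real.rpow_natCast]
  push_cast
  ring

/-- Termwise, (b y²)^k/k! ≤ exp(b y²), so the bound does not depend on y. -/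
theorem besselSeries_mul_exp_le {ν : ℝ} (hν : -1 < ν) {w b : ℝ} (hw : 0 ≤ w) (hb : 0 < b) (y : ℝ) :
    besselSeries ν (w * y ^ 2) * Real.exp (-b * y ^ 2) ≤
      ∑' k : ℕ, (w / b) ^ k / Real.Gamma ((k : ℝ) + ν + 1) := by
  have hz : 0 ≤ w * y ^ 2 := by positivity
  rw [besselSeries, ← tsum_mul_right]
  refine Summable.tsum_le_tsum (fun k => ?_) ((summable_besselSeries hν hz).mul_right _)
    (summable_pow_div_gamma hν (by positivity))
  have hG := gamma_nat_add_pos hν k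
  have h1 := Real.pow_div_factorial_le_exp (x := b * y ^ 2) (by positivity) k
  have h2 : Real.exp (b * y ^ 2) * Real.exp (-b * y ^ 2) = 1 := by
    rw [← Real.exp_add]; simp
  calc (w * y ^ 2) ^ k / ((k.factorial : ℝ) * Real.Gamma ((k : ℝ) + ν + 1))
        * Real.exp (-b * y ^ 2)
      = (w / b) ^ k / Real.Gamma ((k : ℝ) + ν + 1) *
        ((b * y ^ 2) ^ k / (k.factorial : ℝ) * Real.exp (-b * y ^ 2)) := by
        rw [mul_pow, mul_pow, div_pow]
        field_simp
    _ ≤ (w / b) ^ k / Real.Gamma ((k : ℝ) + ν + 1) *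
        (Real.exp (b * y ^ 2) * Real.exp (-b * y ^ 2)) := by gcongr
    _ = _ := by rw [h2, mul_one]

/-- A Chu–Vandermonde identity, by induction on l. Pascal's rule splits the sum for l+1 into the sum
for (k, l, c) and, after absorbing a factor k, the sum for (k-1, l, c+1); hence k and c stay
universally quantified in the induction. -/
theorem gamma_add_add_eq_sum {l : ℕ} : ∀ {k : ℕ} {c : ℝ}, 0 < c →
    Real.Gamma ((k : ℝ) + l + c) / (Real.Gamma ((k : ℝ) + c) * Real.Gamma ((l : ℝ) + c)) =
      ∑ m ∈ Finset.range (l + 1),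
        (k.choose m : ℝ) * (l.choose m : ℝ) * (m.factorial : ℝ) / Real.Gamma ((m : ℝ) + c) := by
  induction l with
  | zero =>
    intro k c hc
    have h1 : Real.Gamma ((k : ℝ) + c) ≠ 0 := (Real.Gamma_pos_of_pos (by positivity)).ne'
    simp only [Nat.cast_zero, add_zero, zero_add, Finset.range_one, Finset.sum_singleton,
      Nat.choose_zero_right, Nat.cast_one, Nat.factorial_zero, mul_one]
    field_simp
  | succ l ih =>
    intro k c hc
    have hlc : 0 < (l : ℝ) + c := by positivity
    have hGl : Real.Gamma ((l : ℝ) + c) ≠ 0 := (Real.Gamma_pos_of_pos hlc).ne'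
    have hGk : Real.Gamma ((k : ℝ) + c) ≠ 0 := (Real.Gamma_pos_of_pos (by positivity)).ne'
    have el : Real.Gamma (((l + 1 : ℕ) : ℝ) + c) = ((l : ℝ) + c) * Real.Gamma ((l : ℝ) + c) := by
      rw [← Real.Gamma_add_one hlc.ne']; push_cast; ring_nf
    have ekl : Real.Gamma ((k : ℝ) + (l + 1 : ℕ) + c) =
        ((k : ℝ) + l + c) * Real.Gamma ((k : ℝ) + l + c) := by
      rw [← Real.Gamma_add_one (by positivity)]; push_cast; ring_nf
    have hsplit : ∑ m ∈ Finset.range (l + 1 + 1),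
        (k.choose m : ℝ) * ((l + 1).choose m : ℝ) * (m.factorial : ℝ) / Real.Gamma ((m : ℝ) + c) =
        ∑ m ∈ Finset.range (l + 1),
          (k.choose m : ℝ) * (l.choose m : ℝ) * (m.factorial : ℝ) / Real.Gamma ((m : ℝ) + c) +
        ∑ m ∈ Finset.range (l + 1), (k.choose (m + 1) : ℝ) * (l.choose m : ℝ) *
          ((m + 1).factorial : ℝ) / Real.Gamma (((m + 1 : ℕ) : ℝ) + c) := by
      rw [Finset.sum_range_succ' (n := l + 1), Finset.sum_range_succ' (fun m => (k.choose m : ℝ) *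
        (l.choose m : ℝ) * (m.factorial : ℝ) / Real.Gamma ((m : ℝ) + c)) l]
      -- The range can be enlarged by one because the added term carries the zero coefficient
      -- `l.choose (l + 1)`.
      have : ∑ m ∈ Finset.range l, (k.choose (m + 1) : ℝ) * (l.choose (m + 1) : ℝ) *
          ((m + 1).factorial : ℝ) / Real.Gamma (((m + 1 : ℕ) : ℝ) + c) =
          ∑ m ∈ Finset.range (l + 1), (k.choose (m + 1) : ℝ) * (l.choose (m + 1) : ℝ) *
          ((m + 1).factorial : ℝ) / Real.Gamma (((m + 1 : ℕ) : ℝ) + c) := by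
        rw [Finset.sum_range_succ, Nat.choose_succ_self]; simp
      rw [this]
      simp only [Nat.choose_zero_right]
      rw [add_right_comm, ← Finset.sum_add_distrib]
      congr 1
      refine Finset.sum_congr rfl fun m _ => ?_
      rw [Nat.choose_succ_succ l m]; push_cast; ring
    rw [hsplit, ← ih hc, ekl, el]
    rcases k with _ | k
    · simp only [Nat.choose_zero_succ, Nat.cast_zero, zero_mul, zero_div, Finset.sum_const_zero,
        add_zero, zero_add]
      field_simp
    · have hk : ∑ m ∈ Finset.range (l + 1), ((k + 1).choose (m + 1) : ℝ) * (l.choose m : ℝ) *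
          ((m + 1).factorial : ℝ) / Real.Gamma (((m + 1 : ℕ) : ℝ) + c) =
          ((k : ℝ) + 1) * (Real.Gamma ((k : ℝ) + l + (c + 1)) /
            (Real.Gamma ((k : ℝ) + (c + 1)) * Real.Gamma ((l : ℝ) + (c + 1)))) := by
        rw [ih (by positivity), Finset.mul_sum]
        refine Finset.sum_congr rfl fun m _ => ?_
        have h1 : ((k : ℝ) + 1) * (k.choose m : ℝ) =
            ((k + 1).choose (m + 1) : ℝ) * ((m : ℝ) + 1) := by
          exact_mod_cast Nat.add_one_mul_choose_eq k m
        have h2 : (((m + 1 : ℕ) : ℝ) + c) = (m : ℝ) + (c + 1) := by push_cast; ring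
        rw [h2, Nat.factorial_succ]
        push_cast
        linear_combination (-(l.choose m : ℝ) * (m.factorial : ℝ) / Real.Gamma ((m : ℝ) + (c + 1))) * h1
      have e1 : (k : ℝ) + l + (c + 1) = ((k + 1 : ℕ) : ℝ) + l + c := by push_cast; ring
      have e2 : (k : ℝ) + (c + 1) = ((k + 1 : ℕ) : ℝ) + c := by push_cast; ring
      have e3 : (l : ℝ) + (c + 1) = ((l + 1 : ℕ) : ℝ) + c := by push_cast; ring
      rw [hk, e1, e2, e3, el]
      field_simp
      push_cast
      ring

theorem tsum_ofReal_pow_div_factorial {u : ℝ} (hu : 0 ≤ u) :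
    ∑' k : ℕ, ENNReal.ofReal (u ^ k / (k.factorial : ℝ)) = ENNReal.ofReal (Real.exp u) := by
  rw [← ENNReal.ofReal_tsum_of_nonneg (f := fun k : ℕ => u ^ k / (k.factorial : ℝ))
    (fun k => by positivity) (Real.summable_pow_div_factorial u),
    Real.exp_eq_exp_ℝ, NormedSpace.exp_eq_tsum_div]

/-- Only k ≥ m contributes, and the shift k ↦ k + m turns the remaining series into an exponential.
-/
theorem tsum_ofReal_pow_div_factorial_mul_choose {u : ℝ} (hu : 0 ≤ u) (m : ℕ) :
    ∑' k : ℕ, ENNReal.ofReal (u ^ k / (k.factorial : ℝ) * (k.choose m : ℝ)) =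
      ENNReal.ofReal (u ^ m / (m.factorial : ℝ) * Real.exp u) := by
  rw [← Summable.sum_add_tsum_nat_add' (k := m) ENNReal.summable]
  have h0 : ∑ k ∈ Finset.range m, ENNReal.ofReal (u ^ k / (k.factorial : ℝ) * (k.choose m : ℝ))
      = 0 :=
    Finset.sum_eq_zero fun k hk => by
      rw [Nat.choose_eq_zero_of_lt (Finset.mem_range.1 hk)]; simp
  rw [h0, zero_add, ENNReal.ofReal_mul (by positivity), ← tsum_ofReal_pow_div_factorial hu,
    ← ENNReal.tsum_mul_left]
  congr 1; funext k
  rw [← ENNReal.ofReal_mul (by positivity)]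
  congr 1
  have h1 : ((k + m).choose m : ℝ) * (m.factorial : ℝ) * (k.factorial : ℝ) =
      ((k + m).factorial : ℝ) := by
    have := Nat.choose_mul_factorial_mul_factorial (Nat.le_add_left m k)
    rw [Nat.add_sub_cancel] at this
    exact_mod_cast this
  rw [← h1, pow_add]
  have : ((k + m).choose m : ℝ) ≠ 0 := by
    exact_mod_cast (Nat.choose_pos (Nat.le_add_left m k)).ne'
  field_simp

/-- The generating function identity behind the Chapman–Kolmogorov equation. -/
theorem tsum_tsum_gamma_eq {ν u v : ℝ} (hν : -1 < ν) (hu : 0 ≤ u) (hv : 0 ≤ v) :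
    ∑' k : ℕ, ∑' l : ℕ, ENNReal.ofReal (u ^ k / (k.factorial : ℝ) * (v ^ l / (l.factorial : ℝ)) *
      (Real.Gamma ((k : ℝ) + l + (ν + 1)) /
        (Real.Gamma ((k : ℝ) + (ν + 1)) * Real.Gamma ((l : ℝ) + (ν + 1))))) =
      ENNReal.ofReal (Real.exp (u + v) * besselSeries ν (u * v)) := by
  have hc : 0 < ν + 1 := by linarith
  have hG : ∀ m : ℕ, 0 < Real.Gamma ((m : ℝ) + (ν + 1)) :=
    fun m => Real.Gamma_pos_of_pos (by positivity)
  -- The finite sum over m separates k from l; extended to all m by zeros, it can be moved outermost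
  -- by Tonelli, and the sums over k and l become exponential series.
  have e : ∀ k l : ℕ, ENNReal.ofReal (u ^ k / (k.factorial : ℝ) * (v ^ l / (l.factorial : ℝ)) *
      (Real.Gamma ((k : ℝ) + l + (ν + 1)) /
        (Real.Gamma ((k : ℝ) + (ν + 1)) * Real.Gamma ((l : ℝ) + (ν + 1))))) =
      ∑' m : ℕ, ENNReal.ofReal (u ^ k / (k.factorial : ℝ) * (k.choose m : ℝ)) *
        (ENNReal.ofReal (v ^ l / (l.factorial : ℝ) * (l.choose m : ℝ)) *
          ENNReal.ofReal ((m.factorial : ℝ) / Real.Gamma ((m : ℝ) + (ν + 1)))) := by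
    intro k l
    rw [tsum_eq_sum (s := Finset.range (l + 1)), gamma_add_add_eq_sum hc, Finset.mul_sum,
      ENNReal.ofReal_sum_of_nonneg]
    · refine Finset.sum_congr rfl fun m _ => ?_
      rw [← ENNReal.ofReal_mul (by positivity), ← ENNReal.ofReal_mul (by positivity)]
      congr 1; ring
    · intro m _
      have := hG m
      positivity
    · intro m hm
      rw [Nat.choose_eq_zero_of_lt (n := l) (by simpa using hm)]; simp
  simp_rw [e]
  calc ∑' k : ℕ, ∑' l : ℕ, ∑' m : ℕ,
        ENNReal.ofReal (u ^ k / (k.factorial : ℝ) * (k.choose m : ℝ)) *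
        (ENNReal.ofReal (v ^ l / (l.factorial : ℝ) * (l.choose m : ℝ)) *
          ENNReal.ofReal ((m.factorial : ℝ) / Real.Gamma ((m : ℝ) + (ν + 1))))
      = ∑' m : ℕ, ∑' k : ℕ, ∑' l : ℕ,
        ENNReal.ofReal (u ^ k / (k.factorial : ℝ) * (k.choose m : ℝ)) *
        (ENNReal.ofReal (v ^ l / (l.factorial : ℝ) * (l.choose m : ℝ)) *
          ENNReal.ofReal ((m.factorial : ℝ) / Real.Gamma ((m : ℝ) + (ν + 1)))) := by
        rw [ENNReal.tsum_comm (α := ℕ) (β := ℕ) (f := fun m k => ∑' l : ℕ,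
          ENNReal.ofReal (u ^ k / (k.factorial : ℝ) * (k.choose m : ℝ)) *
          (ENNReal.ofReal (v ^ l / (l.factorial : ℝ) * (l.choose m : ℝ)) *
          ENNReal.ofReal ((m.factorial : ℝ) / Real.Gamma ((m : ℝ) + (ν + 1)))))]
        exact tsum_congr fun k => ENNReal.tsum_comm
    _ = ∑' m : ℕ, ENNReal.ofReal (Real.exp (u + v)) * ENNReal.ofReal
        ((u * v) ^ m / ((m.factorial : ℝ) * Real.Gamma ((m : ℝ) + ν + 1))) := by
        congr 1; funext m
        simp_rw [ENNReal.tsum_mul_left, ENNReal.tsum_mul_right]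
        have := hG m
        rw [tsum_ofReal_pow_div_factorial_mul_choose hu, tsum_ofReal_pow_div_factorial_mul_choose hv,
          ← ENNReal.ofReal_mul (by positivity), ← ENNReal.ofReal_mul (by positivity),
          ← ENNReal.ofReal_mul (by positivity)]
        congr 1
        rw [Real.exp_add, mul_pow, add_assoc]
        field_simp
    _ = _ := by
        rw [ENNReal.tsum_mul_left, ENNReal.ofReal_mul (by positivity),
          ofReal_besselSeries hν (by positivity)]

end Series

/-! ### The one-dimensional heat kernel: Gaussian images and the semigroup law -/

section HalfLine

/-- The measure `y^(2a+1) dy` on the half-line. -/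
noncomputable def halfMeasure (a : ℝ) : Measure ℝ :=
  (volume.restrict (Set.Ioi 0)).withDensity fun y => ENNReal.ofReal (y ^ (2 * a + 1))

theorem lintegral_halfMeasure (a : ℝ) (f : ℝ → ℝ≥0∞) :
    ∫⁻ y, f y ∂halfMeasure a =
      ∫⁻ y in Set.Ioi 0, ENNReal.ofReal (y ^ (2 * a + 1)) * f y :=
  lintegral_withDensity_eq_lintegral_mul_non_measurable _ (by fun_prop)
    (Eventually.of_forall fun _ => ENNReal.ofReal_lt_top) f

instance (a : ℝ) : SigmaFinite (halfMeasure a) :=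
  inferInstanceAs (SigmaFinite (Measure.withDensity _ fun y => ENNReal.ofReal (y ^ (2 * a + 1))))

theorem halfMeasure_ae_pos (a : ℝ) : ∀ᵐ y ∂halfMeasure a, 0 < y :=
  (withDensity_absolutelyContinuous _ _).ae_le (ae_restrict_mem measurableSet_Ioi)

theorem lintegral_pow_mul_exp {ν b : ℝ} (hν : -1 < ν) (hb : 0 < b) (k : ℕ) :
    ∫⁻ y, ENNReal.ofReal (y ^ (2 * k) * Real.exp (-b * y ^ 2)) ∂halfMeasure ν =
      ENNReal.ofReal (1 / 2 * b ^ (-(k + ν + 1)) * Real.Gamma (k + ν + 1)) := by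
  have hk : (0 : ℝ) ≤ k := k.cast_nonneg
  have hG := gamma_nat_add_pos hν k
  have hq : -1 < 2 * (k : ℝ) + (2 * ν + 1) := by linarith
  have hI := integral_rpow_mul_exp_neg_mul_rpow (p := 2) (q := 2 * (k : ℝ) + (2 * ν + 1)) (b := b)
    (by norm_num) hq hb
  have e : ∀ y ∈ Set.Ioi (0 : ℝ), ENNReal.ofReal (y ^ (2 * ν + 1)) *
      ENNReal.ofReal (y ^ (2 * k) * Real.exp (-b * y ^ 2)) =
      ENNReal.ofReal (y ^ (2 * (k : ℝ) + (2 * ν + 1)) * Real.exp (-b * y ^ (2 : ℝ))) := by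
    intro y hy
    have hy : 0 < y := hy
    rw [← ENNReal.ofReal_mul (by positivity), Real.rpow_add hy (2 * (k : ℝ))]
    congr 1
    have : y ^ (2 * (k : ℝ)) = y ^ (2 * k) := by rw [← Real.rpow_natCast]; push_cast; rfl
    rw [this, Real.rpow_two]; ring
  rw [lintegral_halfMeasure, setLIntegral_congr_fun measurableSet_Ioi e,
    ← ofReal_integral_eq_lintegral_ofReal, hI]
  · congr 1
    have e1 : -(2 * (k : ℝ) + (2 * ν + 1) + 1) / 2 = -(k + ν + 1) := by ring
    have e2 : (2 * (k : ℝ) + (2 * ν + 1) + 1) / 2 = k + ν + 1 := by ring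
    rw [e1, e2]; ring
  -- Integrability comes for free: a non-integrable function would have Bochner integral 0, whereas
  -- the known value is positive.
  · by_contra hcon
    rw [integral_undef hcon] at hI
    have e2 : (2 * (k : ℝ) + (2 * ν + 1) + 1) / 2 = k + ν + 1 := by ring
    rw [e2] at hI
    have : 0 < b ^ (-(2 * (k : ℝ) + (2 * ν + 1) + 1) / 2) * (1 / 2) * Real.Gamma (k + ν + 1) := by
      positivity
    linarith
  · refine (ae_restrict_mem measurableSet_Ioi).mono fun y hy => ?_
    have hy : 0 < y := hy
    show 0 ≤ _
    positivity

/-- Integrating term by term, each moment produces Γ(k+ν+1), which cancels the denominator of the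
Bessel series and leaves the exponential series of w/b. -/
theorem lintegral_besselSeries_mul_exp {ν w b : ℝ} (hν : -1 < ν) (hw : 0 ≤ w) (hb : 0 < b) :
    ∫⁻ y, ENNReal.ofReal (besselSeries ν (w * y ^ 2) * Real.exp (-b * y ^ 2)) ∂halfMeasure ν =
      ENNReal.ofReal (1 / 2 * b ^ (-(ν + 1)) * Real.exp (w / b)) := by
  have hG := gamma_nat_add_pos hν
  have e : ∀ y : ℝ, ENNReal.ofReal (besselSeries ν (w * y ^ 2) * Real.exp (-b * y ^ 2)) =
      ∑' k : ℕ, ENNReal.ofReal (w ^ k / ((k.factorial : ℝ) * Real.Gamma (k + ν + 1))) *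
        ENNReal.ofReal (y ^ (2 * k) * Real.exp (-b * y ^ 2)) := by
    intro y
    rw [ENNReal.ofReal_mul (besselSeries_nonneg hν (by positivity)),
      ofReal_besselSeries hν (by positivity), ← ENNReal.tsum_mul_right]
    congr 1; funext k
    have := hG k
    rw [← ENNReal.ofReal_mul (by positivity), ← ENNReal.ofReal_mul (by positivity)]
    congr 1
    rw [mul_pow, ← pow_mul]; ring
  simp_rw [e]
  rw [lintegral_tsum fun k => by fun_prop]
  have e2 : ∀ k : ℕ, ∫⁻ y, ENNReal.ofReal (w ^ k / ((k.factorial : ℝ) * Real.Gamma (k + ν + 1))) *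
        ENNReal.ofReal (y ^ (2 * k) * Real.exp (-b * y ^ 2)) ∂halfMeasure ν =
      ENNReal.ofReal (1 / 2 * b ^ (-(ν + 1))) *
        ENNReal.ofReal ((w / b) ^ k / (k.factorial : ℝ)) := by
    intro k
    have := hG k
    rw [lintegral_const_mul _ (by fun_prop), lintegral_pow_mul_exp hν hb,
      ← ENNReal.ofReal_mul (by positivity), ← ENNReal.ofReal_mul (by positivity)]
    congr 1
    have : b ^ (-((k : ℝ) + ν + 1)) = b ^ (-(ν + 1)) / b ^ k := by
      rw [← Real.rpow_natCast b k, ← Real.rpow_sub hb]; ring_nf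
    rw [this, div_pow]
    field_simp
  simp_rw [e2]
  rw [ENNReal.tsum_mul_left, tsum_ofReal_pow_div_factorial (by positivity),
    ← ENNReal.ofReal_mul (by positivity)]

/-- Weber's second exponential integral. -/
theorem lintegral_besselSeries_mul_besselSeries {ν w w' b : ℝ} (hν : -1 < ν) (hw : 0 ≤ w)
    (hw' : 0 ≤ w') (hb : 0 < b) :
    ∫⁻ y, ENNReal.ofReal (besselSeries ν (w * y ^ 2) * besselSeries ν (w' * y ^ 2) *
        Real.exp (-b * y ^ 2)) ∂halfMeasure ν =
      ENNReal.ofReal (1 / 2 * b ^ (-(ν + 1)) *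
        (Real.exp (w / b + w' / b) * besselSeries ν (w / b * (w' / b)))) := by
  have hG := gamma_nat_add_pos hν
  have e : ∀ y : ℝ, ENNReal.ofReal (besselSeries ν (w * y ^ 2) * besselSeries ν (w' * y ^ 2) *
        Real.exp (-b * y ^ 2)) =
      ∑' k : ℕ, ∑' l : ℕ, ENNReal.ofReal (w ^ k / ((k.factorial : ℝ) * Real.Gamma (k + ν + 1)) *
          (w' ^ l / ((l.factorial : ℝ) * Real.Gamma (l + ν + 1)))) *
        ENNReal.ofReal (y ^ (2 * (k + l)) * Real.exp (-b * y ^ 2)) := by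
    intro y
    have h1 := besselSeries_nonneg hν (z := w * y ^ 2) (by positivity)
    have h2 := besselSeries_nonneg hν (z := w' * y ^ 2) (by positivity)
    rw [ENNReal.ofReal_mul (by positivity), ENNReal.ofReal_mul h1,
      ofReal_besselSeries hν (by positivity), ofReal_besselSeries hν (by positivity), mul_assoc,
      ← ENNReal.tsum_mul_right]
    refine tsum_congr fun k => ?_
    rw [← mul_assoc, ← ENNReal.tsum_mul_left, ← ENNReal.tsum_mul_right]
    refine tsum_congr fun l => ?_
    have := hG k
    have := hG l
    rw [← ENNReal.ofReal_mul (by positivity), ← ENNReal.ofReal_mul (by positivity),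
      ← ENNReal.ofReal_mul (by positivity)]
    congr 1
    rw [mul_pow, mul_pow, ← pow_mul, ← pow_mul, mul_add, pow_add]; ring
  simp_rw [e]
  rw [lintegral_tsum fun k => (Measurable.tsum fun l => by fun_prop).aemeasurable]
  have e2 : ∀ k l : ℕ, ∫⁻ y, ENNReal.ofReal (w ^ k / ((k.factorial : ℝ) * Real.Gamma (k + ν + 1)) *
          (w' ^ l / ((l.factorial : ℝ) * Real.Gamma (l + ν + 1)))) *
        ENNReal.ofReal (y ^ (2 * (k + l)) * Real.exp (-b * y ^ 2)) ∂halfMeasure ν =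
      ENNReal.ofReal (1 / 2 * b ^ (-(ν + 1))) *
        ENNReal.ofReal ((w / b) ^ k / (k.factorial : ℝ) * ((w' / b) ^ l / (l.factorial : ℝ)) *
      (Real.Gamma ((k : ℝ) + l + (ν + 1)) /
        (Real.Gamma ((k : ℝ) + (ν + 1)) * Real.Gamma ((l : ℝ) + (ν + 1))))) := by
    intro k l
    have h1 := hG k
    have h2 := hG l
    rw [lintegral_const_mul _ (by fun_prop), lintegral_pow_mul_exp hν hb,
      ← ENNReal.ofReal_mul (by positivity), ← ENNReal.ofReal_mul (by positivity)]
    congr 1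
    have : b ^ (-(((k + l : ℕ) : ℝ) + ν + 1)) = b ^ (-(ν + 1)) / (b ^ k * b ^ l) := by
      rw [← pow_add, ← Real.rpow_natCast b (k + l), ← Real.rpow_sub hb]; ring_nf
    rw [this, div_pow, div_pow]
    push_cast
    simp only [add_assoc] at h1 h2 ⊢
    field_simp
  have e3 : ∀ k : ℕ, ∫⁻ y, ∑' l : ℕ, ENNReal.ofReal
        (w ^ k / ((k.factorial : ℝ) * Real.Gamma (k + ν + 1)) *
          (w' ^ l / ((l.factorial : ℝ) * Real.Gamma (l + ν + 1)))) *
        ENNReal.ofReal (y ^ (2 * (k + l)) * Real.exp (-b * y ^ 2)) ∂halfMeasure ν =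
      ENNReal.ofReal (1 / 2 * b ^ (-(ν + 1))) *
        ∑' l : ℕ, ENNReal.ofReal ((w / b) ^ k / (k.factorial : ℝ) *
          ((w' / b) ^ l / (l.factorial : ℝ)) * (Real.Gamma ((k : ℝ) + l + (ν + 1)) /
        (Real.Gamma ((k : ℝ) + (ν + 1)) * Real.Gamma ((l : ℝ) + (ν + 1))))) := by
    intro k
    rw [lintegral_tsum fun l => by fun_prop, ← ENNReal.tsum_mul_left]
    exact tsum_congr fun l => e2 k l
  simp_rw [e3]
  rw [ENNReal.tsum_mul_left, tsum_tsum_gamma_eq hν (by positivity) (by positivity),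
    ← ENNReal.ofReal_mul (by positivity)]

/-- The one-dimensional heat kernel, extended by zero off the quadrant. -/
noncomputable def halfKernel (ν t x y : ℝ) : ℝ :=
  if 0 < x ∧ 0 < y then
    (Real.sinh (2 * t))⁻¹ * (2 * Real.sinh (2 * t)) ^ (-ν) *
      (Real.exp (-(Real.cosh (2 * t) / (2 * Real.sinh (2 * t))) * x ^ 2) *
      Real.exp (-(Real.cosh (2 * t) / (2 * Real.sinh (2 * t))) * y ^ 2)) *
      besselSeries ν ((x * y / (2 * Real.sinh (2 * t))) ^ 2)
  else 0

theorem halfKernel_symm (ν t x y : ℝ) : halfKernel ν t x y = halfKernel ν t y x := by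
  simp only [halfKernel, and_comm (a := 0 < x), mul_comm x y,
    mul_comm (Real.exp (-(Real.cosh (2 * t) / (2 * Real.sinh (2 * t))) * x ^ 2))]

theorem sinh_two_mul_pos {t : ℝ} (ht : 0 < t) : 0 < Real.sinh (2 * t) :=
  Real.sinh_pos_iff.2 (by linarith)

theorem halfKernel_nonneg {ν t : ℝ} (hν : -1 < ν) (ht : 0 < t) (x y : ℝ) :
    0 ≤ halfKernel ν t x y := by
  rw [halfKernel]
  split_ifs
  · have := sinh_two_mul_pos ht
    have := besselSeries_nonneg hν (sq_nonneg (x * y / (2 * Real.sinh (2 * t))))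
    positivity
  · exact le_rfl

theorem measurable_halfKernel {ν : ℝ} (hν : -1 < ν) (t : ℝ) :
    Measurable (Function.uncurry (halfKernel ν t)) := by
  refine Measurable.ite ?_ ?_ measurable_const
  · exact (measurableSet_lt measurable_const measurable_fst).inter
      (measurableSet_lt measurable_const measurable_snd)
  · refine Measurable.mul (by fun_prop) ?_
    exact (measurable_besselSeries_sq hν).comp
      (g := fun z : ℝ => besselSeries ν (z ^ 2))
      (f := fun p : ℝ × ℝ => p.1 * p.2 / (2 * Real.sinh (2 * t))) (by fun_prop)

theorem halfKernel_eq {ν t x y : ℝ} (hx : 0 < x) (hy : 0 < y) :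
    halfKernel ν t x y = (Real.sinh (2 * t))⁻¹ * (2 * Real.sinh (2 * t)) ^ (-ν) *
      Real.exp (-(Real.cosh (2 * t) / (2 * Real.sinh (2 * t))) * x ^ 2) *
      (besselSeries ν ((x / (2 * Real.sinh (2 * t))) ^ 2 * y ^ 2) *
      Real.exp (-(Real.cosh (2 * t) / (2 * Real.sinh (2 * t))) * y ^ 2)) := by
  rw [halfKernel, if_pos ⟨hx, hy⟩]
  have : (x * y / (2 * Real.sinh (2 * t))) ^ 2 = (x / (2 * Real.sinh (2 * t))) ^ 2 * y ^ 2 := by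
    ring
  rw [this]; ring

/-- The weight 1 + |y| makes one estimate serve both the heat kernel and the modified kernel, which
carries an extra factor y. -/
theorem exists_mul_halfKernel_le {ν t : ℝ} (hν : -1 < ν) (ht : 0 < t) (x : ℝ) :
    ∃ M, ∀ y, (1 + |y|) * halfKernel ν t x y ≤ M := by
  have hS := sinh_two_mul_pos ht
  set S := Real.sinh (2 * t)
  have hC : 0 < Real.cosh (2 * t) := Real.cosh_pos _
  -- Half of the Gaussian exponent: one half absorbs the Bessel series, the other the linear growth
  -- of 1 + y.
  set c := Real.cosh (2 * t) / (2 * S) / 2 with hc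
  have hc0 : 0 < c := by positivity
  set w := (x / (2 * S)) ^ 2
  have hw : 0 ≤ w := sq_nonneg _
  set M := ∑' k : ℕ, (w / c) ^ k / Real.Gamma ((k : ℝ) + ν + 1)
  have hM : 0 ≤ M := tsum_nonneg fun k => by
    have := gamma_nat_add_pos hν k
    positivity
  set A := S⁻¹ * (2 * S) ^ (-ν) * Real.exp (-(Real.cosh (2 * t) / (2 * S)) * x ^ 2)
  have hA : 0 ≤ A := by positivity
  refine ⟨A * (M * (2 + 1 / c)), fun y => ?_⟩
  by_cases hxy : 0 < x ∧ 0 < y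
  · rw [halfKernel_eq hxy.1 hxy.2, abs_of_pos hxy.2]
    have hy := hxy.2
    have h1 := besselSeries_mul_exp_le hν hw hc0 y
    have h2 : (1 + y) * Real.exp (-c * y ^ 2) ≤ 2 + 1 / c := by
      have h3 : 1 + c * y ^ 2 ≤ Real.exp (c * y ^ 2) := by
        linarith [Real.add_one_le_exp (c * y ^ 2)]
      have h4 : Real.exp (c * y ^ 2) * Real.exp (-c * y ^ 2) = 1 := by rw [← Real.exp_add]; simp
      have h5 : 1 + y ≤ (2 + 1 / c) * (1 + c * y ^ 2) := by
        have : (2 + 1 / c) * (1 + c * y ^ 2) = 2 + 1 / c + 2 * c * y ^ 2 + y ^ 2 := by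
          field_simp; ring
        rw [this]
        have : 0 < 1 / c := by positivity
        nlinarith [sq_nonneg (y - 1), mul_pos hc0 (mul_pos hy hy)]
      calc (1 + y) * Real.exp (-c * y ^ 2)
          ≤ (2 + 1 / c) * Real.exp (c * y ^ 2) * Real.exp (-c * y ^ 2) := by
            gcongr
            exact h5.trans (by gcongr)
        _ = _ := by rw [mul_assoc, h4, mul_one]
    have e : Real.exp (-(Real.cosh (2 * t) / (2 * S)) * y ^ 2) =
        Real.exp (-c * y ^ 2) * Real.exp (-c * y ^ 2) := by
      rw [← Real.exp_add]; congr 1; rw [hc]; ring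
    calc (1 + y) * (A * (besselSeries ν (w * y ^ 2) *
          Real.exp (-(Real.cosh (2 * t) / (2 * S)) * y ^ 2)))
        = A * ((besselSeries ν (w * y ^ 2) * Real.exp (-c * y ^ 2)) *
          ((1 + y) * Real.exp (-c * y ^ 2))) := by rw [e]; ring
      _ ≤ A * (M * (2 + 1 / c)) := by gcongr
  · rw [halfKernel, if_neg hxy, mul_zero]
    positivity

/-- The heat kernel maps Gaussians to Gaussians. -/
theorem lintegral_halfKernel_mul_exp {ν t x l : ℝ} (hν : -1 < ν) (ht : 0 < t) (hx : 0 < x)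
    (hl : 0 ≤ l) :
    ∫⁻ y, ENNReal.ofReal (halfKernel ν t x y * Real.exp (-l * y ^ 2)) ∂halfMeasure ν =
      ENNReal.ofReal ((Real.cosh (2 * t) + 2 * l * Real.sinh (2 * t)) ^ (-(ν + 1)) *
        Real.exp (-(1 / 2) * x ^ 2 * ((Real.sinh (2 * t) + 2 * l * Real.cosh (2 * t)) /
          (Real.cosh (2 * t) + 2 * l * Real.sinh (2 * t))))) := by
  have hS := sinh_two_mul_pos ht
  have hC : 0 < Real.cosh (2 * t) := Real.cosh_pos _
  have hCS := Real.cosh_sq (2 * t)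
  set S := Real.sinh (2 * t)
  set C := Real.cosh (2 * t)
  have hD : 0 < C + 2 * l * S := by positivity
  have hb : 0 < C / (2 * S) + l := by positivity
  have e : ∀ᵐ y ∂halfMeasure ν, ENNReal.ofReal (halfKernel ν t x y * Real.exp (-l * y ^ 2)) =
      ENNReal.ofReal (S⁻¹ * (2 * S) ^ (-ν) * Real.exp (-(C / (2 * S)) * x ^ 2)) *
      ENNReal.ofReal (besselSeries ν ((x / (2 * S)) ^ 2 * y ^ 2) *
        Real.exp (-(C / (2 * S) + l) * y ^ 2)) := by
    filter_upwards [halfMeasure_ae_pos ν] with y hy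
    rw [← ENNReal.ofReal_mul (by positivity), halfKernel_eq hx hy]
    congr 1
    have : Real.exp (-(C / (2 * S) + l) * y ^ 2) =
        Real.exp (-(C / (2 * S)) * y ^ 2) * Real.exp (-l * y ^ 2) := by
      rw [← Real.exp_add]; congr 1; ring
    rw [this]; ring
  rw [lintegral_congr_ae e, lintegral_const_mul' _ _ ENNReal.ofReal_ne_top,
    lintegral_besselSeries_mul_exp hν (by positivity) hb, ← ENNReal.ofReal_mul (by positivity)]
  congr 1
  have hbD : C / (2 * S) + l = (C + 2 * l * S) / (2 * S) := by field_simp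
  have e1 : ((C + 2 * l * S) / (2 * S)) ^ (-(ν + 1)) =
      (C + 2 * l * S) ^ (-(ν + 1)) * ((2 * S) ^ ν * (2 * S)) := by
    rw [Real.div_rpow hD.le (by positivity), Real.rpow_neg (by positivity : (0 : ℝ) ≤ 2 * S),
      Real.rpow_add_one (by positivity), div_inv_eq_mul]
  have e2 : (2 * S) ^ (-ν) * (2 * S) ^ ν = 1 := by
    rw [← Real.rpow_add (by positivity), neg_add_cancel, Real.rpow_zero]
  have e3 : Real.exp (-(C / (2 * S)) * x ^ 2) *
      Real.exp ((x / (2 * S)) ^ 2 / ((C + 2 * l * S) / (2 * S))) =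
      Real.exp (-(1 / 2) * x ^ 2 * ((S + 2 * l * C) / (C + 2 * l * S))) := by
    rw [← Real.exp_add]; congr 1
    field_simp
    linear_combination (-1 : ℝ) * hCS
  rw [hbD, e1, ← e3]
  calc _ = ((2 * S) ^ (-ν) * (2 * S) ^ ν) * (S⁻¹ * S) * (C + 2 * l * S) ^ (-(ν + 1)) *
        (Real.exp (-(C / (2 * S)) * x ^ 2) *
      Real.exp ((x / (2 * S)) ^ 2 / ((C + 2 * l * S) / (2 * S)))) := by ring
    _ = _ := by rw [e2, inv_mul_cancel₀ hS.ne']; ring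

theorem lintegral_halfKernel {ν t x : ℝ} (hν : -1 < ν) (ht : 0 < t) (hx : 0 < x) :
    ∫⁻ y, ENNReal.ofReal (halfKernel ν t x y) ∂halfMeasure ν =
      ENNReal.ofReal (Real.cosh (2 * t) ^ (-(ν + 1)) *
        Real.exp (-(1 / 2) * x ^ 2 * (Real.sinh (2 * t) / Real.cosh (2 * t)))) := by
  simpa using lintegral_halfKernel_mul_exp hν ht hx le_rfl

/-- The Chapman–Kolmogorov equation. -/
theorem lintegral_halfKernel_mul_halfKernel {ν s t : ℝ} (hν : -1 < ν) (hs : 0 < s) (ht : 0 < t)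
    (x z : ℝ) :
    ∫⁻ y, ENNReal.ofReal (halfKernel ν s x y) * ENNReal.ofReal (halfKernel ν t y z) ∂halfMeasure ν =
      ENNReal.ofReal (halfKernel ν (s + t) x z) := by
  by_cases hxz : 0 < x ∧ 0 < z
  swap
  · have : ∀ y, ENNReal.ofReal (halfKernel ν s x y) * ENNReal.ofReal (halfKernel ν t y z) = 0 := by
      intro y
      rw [halfKernel, halfKernel]
      by_cases h1 : 0 < x
      · have h2 : ¬ 0 < z := fun h => hxz ⟨h1, h⟩
        simp [h2]
      · simp [h1]
    simp_rw [this]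
    rw [halfKernel, if_neg hxz]; simp
  obtain ⟨hx, hz⟩ := hxz
  have hS := sinh_two_mul_pos hs
  have hT := sinh_two_mul_pos ht
  have hU := sinh_two_mul_pos (add_pos hs ht)
  have hUe : Real.sinh (2 * (s + t)) = Real.sinh (2 * s) * Real.cosh (2 * t) +
      Real.cosh (2 * s) * Real.sinh (2 * t) := by rw [mul_add, Real.sinh_add]
  have hCUe : Real.cosh (2 * (s + t)) = Real.cosh (2 * s) * Real.cosh (2 * t) +
      Real.sinh (2 * s) * Real.sinh (2 * t) := by rw [mul_add, Real.cosh_add]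
  have hs2 := Real.cosh_sq (2 * s)
  have ht2 := Real.cosh_sq (2 * t)
  have hCs : 0 < Real.cosh (2 * s) := Real.cosh_pos _
  have hCt : 0 < Real.cosh (2 * t) := Real.cosh_pos _
  have hz' := halfKernel_eq (ν := ν) (t := s + t) hx hz
  have hx' : ∀ y, 0 < y → halfKernel ν s x y = _ := fun y hy => halfKernel_eq (ν := ν) (t := s) hx hy
  have hy' : ∀ y, 0 < y → halfKernel ν t y z = _ := fun y hy =>
    (halfKernel_symm ν t y z).trans (halfKernel_eq (ν := ν) (t := t) hz hy)
  set S := Real.sinh (2 * s)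
  set T := Real.sinh (2 * t)
  set U := Real.sinh (2 * (s + t))
  set Cs := Real.cosh (2 * s)
  set Ct := Real.cosh (2 * t)
  set Cu := Real.cosh (2 * (s + t))
  -- The two Gaussian exponents in y add up, by the addition formula for sinh, to the parameter b of
  -- Weber's integral.
  have hb : Cs / (2 * S) + Ct / (2 * T) = U / (2 * S * T) := by
    rw [hUe]; field_simp; ring
  have e : ∀ᵐ y ∂halfMeasure ν, ENNReal.ofReal (halfKernel ν s x y) *
      ENNReal.ofReal (halfKernel ν t y z) =
      ENNReal.ofReal (S⁻¹ * (2 * S) ^ (-ν) * Real.exp (-(Cs / (2 * S)) * x ^ 2) *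
        (T⁻¹ * (2 * T) ^ (-ν) * Real.exp (-(Ct / (2 * T)) * z ^ 2))) *
      ENNReal.ofReal (besselSeries ν ((x / (2 * S)) ^ 2 * y ^ 2) *
        besselSeries ν ((z / (2 * T)) ^ 2 * y ^ 2) * Real.exp (-(U / (2 * S * T)) * y ^ 2)) := by
    filter_upwards [halfMeasure_ae_pos ν] with y hy
    rw [← ENNReal.ofReal_mul (halfKernel_nonneg hν hs x y), ← ENNReal.ofReal_mul (by positivity),
      hx' y hy, hy' y hy]
    congr 1
    have : Real.exp (-(U / (2 * S * T)) * y ^ 2) =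
        Real.exp (-(Cs / (2 * S)) * y ^ 2) * Real.exp (-(Ct / (2 * T)) * y ^ 2) := by
      rw [← Real.exp_add, ← hb]; congr 1; ring
    rw [this]; ring
  rw [lintegral_congr_ae e, lintegral_const_mul' _ _ ENNReal.ofReal_ne_top,
    lintegral_besselSeries_mul_besselSeries hν (by positivity) (by positivity) (by positivity),
    ← ENNReal.ofReal_mul (by positivity), hz']
  congr 1
  have e0 : (x / (2 * S)) ^ 2 / (U / (2 * S * T)) * ((z / (2 * T)) ^ 2 / (U / (2 * S * T))) =
      (x / (2 * U)) ^ 2 * z ^ 2 := by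
    field_simp
  have e1 : (U / (2 * S * T)) ^ (-(ν + 1)) * ((2 * S) ^ (-ν) * (2 * T) ^ (-ν)) =
      (2 * U) ^ (-ν) * (2 * S * T / U) := by
    have h1 : U / (2 * S * T) * (2 * S) * (2 * T) = 2 * U := by field_simp
    have h2 : (U / (2 * S * T)) ^ (-ν) * (2 * S) ^ (-ν) * (2 * T) ^ (-ν) = (2 * U) ^ (-ν) := by
      rw [← h1, Real.mul_rpow (x := U / (2 * S * T) * (2 * S)) (by positivity) (by positivity),
        Real.mul_rpow (x := U / (2 * S * T)) (by positivity) (by positivity)]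
    rw [neg_add, Real.rpow_add (by positivity), Real.rpow_neg_one, inv_div, ← h2]
    ring
  have e3 : Real.exp (-(Cs / (2 * S)) * x ^ 2) * Real.exp (-(Ct / (2 * T)) * z ^ 2) *
      Real.exp ((x / (2 * S)) ^ 2 / (U / (2 * S * T)) + (z / (2 * T)) ^ 2 / (U / (2 * S * T))) =
      Real.exp (-(Cu / (2 * U)) * x ^ 2) * Real.exp (-(Cu / (2 * U)) * z ^ 2) := by
    rw [← Real.exp_add, ← Real.exp_add, ← Real.exp_add]; congr 1
    have h1 : -(Cs / (2 * S)) + 1 / (2 * S) ^ 2 / (U / (2 * S * T)) = -(Cu / (2 * U)) := by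
      field_simp
      rw [hUe, hCUe]; linear_combination (-T) * hs2
    have h2 : -(Ct / (2 * T)) + 1 / (2 * T) ^ 2 / (U / (2 * S * T)) = -(Cu / (2 * U)) := by
      field_simp
      rw [hUe, hCUe]; linear_combination (-S) * ht2
    linear_combination x ^ 2 * h1 + z ^ 2 * h2
  rw [e0]
  calc _ = (S⁻¹ * T⁻¹ * (1 / 2)) * ((U / (2 * S * T)) ^ (-(ν + 1)) *
        ((2 * S) ^ (-ν) * (2 * T) ^ (-ν))) *
        (Real.exp (-(Cs / (2 * S)) * x ^ 2) * Real.exp (-(Ct / (2 * T)) * z ^ 2) *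
      Real.exp ((x / (2 * S)) ^ 2 / (U / (2 * S * T)) + (z / (2 * T)) ^ 2 / (U / (2 * S * T)))) *
      besselSeries ν ((x / (2 * U)) ^ 2 * z ^ 2) := by ring
    _ = _ := by rw [e1, e3]; field_simp

end HalfLine

/-! ### The mass of the modified one-dimensional kernel -/

section Modified

theorem lintegral_rpow_mul_exp_neg_mul {a r : ℝ} (ha : 0 < a) (hr : 0 < r) :
    ∫⁻ l in Set.Ioi (0 : ℝ), ENNReal.ofReal (l ^ (a - 1) * Real.exp (-(r * l))) =
      ENNReal.ofReal ((1 / r) ^ a * Real.Gamma a) := by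
  have hI := Real.integral_rpow_mul_exp_neg_mul_Ioi ha hr
  have hG := Real.Gamma_pos_of_pos ha
  rw [← ofReal_integral_eq_lintegral_ofReal, hI]
  · by_contra hcon
    rw [integral_undef hcon] at hI
    have : 0 < (1 / r) ^ a * Real.Gamma a := by positivity
    linarith
  · refine (ae_restrict_mem measurableSet_Ioi).mono fun y hy => ?_
    have hy : 0 < y := hy
    show 0 ≤ _
    positivity

/-- `√(u/π) ∫_0^1 w^(-1/2) (1 - w)^(ν - 1/2) e^{-uw} dw`, the profile of the total mass of the
modified kernel. -/
noncomputable def massProfile (ν u : ℝ) : ℝ≥0∞ :=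
  ENNReal.ofReal (Real.sqrt (u / Real.pi)) * ∫⁻ w in Set.Ioo (0 : ℝ) 1,
    ENNReal.ofReal (w ^ (-(1 / 2) : ℝ) * (1 - w) ^ (ν - 1 / 2) * Real.exp (-(u * w)))

theorem sqrt_div_pi_mul {u : ℝ} (hu : 0 < u) :
    Real.sqrt (u / Real.pi) * ((1 / u) ^ (1 / 2 : ℝ) * Real.sqrt Real.pi) = 1 := by
  have := Real.pi_pos
  rw [← Real.sqrt_eq_rpow, ← Real.sqrt_mul (by positivity), ← Real.sqrt_mul (by positivity)]
  rw [Real.sqrt_eq_one]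
  field_simp

/-- The Γ(1/2) integral: the reference value 1 with which `massProfile` is compared from both sides.
-/
theorem sqrt_mul_lintegral_rpow_neg_half {u : ℝ} (hu : 0 < u) :
    ENNReal.ofReal (Real.sqrt (u / Real.pi)) * ∫⁻ w in Set.Ioi (0 : ℝ),
      ENNReal.ofReal (w ^ (-(1 / 2) : ℝ) * Real.exp (-(u * w))) = 1 := by
  have h := lintegral_rpow_mul_exp_neg_mul (a := 1 / 2) (by norm_num) hu
  rw [Real.Gamma_one_half_eq, show (1 / 2 - 1 : ℝ) = -(1 / 2) by norm_num] at h
  rw [h, ← ENNReal.ofReal_mul (by positivity), sqrt_div_pi_mul hu, ENNReal.ofReal_one]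

theorem massProfile_le_one {ν u : ℝ} (hν : 1 / 2 ≤ ν) (hu : 0 < u) : massProfile ν u ≤ 1 := by
  rw [← sqrt_mul_lintegral_rpow_neg_half hu, massProfile]
  refine mul_le_mul' le_rfl ?_
  refine (setLIntegral_mono' measurableSet_Ioo fun w hw => ?_).trans
    (lintegral_mono_set Set.Ioo_subset_Ioi_self)
  apply ENNReal.ofReal_le_ofReal
  have h1 : (1 - w) ^ (ν - 1 / 2) ≤ 1 :=
    Real.rpow_le_one (by linarith [hw.2]) (by linarith [hw.1]) (by linarith)
  have h2 : 0 ≤ w ^ (-(1 / 2) : ℝ) := Real.rpow_nonneg hw.1.le _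
  gcongr
  exact mul_le_of_le_one_right h2 h1

/-- The integral is split at w = 1/2. On the left (1-w)^(ν-1/2) is bounded and the comparison
integral applies. On the right w^(-1/2) is bounded, exp(-uw) ≤ exp(-u/2) beats √u, and the
singularity at w = 1 is integrable because ν > -1/2. -/
theorem exists_massProfile_le {ν : ℝ} (hν : -(1 / 2) < ν) (hν' : ν ≤ 1 / 2) :
    ∃ M : NNReal, ∀ u, 0 < u → massProfile ν u ≤ M := by
  set J := ∫⁻ w in Set.Ioo (0 : ℝ) 1, ENNReal.ofReal ((1 - w) ^ (ν - 1 / 2))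
  have hJ : J ≠ ∞ := by
    have h1 : IntervalIntegrable (fun x : ℝ => x ^ (ν - 1 / 2)) volume 1 0 :=
      intervalIntegral.intervalIntegrable_rpow' (by linarith)
    have h2 := h1.comp_sub_left 1
    simp only [sub_self, sub_zero] at h2
    rw [intervalIntegrable_iff_integrableOn_Ioo_of_le zero_le_one] at h2
    refine ((hasFiniteIntegral_iff_ofReal ?_).1 h2.2).ne
    refine (ae_restrict_mem measurableSet_Ioo).mono fun w hw => ?_
    exact Real.rpow_nonneg (by linarith [hw.2]) _
  set A : ℝ := 2 ^ (1 / 2 - ν)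
  have hA : 0 < A := by positivity
  set B : ℝ := 2 ^ (1 / 2 : ℝ)
  have hB : 0 < B := by positivity
  refine ⟨A.toNNReal + B.toNNReal * J.toNNReal, fun u hu => ?_⟩
  have hpt : ∀ w ∈ Set.Ioo (0 : ℝ) 1,
      ENNReal.ofReal (w ^ (-(1 / 2) : ℝ) * (1 - w) ^ (ν - 1 / 2) * Real.exp (-(u * w))) ≤
      ENNReal.ofReal A * ENNReal.ofReal (w ^ (-(1 / 2) : ℝ) * Real.exp (-(u * w))) +
        ENNReal.ofReal (B * Real.exp (-(u / 2))) * ENNReal.ofReal ((1 - w) ^ (ν - 1 / 2)) := by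
    intro w hw
    have h0 := hw.1
    have h1 : 0 < 1 - w := by linarith [hw.2]
    rw [← ENNReal.ofReal_mul (by positivity), ← ENNReal.ofReal_mul (by positivity),
      ← ENNReal.ofReal_add (by positivity) (by positivity)]
    apply ENNReal.ofReal_le_ofReal
    rcases le_total w (1 / 2) with hw2 | hw2
    · have : (1 - w) ^ (ν - 1 / 2) ≤ A := by
        have := Real.rpow_le_rpow_of_nonpos (z := ν - 1 / 2) (x := 1 / 2) (y := 1 - w)
          (by norm_num) (by linarith) (by linarith)
        refine this.trans (le_of_eq ?_)
        rw [one_div (2 : ℝ), Real.inv_rpow (by norm_num), ← Real.rpow_neg (by norm_num), neg_sub,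
          ← one_div]
      have h3 : 0 ≤ B * Real.exp (-(u / 2)) * (1 - w) ^ (ν - 1 / 2) := by positivity
      calc _ ≤ w ^ (-(1 / 2) : ℝ) * A * Real.exp (-(u * w)) := by gcongr
        _ = A * (w ^ (-(1 / 2) : ℝ) * Real.exp (-(u * w))) := by ring
        _ ≤ _ := by linarith
    · have h2 : w ^ (-(1 / 2) : ℝ) ≤ B := by
        have := Real.rpow_le_rpow_of_nonpos (z := -(1 / 2)) (x := 1 / 2) (y := w)
          (by norm_num) hw2 (by norm_num)
        refine this.trans (le_of_eq ?_)
        rw [one_div, Real.inv_rpow (by norm_num), ← Real.rpow_neg (by norm_num), neg_neg, ← one_div]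
      have h3 : 0 ≤ A * (w ^ (-(1 / 2) : ℝ) * Real.exp (-(u * w))) := by positivity
      have h4 : Real.exp (-(u * w)) ≤ Real.exp (-(u / 2)) := by
        apply Real.exp_le_exp.2; nlinarith
      calc _ ≤ B * (1 - w) ^ (ν - 1 / 2) * Real.exp (-(u / 2)) := by gcongr
        _ = B * Real.exp (-(u / 2)) * (1 - w) ^ (ν - 1 / 2) := by ring
        _ ≤ _ := by linarith
  have h5 : Real.sqrt (u / Real.pi) * Real.exp (-(u / 2)) ≤ 1 := by
    have h6 : Real.sqrt (u / Real.pi) ≤ Real.exp (u / 2) := by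
      apply Real.sqrt_le_iff.2 ⟨(Real.exp_pos _).le, ?_⟩
      rw [← Real.exp_nat_mul]
      calc u / Real.pi ≤ u := div_le_self hu.le (by linarith [Real.pi_gt_three])
        _ ≤ Real.exp u := by linarith [Real.add_one_le_exp u]
        _ = _ := by congr 1; push_cast; ring
    calc _ ≤ Real.exp (u / 2) * Real.exp (-(u / 2)) := by gcongr
      _ = 1 := by rw [← Real.exp_add]; simp
  calc massProfile ν u
      ≤ ENNReal.ofReal (Real.sqrt (u / Real.pi)) * ∫⁻ w in Set.Ioo (0 : ℝ) 1,
        (ENNReal.ofReal A * ENNReal.ofReal (w ^ (-(1 / 2) : ℝ) * Real.exp (-(u * w))) +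
        ENNReal.ofReal (B * Real.exp (-(u / 2))) * ENNReal.ofReal ((1 - w) ^ (ν - 1 / 2))) := by
        rw [massProfile]
        gcongr 1
        exact setLIntegral_mono' measurableSet_Ioo hpt
    _ ≤ ENNReal.ofReal (Real.sqrt (u / Real.pi)) *
        (ENNReal.ofReal A * (∫⁻ w in Set.Ioi (0 : ℝ),
          ENNReal.ofReal (w ^ (-(1 / 2) : ℝ) * Real.exp (-(u * w)))) +
        ENNReal.ofReal (B * Real.exp (-(u / 2))) * J) := by
        rw [lintegral_add_left (by fun_prop), lintegral_const_mul _ (by fun_prop),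
          lintegral_const_mul _ (by fun_prop)]
        gcongr
        exact Set.Ioo_subset_Ioi_self
    _ = ENNReal.ofReal A * (ENNReal.ofReal (Real.sqrt (u / Real.pi)) * ∫⁻ w in Set.Ioi (0 : ℝ),
          ENNReal.ofReal (w ^ (-(1 / 2) : ℝ) * Real.exp (-(u * w)))) +
        ENNReal.ofReal B * (ENNReal.ofReal (Real.sqrt (u / Real.pi) * Real.exp (-(u / 2))) * J) := by
        rw [ENNReal.ofReal_mul hB.le, ENNReal.ofReal_mul (Real.sqrt_nonneg _)]; ring
    _ ≤ ENNReal.ofReal A * 1 + ENNReal.ofReal B * (1 * J) := by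
        rw [sqrt_mul_lintegral_rpow_neg_half hu]
        gcongr
        exact ENNReal.ofReal_le_one.2 h5
    _ = _ := by
        rw [mul_one, one_mul]
        push_cast
        rw [ENNReal.coe_toNNReal hJ]; rfl

/-- A Watson-type expansion with explicit remainder. With δ = 1/2-ν, on (0,1) one has (1-w)^(-δ) ≥ 1
+ δw, and the missing part w ≥ 1 costs at most (1+δ)w². The three resulting integrals are Γ(1/2),
Γ(3/2) and Γ(5/2) integrals, whence the coefficients 1, 1/2 and 3/4. -/
theorem le_massProfile {ν u : ℝ} (hν' : ν < 1 / 2) (hu : 0 < u) :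
    ENNReal.ofReal (1 + (1 / 2 - ν) / (2 * u) - 3 * (1 + (1 / 2 - ν)) / (4 * u ^ 2)) ≤
      massProfile ν u := by
  set δ := 1 / 2 - ν with hδ
  have hδ0 : 0 < δ := by linarith
  set r := Real.sqrt (u / Real.pi)
  have hr := sqrt_div_pi_mul hu
  -- The remainder is added on the right, so that no subtraction occurs in `ℝ≥0∞` before
  -- integrating.
  have hpt : ∀ w ∈ Set.Ioi (0 : ℝ),
      ENNReal.ofReal (w ^ ((1 / 2 : ℝ) - 1) * Real.exp (-(u * w))) +
        ENNReal.ofReal δ * ENNReal.ofReal (w ^ ((3 / 2 : ℝ) - 1) * Real.exp (-(u * w))) ≤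
      (Set.Ioo (0 : ℝ) 1).indicator (fun w => ENNReal.ofReal
        (w ^ (-(1 / 2) : ℝ) * (1 - w) ^ (ν - 1 / 2) * Real.exp (-(u * w)))) w +
      ENNReal.ofReal (1 + δ) * ENNReal.ofReal (w ^ ((5 / 2 : ℝ) - 1) * Real.exp (-(u * w))) := by
    intro w hw
    have hw : 0 < w := hw
    rw [← ENNReal.ofReal_mul hδ0.le, ← ENNReal.ofReal_add (by positivity) (by positivity)]
    by_cases h1 : w < 1
    · rw [Set.indicator_of_mem (show w ∈ Set.Ioo (0 : ℝ) 1 from ⟨hw, h1⟩)]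
      refine le_trans (ENNReal.ofReal_le_ofReal ?_) le_self_add
      have h2 : 1 + δ * w ≤ (1 - w) ^ (ν - 1 / 2) := by
        rw [Real.rpow_def_of_pos (by linarith)]
        have h3 := Real.log_le_sub_one_of_pos (x := 1 - w) (by linarith)
        have h4 := Real.add_one_le_exp (Real.log (1 - w) * (ν - 1 / 2))
        have : δ * w ≤ Real.log (1 - w) * (ν - 1 / 2) := by
          rw [hδ]; nlinarith
        linarith
      have e1 : w ^ ((3 / 2 : ℝ) - 1) = w ^ (-(1 / 2) : ℝ) * w := by
        rw [← Real.rpow_add_one hw.ne']; norm_num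
      have e2 : w ^ ((1 / 2 : ℝ) - 1) = w ^ (-(1 / 2) : ℝ) := by norm_num
      rw [e1, e2]
      calc _ = w ^ (-(1 / 2) : ℝ) * (1 + δ * w) * Real.exp (-(u * w)) := by ring
        _ ≤ _ := by gcongr
    · push Not at h1
      refine le_trans ?_ le_add_self
      rw [← ENNReal.ofReal_mul (by positivity)]
      apply ENNReal.ofReal_le_ofReal
      have e1 : w ^ ((1 / 2 : ℝ) - 1) ≤ w ^ ((5 / 2 : ℝ) - 1) :=
        Real.rpow_le_rpow_of_exponent_le h1 (by norm_num)
      have e2 : w ^ ((3 / 2 : ℝ) - 1) ≤ w ^ ((5 / 2 : ℝ) - 1) :=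
        Real.rpow_le_rpow_of_exponent_le h1 (by norm_num)
      calc _ ≤ w ^ ((5 / 2 : ℝ) - 1) * Real.exp (-(u * w)) +
            δ * (w ^ ((5 / 2 : ℝ) - 1) * Real.exp (-(u * w))) := by gcongr
        _ = _ := by ring
  have hint := setLIntegral_mono' (μ := volume) measurableSet_Ioi hpt
  rw [lintegral_add_left (by fun_prop), lintegral_const_mul _ (by fun_prop),
    lintegral_add_right _ (by fun_prop), lintegral_const_mul _ (by fun_prop),
    lintegral_rpow_mul_exp_neg_mul (by norm_num) hu, lintegral_rpow_mul_exp_neg_mul (by norm_num) hu,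
    lintegral_rpow_mul_exp_neg_mul (by norm_num) hu,
    setLIntegral_indicator measurableSet_Ioo,
    Set.inter_eq_left.2 Set.Ioo_subset_Ioi_self] at hint
  have hG3 : Real.Gamma (3 / 2) = 1 / 2 * Real.sqrt Real.pi := by
    rw [← Real.Gamma_one_half_eq, ← Real.Gamma_add_one (by norm_num)]; norm_num
  have hG5 : Real.Gamma (5 / 2) = 3 / 4 * Real.sqrt Real.pi := by
    have : Real.Gamma (5 / 2) = 3 / 2 * Real.Gamma (3 / 2) := by
      rw [← Real.Gamma_add_one (by norm_num)]; norm_num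
    rw [this, hG3]; ring
  have hu3 : (1 / u) ^ (3 / 2 : ℝ) = (1 / u) ^ (1 / 2 : ℝ) * (1 / u) := by
    rw [← Real.rpow_add_one (by positivity)]; norm_num
  have hu5 : (1 / u) ^ (5 / 2 : ℝ) = (1 / u) ^ (1 / 2 : ℝ) * (1 / u) * (1 / u) := by
    rw [← hu3, ← Real.rpow_add_one (by positivity)]; norm_num
  have hmul := mul_le_mul_right hint (ENNReal.ofReal r)
  rw [mul_add, mul_add, ← massProfile, ← ENNReal.ofReal_mul hδ0.le,
    ← ENNReal.ofReal_mul (p := 1 + δ) (by positivity), ← ENNReal.ofReal_mul (Real.sqrt_nonneg _),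
    ← ENNReal.ofReal_mul (Real.sqrt_nonneg _), ← ENNReal.ofReal_mul (Real.sqrt_nonneg _),
    hG3, hG5, hu3, hu5, Real.Gamma_one_half_eq,
    ← ENNReal.ofReal_add (by positivity) (by positivity)] at hmul
  rw [ENNReal.ofReal_sub _ (by positivity), tsub_le_iff_right]
  refine le_trans (le_of_eq ?_) (hmul.trans (le_of_eq ?_))
  · congr 1
    linear_combination (-(1 + δ / (2 * u))) * hr
  · congr 2
    linear_combination (3 * (1 + δ) / (4 * u ^ 2)) * hr

/-- A whole range of u, not a single value, is required because contractivity controls masses only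
almost everywhere. -/
theorem exists_lt_massProfile {ν : ℝ} (hν' : ν < 1 / 2) :
    ∃ u₀ η : ℝ, 0 < u₀ ∧ 0 < η ∧ ∀ u, u₀ ≤ u → u ≤ 2 * u₀ →
      ENNReal.ofReal (1 + η) ≤ massProfile ν u := by
  set δ := 1 / 2 - ν with hδ
  have hδ0 : 0 < δ := by linarith
  -- For u ≥ u₀ the remainder 3(1+δ)/(4u²) = δu₀/(4u²) is at most δ/(4u), half of the gain δ/(2u).
  -- The other half is at least δ/(8u₀) = η when u ≤ 2u₀.
  refine ⟨3 * (1 + δ) / δ, δ / (8 * (3 * (1 + δ) / δ)), by positivity, by positivity,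
    fun u h1 h2 => ?_⟩
  set u₀ := 3 * (1 + δ) / δ with hu₀
  have hu₀' : 0 < u₀ := by positivity
  have hu : 0 < u := hu₀'.trans_le h1
  refine le_trans (ENNReal.ofReal_le_ofReal ?_) (le_massProfile hν' hu)
  rw [← hδ]
  have e : 3 * (1 + δ) = δ * u₀ := by rw [hu₀]; field_simp
  rw [e]
  have h3 : δ / (8 * u₀) ≤ δ / (4 * u) := by
    apply div_le_div_of_nonneg_left hδ0.le (by positivity); linarith
  have h4 : δ * u₀ / (4 * u ^ 2) ≤ δ / (4 * u) := by
    rw [div_le_div_iff₀ (by positivity) (by positivity)]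
    nlinarith [mul_le_mul_of_nonneg_left h1 (by positivity : 0 ≤ 4 * δ * u)]
  have h5 : δ / (2 * u) = δ / (4 * u) + δ / (4 * u) := by field_simp; norm_num
  linarith

/-- The modified one-dimensional kernel. -/
noncomputable def modHalfKernel (a t x y : ℝ) : ℝ := x * y * halfKernel (a + 1) t x y

/-- The factor y moves to the measure: y · y^(2a+1) = y⁻¹ · y^(2(a+1)+1), so the order of the kernel
and of the measure agree. -/
theorem lintegral_modHalfKernel_eq {a t x : ℝ} (hx : 0 < x) :
    ∫⁻ y, ENNReal.ofReal (modHalfKernel a t x y) ∂halfMeasure a =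
      ENNReal.ofReal x * ∫⁻ y, ENNReal.ofReal (halfKernel (a + 1) t x y) *
        ENNReal.ofReal y⁻¹ ∂halfMeasure (a + 1) := by
  rw [lintegral_halfMeasure, lintegral_halfMeasure,
    ← lintegral_const_mul' _ _ ENNReal.ofReal_ne_top]
  refine setLIntegral_congr_fun measurableSet_Ioi fun y hy => ?_
  have hy : 0 < y := hy
  simp only [modHalfKernel]
  have e : y ^ (2 * (a + 1) + 1) = y ^ (2 * a + 1) * y * y := by
    rw [← Real.rpow_add_one hy.ne', ← Real.rpow_add_one hy.ne']; ring_nf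
  have e2 : y ^ (2 * (a + 1) + 1) * y⁻¹ = y ^ (2 * a + 1) * y := by
    rw [e]; field_simp
  rw [ENNReal.ofReal_mul (by positivity), ENNReal.ofReal_mul hx.le]
  calc _ = ENNReal.ofReal (y ^ (2 * a + 1)) * ENNReal.ofReal y * ENNReal.ofReal x *
        ENNReal.ofReal (halfKernel (a + 1) t x y) := by ring
    _ = ENNReal.ofReal (y ^ (2 * (a + 1) + 1)) * ENNReal.ofReal y⁻¹ * ENNReal.ofReal x *
        ENNReal.ofReal (halfKernel (a + 1) t x y) := by
        rw [← ENNReal.ofReal_mul (p := y ^ (2 * a + 1)) (by positivity),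
          ← ENNReal.ofReal_mul (p := y ^ (2 * (a + 1) + 1)) (by positivity), e2]
    _ = _ := by ring

/-- Subordination: the Γ(1/2) integral at rate y² exhibits 1/y as a mixture of Gaussians, on which
the heat kernel acts explicitly. -/
theorem ofReal_inv_eq_lintegral {y : ℝ} (hy : 0 < y) :
    ENNReal.ofReal y⁻¹ = ∫⁻ l in Set.Ioi (0 : ℝ),
      ENNReal.ofReal ((Real.sqrt Real.pi)⁻¹ * l ^ (-(1 / 2) : ℝ)) *
        ENNReal.ofReal (Real.exp (-l * y ^ 2)) := by
  have hπ := Real.sqrt_pos.2 Real.pi_pos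
  have h := lintegral_rpow_mul_exp_neg_mul (a := 1 / 2) (r := y ^ 2) (by norm_num) (by positivity)
  rw [Real.Gamma_one_half_eq, show (1 / 2 - 1 : ℝ) = -(1 / 2) by norm_num] at h
  have e : ∀ l ∈ Set.Ioi (0 : ℝ), ENNReal.ofReal ((Real.sqrt Real.pi)⁻¹ * l ^ (-(1 / 2) : ℝ)) *
        ENNReal.ofReal (Real.exp (-l * y ^ 2)) = ENNReal.ofReal (Real.sqrt Real.pi)⁻¹ *
        ENNReal.ofReal (l ^ (-(1 / 2) : ℝ) * Real.exp (-(y ^ 2 * l))) := by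
    intro l hl
    have hl : 0 < l := hl
    rw [← ENNReal.ofReal_mul (by positivity), ← ENNReal.ofReal_mul (by positivity)]
    congr 1
    rw [show -l * y ^ 2 = -(y ^ 2 * l) by ring]; ring
  rw [setLIntegral_congr_fun measurableSet_Ioi e, lintegral_const_mul _ (by fun_prop), h,
    ← ENNReal.ofReal_mul (by positivity)]
  congr 1
  rw [← Real.sqrt_eq_rpow, one_div, ← inv_pow, Real.sqrt_sq (by positivity)]
  field_simp

theorem image_mul_div_one_sub {c : ℝ} (hc : 0 < c) :
    (fun w : ℝ => c * (w / (1 - w))) '' Set.Ioo 0 1 = Set.Ioi 0 := by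
  ext l
  constructor
  · rintro ⟨w, hw, rfl⟩
    have h1 : 0 < 1 - w := by linarith [hw.2]
    have := hw.1
    show 0 < c * (w / (1 - w))
    positivity
  · intro hl
    have hl : 0 < l := hl
    refine ⟨l / (c + l), ⟨by positivity, (div_lt_one (by positivity)).2 (by linarith)⟩, ?_⟩
    have : 1 - l / (c + l) = c / (c + l) := by field_simp; ring
    simp only [this]
    field_simp

/-- By subordination and Tonelli the mass is an integral over l of Gaussian images; a fractional
linear substitution maps it to (0,1), where t and x enter the integrand only through u. -/
theorem lintegral_modHalfKernel {a t x : ℝ} (ha : -(3 / 2) < a) (ht : 0 < t) (hx : 0 < x) :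
    ∫⁻ y, ENNReal.ofReal (modHalfKernel a t x y) ∂halfMeasure a =
      ENNReal.ofReal (Real.cosh (2 * t) ^ (-(a + 1)) * Real.exp (-(Real.sinh (2 * t) ^ 2 *
        (x ^ 2 / (2 * Real.sinh (2 * t) * Real.cosh (2 * t)))))) *
      massProfile (a + 1) (x ^ 2 / (2 * Real.sinh (2 * t) * Real.cosh (2 * t))) := by
  have hν : -1 < a + 1 := by linarith
  rw [lintegral_modHalfKernel_eq hx]
  set ν := a + 1
  have hS := sinh_two_mul_pos ht
  have hC : 0 < Real.cosh (2 * t) := Real.cosh_pos _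
  have hCS := Real.cosh_sq (2 * t)
  have hgauss := fun l (hl : 0 ≤ l) => lintegral_halfKernel_mul_exp (l := l) hν ht hx hl
  set S := Real.sinh (2 * t)
  set C := Real.cosh (2 * t)
  set u := x ^ 2 / (2 * S * C) with hu
  have hu0 : 0 < u := by positivity
  have hπ := Real.sqrt_pos.2 Real.pi_pos
  have hk : Measurable fun y => ENNReal.ofReal (halfKernel ν t x y) :=
    ((measurable_halfKernel hν t).comp measurable_prodMk_left).ennreal_ofReal
  have e1 : ∀ᵐ y ∂halfMeasure ν, ENNReal.ofReal (halfKernel ν t x y) * ENNReal.ofReal y⁻¹ =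
      ∫⁻ l in Set.Ioi (0 : ℝ), ENNReal.ofReal (halfKernel ν t x y) *
        (ENNReal.ofReal ((Real.sqrt Real.pi)⁻¹ * l ^ (-(1 / 2) : ℝ)) *
        ENNReal.ofReal (Real.exp (-l * y ^ 2))) := by
    filter_upwards [halfMeasure_ae_pos ν] with y hy
    rw [ofReal_inv_eq_lintegral hy, lintegral_const_mul _ (by fun_prop)]
  rw [lintegral_congr_ae e1, lintegral_lintegral_swap]
  swap
  · refine Measurable.aemeasurable ?_
    exact (hk.comp measurable_fst).mul (by fun_prop)
  have e2 : ∀ l ∈ Set.Ioi (0 : ℝ), ∫⁻ y, ENNReal.ofReal (halfKernel ν t x y) *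
        (ENNReal.ofReal ((Real.sqrt Real.pi)⁻¹ * l ^ (-(1 / 2) : ℝ)) *
        ENNReal.ofReal (Real.exp (-l * y ^ 2))) ∂halfMeasure ν =
      ENNReal.ofReal ((Real.sqrt Real.pi)⁻¹ * l ^ (-(1 / 2) : ℝ) *
        ((C + 2 * l * S) ^ (-(ν + 1)) *
        Real.exp (-(1 / 2) * x ^ 2 * ((S + 2 * l * C) / (C + 2 * l * S))))) := by
    intro l hl
    have hl : 0 < l := hl
    rw [ENNReal.ofReal_mul (p := (Real.sqrt Real.pi)⁻¹ * l ^ (-(1 / 2) : ℝ)) (by positivity),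
      ← hgauss l hl.le,
      ← lintegral_const_mul' _ _ ENNReal.ofReal_ne_top]
    congr 1; funext y
    rw [ENNReal.ofReal_mul (halfKernel_nonneg hν ht x y)]; ring
  rw [setLIntegral_congr_fun measurableSet_Ioi e2]
  -- With l = c·w/(1-w) this c gives C + 2lS = C/(1-w), and by C² - S² = 1 the exponent becomes -S²u
  -- - uw, linear in w.
  set c := C / (2 * S) with hc
  have hc0 : 0 < c := by positivity
  have hinj : Set.InjOn (fun w : ℝ => c * (w / (1 - w))) (Set.Ioo 0 1) := by
    intro w hw w' hw' h
    have h1 : 0 < 1 - w := by linarith [hw.2]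
    have h2 : 0 < 1 - w' := by linarith [hw'.2]
    have h3 := mul_left_cancel₀ hc0.ne' h
    rw [div_eq_div_iff h1.ne' h2.ne'] at h3
    linarith
  have hder : ∀ w ∈ Set.Ioo (0 : ℝ) 1, HasDerivWithinAt (fun w : ℝ => c * (w / (1 - w)))
      (c / (1 - w) ^ 2) (Set.Ioo 0 1) w := by
    intro w hw
    have h1 : 1 - w ≠ 0 := by linarith [hw.2]
    have := ((hasDerivAt_id w).div ((hasDerivAt_id w).const_sub 1) h1).const_mul c
    refine (this.congr_deriv ?_).hasDerivWithinAt
    simp only [id]; ring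
  rw [← image_mul_div_one_sub hc0,
    lintegral_image_eq_lintegral_abs_deriv_mul measurableSet_Ioo hder hinj, massProfile,
    ← mul_assoc, ← ENNReal.ofReal_mul (by positivity),
    ← lintegral_const_mul' _ _ ENNReal.ofReal_ne_top,
    ← lintegral_const_mul' _ _ ENNReal.ofReal_ne_top]
  refine setLIntegral_congr_fun measurableSet_Ioo fun w hw => ?_
  have hw0 := hw.1
  have hw1 : 0 < 1 - w := by linarith [hw.2]
  rw [← ENNReal.ofReal_mul (by positivity), ← ENNReal.ofReal_mul hx.le,
    ← ENNReal.ofReal_mul (by positivity), abs_of_pos (by positivity)]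
  congr 1
  have hD : C + 2 * (c * (w / (1 - w))) * S = C / (1 - w) := by
    rw [hc]; field_simp; ring
  have hexp : Real.exp (-(1 / 2) * x ^ 2 * ((S + 2 * (c * (w / (1 - w))) * C) / (C / (1 - w)))) =
      Real.exp (-(S ^ 2 * u)) * Real.exp (-(u * w)) := by
    rw [← Real.exp_add]; congr 1
    rw [hu, hc]; field_simp
    linear_combination (-w) * hCS
  have hl : (c * (w / (1 - w))) ^ (-(1 / 2) : ℝ) =
      c ^ (-(1 / 2) : ℝ) * (w ^ (-(1 / 2) : ℝ) * (1 - w) ^ (1 / 2 : ℝ)) := by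
    rw [Real.mul_rpow (by positivity) (by positivity), Real.div_rpow hw0.le hw1.le,
      Real.rpow_neg hw1.le, div_inv_eq_mul]
  have hDp : (C / (1 - w)) ^ (-(ν + 1)) = C ^ (-ν) * C⁻¹ * (1 - w) ^ (ν + 1) := by
    rw [Real.div_rpow hC.le hw1.le, Real.rpow_neg hw1.le, div_inv_eq_mul, neg_add,
      Real.rpow_add hC, Real.rpow_neg_one]
  have hpow : (1 - w) ^ (1 / 2 : ℝ) * (1 - w) ^ (ν + 1) = (1 - w) ^ (ν - 1 / 2) * (1 - w) ^ 2 := by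
    rw [← Real.rpow_add hw1, ← Real.rpow_two, ← Real.rpow_add hw1]; ring_nf
  have hx1 : x * (c * c ^ (-(1 / 2) : ℝ)) * C⁻¹ * (Real.sqrt Real.pi)⁻¹ =
      Real.sqrt (u / Real.pi) := by
    have h1 : c * c ^ (-(1 / 2) : ℝ) = Real.sqrt c := by
      rw [Real.sqrt_eq_rpow, mul_comm, ← Real.rpow_add_one hc0.ne']; norm_num
    rw [h1, Real.sqrt_div hu0.le, div_eq_mul_inv]
    congr 1
    symm
    rw [Real.sqrt_eq_iff_mul_self_eq_of_pos (by positivity)]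
    have : x * Real.sqrt c * C⁻¹ * (x * Real.sqrt c * C⁻¹) =
        x ^ 2 * (Real.sqrt c * Real.sqrt c) * C⁻¹ ^ 2 := by ring
    rw [this, Real.mul_self_sqrt hc0.le, hu, hc]
    field_simp
  rw [hD, hexp, hl, hDp, ← hx1]
  calc _ = x * (c * c ^ (-(1 / 2) : ℝ)) * C⁻¹ * (Real.sqrt Real.pi)⁻¹ *
        (C ^ (-ν) * Real.exp (-(S ^ 2 * u))) * (w ^ (-(1 / 2) : ℝ) * Real.exp (-(u * w))) *
        ((1 - w) ^ (1 / 2 : ℝ) * (1 - w) ^ (ν + 1) / (1 - w) ^ 2) := by ring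
    _ = _ := by rw [hpow]; field_simp

/-- The Chapman–Kolmogorov equation for the modified kernel. -/
theorem lintegral_modHalfKernel_mul_modHalfKernel {a s t : ℝ} (ha : -2 < a) (hs : 0 < s)
    (ht : 0 < t) (x z : ℝ) :
    ∫⁻ y, ENNReal.ofReal (modHalfKernel a s x y) * ENNReal.ofReal (modHalfKernel a t y z)
      ∂halfMeasure a = ENNReal.ofReal (modHalfKernel a (s + t) x z) := by
  have hν : -1 < a + 1 := by linarith
  by_cases hxz : 0 < x ∧ 0 < z
  swap
  · have : ∀ y, ENNReal.ofReal (modHalfKernel a s x y) *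
        ENNReal.ofReal (modHalfKernel a t y z) = 0 := by
      intro y
      rw [modHalfKernel, modHalfKernel, halfKernel, halfKernel]
      by_cases h1 : 0 < x
      · have h2 : ¬ 0 < z := fun h => hxz ⟨h1, h⟩
        simp [h2]
      · simp [h1]
    simp_rw [this]
    rw [modHalfKernel, halfKernel, if_neg hxz]; simp
  obtain ⟨hx, hz⟩ := hxz
  rw [modHalfKernel, ENNReal.ofReal_mul (by positivity),
    ← lintegral_halfKernel_mul_halfKernel hν hs ht, lintegral_halfMeasure, lintegral_halfMeasure,
    ← lintegral_const_mul' _ _ ENNReal.ofReal_ne_top]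
  refine setLIntegral_congr_fun measurableSet_Ioi fun y hy => ?_
  have hy : 0 < y := hy
  simp only [modHalfKernel]
  have e : y ^ (2 * (a + 1) + 1) = y ^ (2 * a + 1) * y * y := by
    rw [← Real.rpow_add_one hy.ne', ← Real.rpow_add_one hy.ne']; ring_nf
  rw [e, ENNReal.ofReal_mul (by positivity), ENNReal.ofReal_mul hx.le,
    ENNReal.ofReal_mul (p := y * z) (by positivity), ENNReal.ofReal_mul hy.le,
    ENNReal.ofReal_mul (p := x) hx.le,
    ENNReal.ofReal_mul (p := y ^ (2 * a + 1) * y) (by positivity),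
    ENNReal.ofReal_mul (p := y ^ (2 * a + 1)) (by positivity)]
  ring

end Modified

/-! ### Product kernels on the orthant -/

section Product

theorem lintegral_pi_prod {n : ℕ} (μ : Fin n → Measure ℝ) [∀ i, SigmaFinite (μ i)]
    (f : Fin n → ℝ → ℝ≥0∞) (hf : ∀ i, Measurable (f i)) :
    ∫⁻ x, ∏ i, f i (x i) ∂Measure.pi μ = ∏ i, ∫⁻ y, f i y ∂μ i := by
  induction n with
  | zero => simp
  | succ n ih =>
    have hmp := (measurePreserving_piFinSuccAbove μ 0).symm
    rw [← hmp.lintegral_comp_emb (MeasurableEquiv.measurableEmbedding _)]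
    have e : ∀ z : ℝ × (Fin n → ℝ),
        ∏ i, f i ((MeasurableEquiv.piFinSuccAbove (fun _ => ℝ) 0).symm z i) =
        f 0 z.1 * ∏ i : Fin n, f i.succ (z.2 i) := by
      intro z
      rw [Fin.prod_univ_succ]
      rfl
    simp_rw [e]
    have hm : Measurable fun y : Fin n → ℝ => ∏ i : Fin n, f i.succ (y i) :=
      Finset.measurable_prod _ fun i _ => (hf _).comp (measurable_pi_apply i)
    rw [lintegral_prod (fun z : ℝ × (Fin n → ℝ) => f 0 z.1 * ∏ i : Fin n, f i.succ (z.2 i))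
      (((hf 0).comp measurable_fst).mul (hm.comp measurable_snd)).aemeasurable]
    simp_rw [lintegral_const_mul _ hm]
    rw [lintegral_mul_const _ (hf 0), Fin.prod_univ_succ]
    congr 1
    exact ih (fun i => μ i.succ) (fun i => f i.succ) (fun i => hf _)

variable {d : ℕ}

theorem setOf_forall_pos_eq : {x : Fin d → ℝ | ∀ i, 0 < x i} = Set.univ.pi fun _ => Set.Ioi 0 := by
  ext x; simp

theorem measurableSet_forall_pos : MeasurableSet {x : Fin d → ℝ | ∀ i, 0 < x i} := by
  rw [setOf_forall_pos_eq]; exact MeasurableSet.univ_pi fun _ => measurableSet_Ioi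

theorem muAlpha_ae_pos (α : Fin d → ℝ) : ∀ᵐ y ∂muAlpha α, ∀ i, 0 < y i :=
  (withDensity_absolutelyContinuous _ _).ae_le
    (ae_restrict_mem measurableSet_forall_pos)

theorem measurable_weight (α : Fin d → ℝ) :
    Measurable fun x : Fin d → ℝ => ENNReal.ofReal (∏ i, x i ^ (2 * α i + 1)) := by
  fun_prop

instance (α : Fin d → ℝ) : SigmaFinite (muAlpha α) :=
  inferInstanceAs (SigmaFinite (Measure.withDensity _
    fun x : Fin d → ℝ => ENNReal.ofReal (∏ i, x i ^ (2 * α i + 1))))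

theorem lintegral_muAlpha (α : Fin d → ℝ) (f : (Fin d → ℝ) → ℝ≥0∞) :
    ∫⁻ y, f y ∂muAlpha α = ∫⁻ y in {x : Fin d → ℝ | ∀ i, 0 < x i},
      ENNReal.ofReal (∏ i, y i ^ (2 * α i + 1)) * f y :=
  lintegral_withDensity_eq_lintegral_mul_non_measurable _ (measurable_weight α)
    (Eventually.of_forall fun _ => ENNReal.ofReal_lt_top) f

theorem lintegral_muAlpha_prod (α : Fin d → ℝ) (f : Fin d → ℝ → ℝ≥0∞)
    (hf : ∀ i, Measurable (f i)) :
    ∫⁻ y, ∏ i, f i (y i) ∂muAlpha α = ∏ i, ∫⁻ y, f i y ∂halfMeasure (α i) := by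
  simp_rw [lintegral_halfMeasure]
  rw [lintegral_muAlpha]
  have e : ∀ y ∈ {x : Fin d → ℝ | ∀ i, 0 < x i},
      ENNReal.ofReal (∏ i, y i ^ (2 * α i + 1)) * ∏ i, f i (y i) =
      ∏ i, ENNReal.ofReal (y i ^ (2 * α i + 1)) * f i (y i) := by
    intro y hy
    rw [ENNReal.ofReal_prod_of_nonneg fun i _ => Real.rpow_nonneg (hy i).le _,
      Finset.prod_mul_distrib]
  rw [setLIntegral_congr_fun measurableSet_forall_pos e, setOf_forall_pos_eq, volume_pi, Measure.restrict_pi_pi,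
    lintegral_pi_prod (fun _ => volume.restrict (Set.Ioi 0)) (f := fun i y => ENNReal.ofReal (y ^ (2 * α i + 1)) * f i y)]
  intro i
  exact Measurable.mul (by fun_prop) (hf i)

/-- The product of one-dimensional kernels. -/
noncomputable def prodKernel (k : Fin d → ℝ → ℝ → ℝ) (x y : Fin d → ℝ) : ℝ :=
  ∏ i, k i (x i) (y i)

theorem measurable_prodKernel {k : Fin d → ℝ → ℝ → ℝ}
    (hk : ∀ i, Measurable (Function.uncurry (k i))) :
    Measurable (Function.uncurry (prodKernel k)) :=
  Finset.measurable_prod Finset.univ (f := fun i (z : (Fin d → ℝ) × (Fin d → ℝ)) =>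
    k i (z.1 i) (z.2 i)) fun i _ => (hk i).comp
    (g := Function.uncurry (k i)) (f := fun z : (Fin d → ℝ) × (Fin d → ℝ) => (z.1 i, z.2 i))
      (by fun_prop)

theorem lintegral_prodKernel {k : Fin d → ℝ → ℝ → ℝ}
    (hk : ∀ i, Measurable (Function.uncurry (k i))) (h0 : ∀ i x y, 0 ≤ k i x y) (α x : Fin d → ℝ) :
    ∫⁻ y, ENNReal.ofReal (prodKernel k x y) ∂muAlpha α =
      ∏ i, ∫⁻ y, ENNReal.ofReal (k i (x i) y) ∂halfMeasure (α i) := by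
  simp_rw [prodKernel, ENNReal.ofReal_prod_of_nonneg fun i _ => h0 i _ _]
  exact lintegral_muAlpha_prod α (fun i y => ENNReal.ofReal (k i (x i) y))
    fun i => ((hk i).comp measurable_prodMk_left).ennreal_ofReal

theorem IsSymmKernel.prod {k : Fin d → ℝ → ℝ → ℝ} {α : Fin d → ℝ} {C : Fin d → NNReal}
    (h : ∀ i, IsSymmKernel (halfMeasure (α i)) (k i) (C i)) :
    IsSymmKernel (muAlpha α) (prodKernel k) (∏ i, C i) where
  meas := measurable_prodKernel fun i => (h i).meas
  nonneg x y := Finset.prod_nonneg fun i _ => (h i).nonneg _ _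
  symm x y := Finset.prod_congr rfl fun i _ => (h i).symm _ _
  bdd x := by
    choose M hM using fun i => (h i).bdd (x i)
    exact ⟨∏ i, M i, fun y => Finset.prod_le_prod (fun i _ => (h i).nonneg _ _) fun i _ => hM i _⟩
  mass x := by
    rw [lintegral_prodKernel (fun i => (h i).meas) fun i => (h i).nonneg]
    push_cast
    exact Finset.prod_le_prod' fun i _ => (h i).mass _

theorem IsSymmKernel.const_mul {X : Type*} [MeasurableSpace X] {μ : Measure X} {K : X → X → ℝ}
    {C : NNReal} (h : IsSymmKernel μ K C) {c : ℝ} (hc : 0 ≤ c) :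
    IsSymmKernel μ (fun x y => c * K x y) (c.toNNReal * C) where
  meas := h.meas.const_mul c
  nonneg x y := mul_nonneg hc (h.nonneg x y)
  symm x y := by rw [h.symm]
  bdd x := by
    obtain ⟨M, hM⟩ := h.bdd x
    exact ⟨c * M, fun y => mul_le_mul_of_nonneg_left (hM y) hc⟩
  mass x := by
    simp_rw [ENNReal.ofReal_mul hc]
    rw [lintegral_const_mul' _ _ ENNReal.ofReal_ne_top]
    push_cast
    exact mul_le_mul' le_rfl (h.mass x)

theorem lintegral_prodKernel_mul {k k' k'' : Fin d → ℝ → ℝ → ℝ} {α : Fin d → ℝ}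
    (hk : ∀ i, Measurable (Function.uncurry (k i))) (hk' : ∀ i, Measurable (Function.uncurry (k' i)))
    (h0 : ∀ i x y, 0 ≤ k i x y) (h0' : ∀ i x y, 0 ≤ k' i x y) (h0'' : ∀ i x y, 0 ≤ k'' i x y)
    (h : ∀ i x z, ∫⁻ y, ENNReal.ofReal (k i x y) * ENNReal.ofReal (k' i y z) ∂halfMeasure (α i) =
      ENNReal.ofReal (k'' i x z)) (x z : Fin d → ℝ) :
    ∫⁻ y, ENNReal.ofReal (prodKernel k x y) * ENNReal.ofReal (prodKernel k' y z) ∂muAlpha α =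
      ENNReal.ofReal (prodKernel k'' x z) := by
  have e : ∀ y : Fin d → ℝ, ENNReal.ofReal (prodKernel k x y) * ENNReal.ofReal (prodKernel k' y z) =
      ∏ i, ENNReal.ofReal (k i (x i) (y i)) * ENNReal.ofReal (k' i (y i) (z i)) := by
    intro y
    rw [prodKernel, prodKernel, ENNReal.ofReal_prod_of_nonneg fun i _ => h0 i _ _,
      ENNReal.ofReal_prod_of_nonneg fun i _ => h0' i _ _, Finset.prod_mul_distrib]
  simp_rw [e]
  rw [lintegral_muAlpha_prod α
    (fun i y => ENNReal.ofReal (k i (x i) y) * ENNReal.ofReal (k' i y (z i))) fun i =>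
      ((hk i).comp measurable_prodMk_left).ennreal_ofReal.mul
        ((hk' i).comp (measurable_id.prodMk measurable_const)).ennreal_ofReal,
    prodKernel, ENNReal.ofReal_prod_of_nonneg fun i _ => h0'' i _ _]
  exact Finset.prod_congr rfl fun i _ => h i _ _

/-! ### The one-dimensional factors -/

theorem halfKernel_of_nonpos {ν t x : ℝ} (hx : ¬ 0 < x) (y : ℝ) : halfKernel ν t x y = 0 :=
  if_neg fun h => hx h.1

theorem exp_neg_sq_mul_tanh_le_one {x t : ℝ} (ht : 0 < t) :
    Real.exp (-(1 / 2) * x ^ 2 * (Real.sinh (2 * t) / Real.cosh (2 * t))) ≤ 1 := by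
  have hS := sinh_two_mul_pos ht
  have hC := Real.cosh_pos (2 * t)
  rw [Real.exp_le_one_iff]
  have : 0 ≤ x ^ 2 * (Real.sinh (2 * t) / Real.cosh (2 * t)) := by positivity
  nlinarith

theorem isSymmKernel_halfKernel {ν t : ℝ} (hν : -1 < ν) (ht : 0 < t) :
    IsSymmKernel (halfMeasure ν) (halfKernel ν t) (Real.cosh (2 * t) ^ (-(ν + 1))).toNNReal where
  meas := measurable_halfKernel hν t
  nonneg := halfKernel_nonneg hν ht
  symm := halfKernel_symm ν t
  bdd x := by
    obtain ⟨M, hM⟩ := exists_mul_halfKernel_le hν ht x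
    refine ⟨M, fun y => le_trans ?_ (hM y)⟩
    exact le_mul_of_one_le_left (halfKernel_nonneg hν ht x y) (by linarith [abs_nonneg y])
  mass x := by
    by_cases hx : 0 < x
    · rw [lintegral_halfKernel hν ht hx]
      refine ENNReal.ofReal_le_ofReal ?_
      exact mul_le_of_le_one_right (Real.rpow_nonneg (Real.cosh_pos _).le _)
        (exp_neg_sq_mul_tanh_le_one ht)
    · simp [halfKernel_of_nonpos hx]

theorem modHalfKernel_nonneg {a t : ℝ} (ha : -2 < a) (ht : 0 < t) (x y : ℝ) :
    0 ≤ modHalfKernel a t x y := by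
  rw [modHalfKernel]
  by_cases h : 0 < x ∧ 0 < y
  · exact mul_nonneg (mul_nonneg h.1.le h.2.le) (halfKernel_nonneg (by linarith) ht x y)
  · rw [halfKernel, if_neg h, mul_zero]

theorem measurable_modHalfKernel {a : ℝ} (ha : -2 < a) (t : ℝ) :
    Measurable (Function.uncurry (modHalfKernel a t)) :=
  (measurable_fst.mul measurable_snd).mul (measurable_halfKernel (by linarith) t)

/-- The bound M on the profile is left as a parameter: M = 1 yields the submarkovian case, a general
finite M the remaining range. -/
theorem isSymmKernel_modHalfKernel {a t : ℝ} (ha : -(3 / 2) < a) (ht : 0 < t) {M : NNReal}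
    (hM : ∀ u, 0 < u → massProfile (a + 1) u ≤ M) :
    IsSymmKernel (halfMeasure a) (modHalfKernel a t)
      (M * (Real.cosh (2 * t) ^ (-(a + 1))).toNNReal) where
  meas := measurable_modHalfKernel (by linarith) t
  nonneg := modHalfKernel_nonneg (by linarith) ht
  symm x y := by rw [modHalfKernel, modHalfKernel, halfKernel_symm, mul_comm x y]
  bdd x := by
    obtain ⟨B, hB⟩ := exists_mul_halfKernel_le (ν := a + 1) (by linarith) ht x
    refine ⟨|x| * B, fun y => le_trans ?_ (mul_le_mul_of_nonneg_left (hB y) (abs_nonneg x))⟩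
    have h0 := halfKernel_nonneg (ν := a + 1) (by linarith) ht x y
    calc x * y * halfKernel (a + 1) t x y ≤ |x * y| * halfKernel (a + 1) t x y := by
          gcongr; exact le_abs_self _
      _ = |x| * (|y| * halfKernel (a + 1) t x y) := by rw [abs_mul]; ring
      _ ≤ _ := by gcongr; linarith
  mass x := by
    by_cases hx : 0 < x
    · have hS := sinh_two_mul_pos ht
      have hC := Real.cosh_pos (2 * t)
      rw [lintegral_modHalfKernel ha ht hx, mul_comm]
      push_cast
      refine mul_le_mul' (hM _ (by positivity)) (ENNReal.ofReal_le_ofReal ?_)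
      refine mul_le_of_le_one_right (by positivity) ?_
      rw [Real.exp_le_one_iff, neg_nonpos]
      positivity
    · simp [modHalfKernel, halfKernel_of_nonpos hx]

/-- The factors of the modified kernel. -/
noncomputable def factorKernel (α : Fin d → ℝ) (j : Fin d) (t : ℝ) (i : Fin d) : ℝ → ℝ → ℝ :=
  if i = j then modHalfKernel (α i) t else halfKernel (α i) t

/-- The modified kernel, extended by zero off the orthant. -/
noncomputable def modKernel (α : Fin d → ℝ) (j : Fin d) (t : ℝ) (x y : Fin d → ℝ) : ℝ :=
  Real.exp (-2 * t) * prodKernel (factorKernel α j t) x y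

variable {α : Fin d → ℝ} {j : Fin d}

theorem measurable_factorKernel (hj : -(3 / 2 : ℝ) < α j) (hα : ∀ i, i ≠ j → -1 < α i) (t : ℝ)
    (i : Fin d) : Measurable (Function.uncurry (factorKernel α j t i)) := by
  rw [factorKernel]
  split_ifs with h
  · subst h; exact measurable_modHalfKernel (by linarith) t
  · exact measurable_halfKernel (hα i h) t

theorem factorKernel_nonneg (hj : -(3 / 2 : ℝ) < α j) (hα : ∀ i, i ≠ j → -1 < α i) {t : ℝ}
    (ht : 0 < t) (i : Fin d) (x y : ℝ) : 0 ≤ factorKernel α j t i x y := by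
  rw [factorKernel]
  split_ifs with h
  · subst h; exact modHalfKernel_nonneg (by linarith) ht x y
  · exact halfKernel_nonneg (hα i h) ht x y

theorem isSymmKernel_modKernel (hj : -(3 / 2 : ℝ) < α j) (hα : ∀ i, i ≠ j → -1 < α i) {t : ℝ}
    (ht : 0 < t) {M : NNReal} (hM : ∀ u, 0 < u → massProfile (α j + 1) u ≤ M) :
    IsSymmKernel (muAlpha α) (modKernel α j t)
      (M * (Real.exp (-2 * t) * Real.cosh (2 * t) ^ (-((∑ i, α i) + (d : ℝ)))).toNNReal) := by
  have h1 : ∀ i, IsSymmKernel (halfMeasure (α i)) (factorKernel α j t i)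
      ((if i = j then M else 1) * (Real.cosh (2 * t) ^ (-(α i + 1))).toNNReal) := by
    intro i
    rw [factorKernel]
    split_ifs with h
    · subst h; exact isSymmKernel_modHalfKernel hj ht hM
    · rw [one_mul]; exact isSymmKernel_halfKernel (hα i h) ht
  have h2 := (IsSymmKernel.prod h1).const_mul (Real.exp_pos (-2 * t)).le
  have e : (Real.exp (-2 * t)).toNNReal * ∏ i, ((if i = j then M else 1) *
      (Real.cosh (2 * t) ^ (-(α i + 1))).toNNReal) =
      M * (Real.exp (-2 * t) * Real.cosh (2 * t) ^ (-((∑ i, α i) + (d : ℝ)))).toNNReal := by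
    have hC := Real.cosh_pos (2 * t)
    rw [Finset.prod_mul_distrib, Finset.prod_ite_eq' Finset.univ j, if_pos (Finset.mem_univ j),
      ← Real.toNNReal_prod_of_nonneg fun i _ => by positivity,
      Real.toNNReal_mul (Real.exp_pos _).le, ← Real.rpow_sum_of_pos hC]
    have : ∑ i, -(α i + 1) = -((∑ i, α i) + (d : ℝ)) := by
      rw [Finset.sum_neg_distrib, Finset.sum_add_distrib]; simp
    rw [this]; ring
  rw [e] at h2
  exact h2

theorem lintegral_modKernel_mul (hj : -(3 / 2 : ℝ) < α j) (hα : ∀ i, i ≠ j → -1 < α i) {s t : ℝ}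
    (hs : 0 < s) (ht : 0 < t) (x z : Fin d → ℝ) :
    ∫⁻ y, ENNReal.ofReal (modKernel α j s x y) * ENNReal.ofReal (modKernel α j t y z) ∂muAlpha α =
      ENNReal.ofReal (modKernel α j (s + t) x z) := by
  have h := lintegral_prodKernel_mul (measurable_factorKernel hj hα s)
    (measurable_factorKernel hj hα t) (factorKernel_nonneg hj hα hs) (factorKernel_nonneg hj hα ht)
    (factorKernel_nonneg hj hα (add_pos hs ht)) (α := α) (fun i x z => by
      simp only [factorKernel]
      split_ifs with h
      · subst h; exact lintegral_modHalfKernel_mul_modHalfKernel (by linarith) hs ht x z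
      · exact lintegral_halfKernel_mul_halfKernel (hα i h) hs ht x z) x z
  simp only [modKernel]
  have e : Real.exp (-2 * (s + t)) = Real.exp (-2 * s) * Real.exp (-2 * t) := by
    rw [← Real.exp_add]; ring_nf
  rw [e, ENNReal.ofReal_mul (by positivity), ← h,
    ← lintegral_const_mul' _ _ ENNReal.ofReal_ne_top]
  congr 1; funext y
  rw [ENNReal.ofReal_mul (Real.exp_pos _).le, ENNReal.ofReal_mul (Real.exp_pos _).le,
    ENNReal.ofReal_mul (Real.exp_pos _).le]
  ring

theorem halfKernel_eq_besselI {ν t x y : ℝ} (ht : 0 < t) (hx : 0 < x) (hy : 0 < y) :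
    halfKernel ν t x y = (Real.sinh (2 * t))⁻¹ *
      (Real.exp (-(1 / 2) * (Real.cosh (2 * t) / Real.sinh (2 * t)) * (x ^ 2 + y ^ 2))) *
      ((x * y) ^ (-ν) * besselI ν (x * y / Real.sinh (2 * t))) := by
  have hS := sinh_two_mul_pos ht
  rw [halfKernel, if_pos ⟨hx, hy⟩, besselI_eq ν (by positivity), ← Real.exp_add]
  set S := Real.sinh (2 * t)
  have e1 : x * y / S / 2 = x * y / (2 * S) := by field_simp
  have e2 : (x * y) ^ (-ν) * (x * y / (2 * S)) ^ ν = (2 * S) ^ (-ν) := by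
    rw [Real.div_rpow (by positivity) (by positivity), Real.rpow_neg (by positivity),
      Real.rpow_neg (by positivity)]
    have : (x * y) ^ ν ≠ 0 := by positivity
    field_simp
  have e3 : -(Real.cosh (2 * t) / (2 * S)) * x ^ 2 + -(Real.cosh (2 * t) / (2 * S)) * y ^ 2 =
      -(1 / 2) * (Real.cosh (2 * t) / S) * (x ^ 2 + y ^ 2) := by field_simp; ring
  rw [e1, e3, ← e2]; ring

theorem heatKernel_eq_prodKernel (β : Fin d → ℝ) {t : ℝ} (ht : 0 < t) {x y : Fin d → ℝ}
    (hx : ∀ i, 0 < x i) (hy : ∀ i, 0 < y i) :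
    heatKernel β t x y = prodKernel (fun i => halfKernel (β i) t) x y := by
  rw [heatKernel, prodKernel,
    Finset.prod_congr rfl fun i _ => halfKernel_eq_besselI (ν := β i) ht (hx i) (hy i)]
  simp only [Finset.prod_mul_distrib]
  rw [← Real.exp_sum, Finset.prod_const,
    Finset.card_univ, Fintype.card_fin, ← Finset.mul_sum, Finset.sum_add_distrib]

/-- The factor x_j y_j and the shift of α by e_j both affect only the j-th coordinate, where
together they form `modHalfKernel`. -/
theorem prodKernel_factorKernel (α : Fin d → ℝ) (j : Fin d) (t : ℝ) (x y : Fin d → ℝ) :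
    prodKernel (factorKernel α j t) x y =
      x j * y j * prodKernel (fun i => halfKernel ((α + Pi.single j 1 : Fin d → ℝ) i) t) x y := by
  have e : x j * y j = ∏ i, if i = j then x i * y i else 1 := by
    rw [Finset.prod_ite_eq' Finset.univ j, if_pos (Finset.mem_univ j)]
  rw [e, prodKernel, prodKernel, ← Finset.prod_mul_distrib]
  refine Finset.prod_congr rfl fun i _ => ?_
  rw [factorKernel]
  split_ifs with h
  · subst h; simp [modHalfKernel]
  · simp [h]

theorem modifiedKernel_eq_modKernel (α : Fin d → ℝ) (j : Fin d) {t : ℝ} (ht : 0 < t)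
    {x y : Fin d → ℝ} (hx : ∀ i, 0 < x i) (hy : ∀ i, 0 < y i) :
    modifiedKernel α j t x y = modKernel α j t x y := by
  rw [modifiedKernel, modKernel, heatKernel_eq_prodKernel _ ht hx hy, prodKernel_factorKernel]

theorem modifiedSemigroup_eq_kernelOp {𝕜 : Type*} [RCLike 𝕜] (α : Fin d → ℝ) (j : Fin d) {t : ℝ}
    (ht : 0 < t) (f : (Fin d → ℝ) → 𝕜) {x : Fin d → ℝ} (hx : ∀ i, 0 < x i) :
    modifiedSemigroup α j t f x = kernelOp (muAlpha α) (modKernel α j t) f x := by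
  rw [modifiedSemigroup, if_neg ht.ne', kernelOp]
  refine integral_congr_ae ?_
  filter_upwards [muAlpha_ae_pos α] with y hy
  rw [modifiedKernel_eq_modKernel α j ht hx hy]

theorem modifiedSemigroup_ae_eq {𝕜 : Type*} [RCLike 𝕜] (α : Fin d → ℝ) (j : Fin d) {t : ℝ}
    (ht : 0 < t) (f : (Fin d → ℝ) → 𝕜) :
    modifiedSemigroup α j t f =ᵐ[muAlpha α] kernelOp (muAlpha α) (modKernel α j t) f := by
  filter_upwards [muAlpha_ae_pos α] with x hx
  exact modifiedSemigroup_eq_kernelOp α j ht f hx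

end Product

/-! ### Strong continuity of the product heat semigroup -/

section Continuity

variable {d : ℕ}

/-- The product heat kernel, extended by zero off the orthant. -/
noncomputable def prodHeatKernel (β : Fin d → ℝ) (t : ℝ) : (Fin d → ℝ) → (Fin d → ℝ) → ℝ :=
  prodKernel fun i => halfKernel (β i) t

/-- The image of the Gaussian `exp(-l y²)` under the one-dimensional heat semigroup. -/
noncomputable def gaussImage (ν l t x : ℝ) : ℝ :=
  (Real.cosh (2 * t) + 2 * l * Real.sinh (2 * t)) ^ (-(ν + 1)) *
    Real.exp (-(1 / 2) * x ^ 2 * ((Real.sinh (2 * t) + 2 * l * Real.cosh (2 * t)) /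
      (Real.cosh (2 * t) + 2 * l * Real.sinh (2 * t))))

theorem tendsto_gaussImage (ν l x : ℝ) :
    Tendsto (fun t => gaussImage ν l t x) (𝓝[>] 0) (𝓝 (Real.exp (-l * x ^ 2))) := by
  have h : ContinuousAt (fun t => gaussImage ν l t x) 0 := by
    unfold gaussImage
    have h1 : ContinuousAt (fun t => Real.cosh (2 * t) + 2 * l * Real.sinh (2 * t)) 0 := by
      fun_prop
    have h2 : Real.cosh (2 * 0) + 2 * l * Real.sinh (2 * 0) ≠ 0 := by simp
    refine (h1.rpow_const (Or.inl h2)).mul ?_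
    refine Real.continuous_exp.continuousAt.comp (ContinuousAt.mul continuousAt_const ?_)
    exact ContinuousAt.div (by fun_prop) h1 h2
  have h0 : gaussImage ν l 0 x = Real.exp (-l * x ^ 2) := by
    simp only [gaussImage, mul_zero, Real.cosh_zero, Real.sinh_zero, add_zero, Real.one_rpow,
      one_mul, zero_add, mul_one, div_one]
    congr 1; ring
  rw [← h0]
  exact h.tendsto.mono_left nhdsWithin_le_nhds

theorem gaussImage_nonneg {ν l t x : ℝ} (ht : 0 < t) (hl : 0 ≤ l) : 0 ≤ gaussImage ν l t x := by
  have := sinh_two_mul_pos ht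
  have := Real.cosh_pos (2 * t)
  unfold gaussImage
  positivity

/-- At l = 1/2 the quotient in the exponent is 1: exp(-x²/2) is the ground state, an eigenfunction
with eigenvalue at most 1. It serves as the time-independent majorant. -/
theorem gaussImage_half_le {ν t x : ℝ} (hν : -1 < ν) (ht : 0 < t) :
    gaussImage ν (1 / 2) t x ≤ Real.exp (-(1 / 2) * x ^ 2) := by
  have hS := sinh_two_mul_pos ht
  have hC := Real.one_le_cosh (2 * t)
  unfold gaussImage
  have e : (Real.sinh (2 * t) + 2 * (1 / 2) * Real.cosh (2 * t)) /
      (Real.cosh (2 * t) + 2 * (1 / 2) * Real.sinh (2 * t)) = 1 := by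
    rw [div_eq_one_iff_eq (by positivity)]; ring
  rw [e, mul_one]
  refine mul_le_of_le_one_left (Real.exp_pos _).le ?_
  exact Real.rpow_le_one_of_one_le_of_nonpos (by linarith) (by linarith)

variable {β : Fin d → ℝ}

theorem isSymmKernel_prodHeatKernel (hβ : ∀ i, -1 < β i) {t : ℝ} (ht : 0 < t) :
    IsSymmKernel (muAlpha β) (prodHeatKernel β t)
      (∏ i, (Real.cosh (2 * t) ^ (-(β i + 1))).toNNReal) :=
  IsSymmKernel.prod fun i => isSymmKernel_halfKernel (hβ i) ht

theorem prod_toNNReal_cosh_le_one (hβ : ∀ i, -1 < β i) (t : ℝ) :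
    ∏ i, (Real.cosh (2 * t) ^ (-(β i + 1))).toNNReal ≤ 1 :=
  Finset.prod_le_one' fun i _ => Real.toNNReal_le_one.2
    (Real.rpow_le_one_of_one_le_of_nonpos (Real.one_le_cosh _) (by linarith [hβ i]))

/-- The Gaussian with parameters `l i`. -/
noncomputable def gaussian (l x : Fin d → ℝ) : ℝ := ∏ i, Real.exp (-l i * x i ^ 2)

theorem gaussian_pos (l x : Fin d → ℝ) : 0 < gaussian l x :=
  Finset.prod_pos fun _ _ => Real.exp_pos _

theorem gaussian_le_one {l : Fin d → ℝ} (hl : ∀ i, 0 ≤ l i) (x : Fin d → ℝ) : gaussian l x ≤ 1 :=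
  Finset.prod_le_one (fun _ _ => (Real.exp_pos _).le) fun i _ => by
    rw [Real.exp_le_one_iff]
    have := mul_nonneg (hl i) (sq_nonneg (x i))
    linarith

theorem continuous_gaussian (l : Fin d → ℝ) : Continuous (gaussian l) := by
  unfold gaussian; fun_prop

theorem memL1AddLinf_gaussian (μ : Measure (Fin d → ℝ)) {l : Fin d → ℝ} (hl : ∀ i, 0 ≤ l i) :
    MemL1AddLinf μ (gaussian l) :=
  .of_memLp_top (memLp_top_of_bound (continuous_gaussian l).aestronglyMeasurable 1
    (Eventually.of_forall fun x => by
      rw [Real.norm_of_nonneg (gaussian_pos l x).le]; exact gaussian_le_one hl x))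

theorem kernelOp_gaussian (hβ : ∀ i, -1 < β i) {t : ℝ} (ht : 0 < t) {l : Fin d → ℝ}
    (hl : ∀ i, 0 ≤ l i) {x : Fin d → ℝ} (hx : ∀ i, 0 < x i) :
    kernelOp (muAlpha β) (prodHeatKernel β t) (gaussian l) x =
      ∏ i, gaussImage (β i) (l i) t (x i) := by
  have hK := isSymmKernel_prodHeatKernel hβ ht
  simp only [kernelOp, smul_eq_mul]
  rw [integral_eq_lintegral_of_nonneg_ae
    (Eventually.of_forall fun y => mul_nonneg (hK.nonneg x y) (gaussian_pos l y).le)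
    ((hK.measurable_right x).mul (continuous_gaussian l).measurable).aestronglyMeasurable]
  have e : ∀ y, prodHeatKernel β t x y * gaussian l y =
      ∏ i, halfKernel (β i) t (x i) (y i) * Real.exp (-l i * y i ^ 2) := fun y => by
    rw [prodHeatKernel, prodKernel, gaussian, Finset.prod_mul_distrib]
  simp_rw [e, ENNReal.ofReal_prod_of_nonneg fun i _ =>
    mul_nonneg (halfKernel_nonneg (hβ i) ht _ _) (Real.exp_pos _).le]
  rw [lintegral_muAlpha_prod β
    (fun i y => ENNReal.ofReal (halfKernel (β i) t (x i) y * Real.exp (-l i * y ^ 2))) fun i =>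
      (((measurable_halfKernel (hβ i) t).comp measurable_prodMk_left).mul
        (by fun_prop)).ennreal_ofReal,
    Finset.prod_congr rfl fun i _ => show _ = ENNReal.ofReal (gaussImage (β i) (l i) t (x i)) from
      lintegral_halfKernel_mul_exp (hβ i) ht (hx i) (hl i),
    ← ENNReal.ofReal_prod_of_nonneg fun i _ => gaussImage_nonneg (ν := β i) ht (hl i),
    ENNReal.toReal_ofReal (Finset.prod_nonneg fun i _ => gaussImage_nonneg ht (hl i))]

theorem tendsto_kernelOp_gaussian (hβ : ∀ i, -1 < β i) {l : Fin d → ℝ}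
    (hl : ∀ i, 0 ≤ l i) {x : Fin d → ℝ} (hx : ∀ i, 0 < x i) :
    Tendsto (fun t => kernelOp (muAlpha β) (prodHeatKernel β t) (gaussian l) x) (𝓝[>] 0)
      (𝓝 (gaussian l x)) := by
  have h : Tendsto (fun t => ∏ i, gaussImage (β i) (l i) t (x i)) (𝓝[>] 0) (𝓝 (gaussian l x)) :=
    tendsto_finsetProd _ fun i _ => tendsto_gaussImage _ _ _
  refine h.congr' ?_
  filter_upwards [self_mem_nhdsWithin] with t ht
  exact (kernelOp_gaussian hβ ht hl hx).symm

theorem lintegral_gaussian_lt_top (hβ : ∀ i, -1 < β i) {l : Fin d → ℝ} (hl : ∀ i, 0 < l i) :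
    ∫⁻ y, ENNReal.ofReal (gaussian l y) ∂muAlpha β < ∞ := by
  simp_rw [gaussian, ENNReal.ofReal_prod_of_nonneg fun i _ => (Real.exp_pos _).le]
  rw [lintegral_muAlpha_prod β (fun i y => ENNReal.ofReal (Real.exp (-l i * y ^ 2)))
    fun i => by fun_prop]
  refine ENNReal.prod_lt_top fun i _ => ?_
  have := lintegral_pow_mul_exp (hβ i) (hl i) 0
  simp only [mul_zero, pow_zero, one_mul] at this
  rw [this]
  exact ENNReal.ofReal_lt_top

/-- The density may blow up at the boundary, so local finiteness comes from Markov's inequality with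
an integrable Gaussian. It is needed for the density of compactly supported functions in L². -/
theorem isLocallyFiniteMeasure_muAlpha (hβ : ∀ i, -1 < β i) :
    IsLocallyFiniteMeasure (muAlpha β) := by
  refine ⟨fun x => ?_⟩
  set g : (Fin d → ℝ) → ℝ := gaussian fun _ => 1
  have hx : 0 < g x := gaussian_pos _ x
  have hc : Continuous g := continuous_gaussian _
  refine ⟨{y | g x / 2 < g y}, (isOpen_lt continuous_const hc).mem_nhds (by
    show g x / 2 < g x; linarith), ?_⟩
  have hε : ENNReal.ofReal (g x / 2) ≠ 0 := by simpa using hx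
  refine lt_of_le_of_lt (measure_mono fun y hy => ?_)
    ((meas_ge_le_lintegral_div (f := fun y => ENNReal.ofReal (g y)) (ε := ENNReal.ofReal (g x / 2))
      (by fun_prop) hε ENNReal.ofReal_ne_top).trans_lt
        (ENNReal.div_lt_top (lintegral_gaussian_lt_top hβ fun _ => one_pos).ne hε))
  exact ENNReal.ofReal_le_ofReal (le_of_lt hy)

/-- A bounded continuous function is close to its value at `x`, up to squared differences of
one-dimensional Gaussians. -/
theorem exists_norm_sub_le {E : Type*} [NormedAddCommGroup E] {g : (Fin d → ℝ) → E}
    (hg : Continuous g) {B : ℝ} (hB : ∀ y, ‖g y‖ ≤ B) {x : Fin d → ℝ} (hx : ∀ i, 0 < x i)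
    {ε : ℝ} (hε : 0 < ε) :
    ∃ A : ℝ, 0 ≤ A ∧ ∀ y : Fin d → ℝ, (∀ i, 0 < y i) →
      ‖g y - g x‖ ≤ ε + A * ∑ i, (Real.exp (-(1 / 2) * y i ^ 2) -
        Real.exp (-(1 / 2) * x i ^ 2)) ^ 2 := by
  -- On the orthant e is injective with continuous inverse s, so closeness of e y to e x forces
  -- closeness of g y to g x.
  set e : (Fin d → ℝ) → Fin d → ℝ := fun y i => Real.exp (-(1 / 2) * y i ^ 2)
  set s : (Fin d → ℝ) → Fin d → ℝ := fun z i => Real.sqrt (-2 * Real.log (z i))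
  have hse : ∀ y : Fin d → ℝ, (∀ i, 0 < y i) → s (e y) = y := by
    intro y hy
    funext i
    simp only [s, e, Real.log_exp]
    rw [← Real.sqrt_sq (hy i).le]
    congr 1
    rw [Real.sqrt_sq (hy i).le]; ring
  have hs : ContinuousAt s (e x) := by
    refine continuousAt_pi.2 fun i => ?_
    refine Real.continuous_sqrt.continuousAt.comp (ContinuousAt.mul continuousAt_const ?_)
    exact (continuous_apply i).continuousAt.log (Real.exp_pos _).ne'
  have hgs : ContinuousAt (g ∘ s) (e x) := hg.continuousAt.comp hs
  obtain ⟨η, hη, hηε⟩ := Metric.continuousAt_iff.1 hgs ε hε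
  have hB0 : 0 ≤ B := (norm_nonneg _).trans (hB x)
  -- When e y is at distance at least η from e x, the sum of squares is at least η², so this
  -- constant covers the trivial bound 2B.
  refine ⟨2 * B / η ^ 2, by positivity, fun y hy => ?_⟩
  have hsum : 0 ≤ ∑ i, (e y i - e x i) ^ 2 := Finset.sum_nonneg fun i _ => sq_nonneg _
  rcases lt_or_ge (dist (e y) (e x)) η with h | h
  · have := hηε h
    simp only [Function.comp, hse y hy, hse x hx, dist_eq_norm] at this
    have h0 : 0 ≤ 2 * B / η ^ 2 * ∑ i, (e y i - e x i) ^ 2 := by positivity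
    exact this.le.trans (by linarith)
  · obtain ⟨i, hi⟩ : ∃ i, η ≤ dist (e y i) (e x i) := by
      by_contra! hcon
      exact absurd ((dist_pi_lt_iff hη).2 hcon) (not_lt.2 h)
    have h1 : η ^ 2 ≤ ∑ i, (e y i - e x i) ^ 2 := by
      calc η ^ 2 ≤ |e y i - e x i| ^ 2 := by
            rw [Real.dist_eq] at hi
            gcongr
        _ = (e y i - e x i) ^ 2 := sq_abs _
        _ ≤ _ := Finset.single_le_sum (f := fun i => (e y i - e x i) ^ 2)
            (fun i _ => sq_nonneg _) (Finset.mem_univ i)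
    have h2 : ‖g y - g x‖ ≤ 2 * B := by
      linarith [norm_sub_le (g y) (g x), hB y, hB x]
    have h3 : 2 * B ≤ 2 * B / η ^ 2 * ∑ i, (e y i - e x i) ^ 2 := by
      calc 2 * B = 2 * B / η ^ 2 * η ^ 2 := by field_simp
        _ ≤ _ := by gcongr
    linarith

variable {𝕜 : Type*} [RCLike 𝕜]

theorem gaussian_single (i : Fin d) (l : ℝ) (x : Fin d → ℝ) :
    gaussian (Pi.single i l) x = Real.exp (-l * x i ^ 2) := by
  rw [gaussian, Finset.prod_eq_single i]
  · simp
  · intro k _ hk; simp [Pi.single_eq_of_ne hk]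
  · simp

theorem gaussian_zero (x : Fin d → ℝ) : gaussian 0 x = 1 := by simp [gaussian]

/-- Korovkin's argument. The error is controlled by the operator applied to 1 and to the squares
(exp(-y_i²/2) - exp(-x_i²/2))², which expand into Gaussians with l = 1, 1/2, 0 whose images are
explicit. Since constants are not preserved, ‖g x‖·|T1 - 1| is estimated separately. -/
theorem tendsto_prodHeatKernel_apply (hβ : ∀ i, -1 < β i) {g : (Fin d → ℝ) → 𝕜}
    (hg : Continuous g) {B : ℝ} (hB : ∀ y, ‖g y‖ ≤ B) {x : Fin d → ℝ} (hx : ∀ i, 0 < x i) :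
    Tendsto (fun t => kernelOp (muAlpha β) (prodHeatKernel β t) g x) (𝓝[>] 0) (𝓝 (g x)) := by
  set μ := muAlpha β
  set T : ℝ → ((Fin d → ℝ) → ℝ) → ℝ := fun t f => kernelOp μ (prodHeatKernel β t) f x
  set e : Fin d → ℝ := fun i => Real.exp (-(1 / 2) * x i ^ 2) with he
  have hT0 : Tendsto (fun t => T t (gaussian 0)) (𝓝[>] 0) (𝓝 1) := by
    have := tendsto_kernelOp_gaussian hβ (l := 0) (fun _ => le_rfl) hx
    rwa [gaussian_zero] at this
  have hs : ∀ (i : Fin d) (l : ℝ), 0 ≤ l → ∀ k, 0 ≤ (Pi.single i l : Fin d → ℝ) k := by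
    intro i l hl k
    rw [Pi.single_apply]; split_ifs <;> simp [hl]
  have hT1 : ∀ i, Tendsto (fun t => T t (gaussian (Pi.single i (1 / 2)))) (𝓝[>] 0) (𝓝 (e i)) := by
    intro i
    have := tendsto_kernelOp_gaussian hβ (hs i (1 / 2) (by norm_num)) hx
    rwa [gaussian_single] at this
  have hT2 : ∀ i, Tendsto (fun t => T t (gaussian (Pi.single i 1))) (𝓝[>] 0) (𝓝 (e i ^ 2)) := by
    intro i
    have := tendsto_kernelOp_gaussian hβ (hs i 1 (by norm_num)) hx
    rw [gaussian_single] at this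
    convert this using 2
    rw [he, ← Real.exp_nat_mul]; congr 1; push_cast; ring
  set V : Fin d → ℝ → ℝ := fun i t => T t (gaussian (Pi.single i 1)) -
    2 * e i * T t (gaussian (Pi.single i (1 / 2))) + e i ^ 2 * T t (gaussian 0)
  have hV : ∀ i, Tendsto (V i) (𝓝[>] 0) (𝓝 0) := by
    intro i
    have := ((hT2 i).sub ((hT1 i).const_mul (2 * e i))).add (hT0.const_mul (e i ^ 2))
    convert this using 2; ring
  rw [Metric.tendsto_nhds]
  intro ε hε
  obtain ⟨A, hA, hbound⟩ := exists_norm_sub_le hg hB hx (half_pos hε)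
  have hlim : Tendsto (fun t => ε / 2 * T t (gaussian 0) + A * ∑ i, V i t +
      ‖g x‖ * |T t (gaussian 0) - 1|) (𝓝[>] 0) (𝓝 (ε / 2)) := by
    have h1 := ((hT0.const_mul (ε / 2)).add
      ((tendsto_finsetSum Finset.univ fun i _ => hV i).const_mul A)).add
      (((hT0.sub_const 1).abs).const_mul ‖g x‖)
    convert h1 using 2; simp
  filter_upwards [hlim.eventually (gt_mem_nhds (half_lt_self hε)), self_mem_nhdsWithin] with t ht ht0
  have ht0 : 0 < t := ht0
  refine lt_of_le_of_lt ?_ ht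
  have hK := isSymmKernel_prodHeatKernel hβ ht0
  have hint : ∀ {l : Fin d → ℝ}, (∀ i, 0 ≤ l i) →
      Integrable (fun y => prodHeatKernel β t x y * gaussian l y) μ :=
    fun hl => hK.integrable (memL1AddLinf_gaussian μ hl) x
  have hg1 : MemL1AddLinf μ g := .of_memLp_top
    (memLp_top_of_bound hg.aestronglyMeasurable B (Eventually.of_forall hB))
  have hVint : ∀ i, Integrable (fun y => prodHeatKernel β t x y *
      (Real.exp (-(1 / 2) * y i ^ 2) - e i) ^ 2) μ ∧
      ∫ y, prodHeatKernel β t x y * (Real.exp (-(1 / 2) * y i ^ 2) - e i) ^ 2 ∂μ = V i t := by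
    intro i
    have h2 := hint (hs i 1 (by norm_num))
    have h1 := (hint (hs i (1 / 2) (by norm_num))).const_mul (2 * e i)
    have h0 := (hint (l := 0) (fun _ => le_rfl)).const_mul (e i ^ 2)
    have heq : (fun y => prodHeatKernel β t x y * (Real.exp (-(1 / 2) * y i ^ 2) - e i) ^ 2) =
        fun y => prodHeatKernel β t x y * gaussian (Pi.single i 1) y -
          2 * e i * (prodHeatKernel β t x y * gaussian (Pi.single i (1 / 2)) y) +
          e i ^ 2 * (prodHeatKernel β t x y * gaussian 0 y) := by
      funext y
      have : Real.exp (-1 * y i ^ 2) = Real.exp (-(1 / 2) * y i ^ 2) ^ 2 := by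
        rw [← Real.exp_nat_mul]; congr 1; push_cast; ring
      rw [gaussian_single, gaussian_single, gaussian_zero, this]; ring
    refine ⟨heq ▸ (h2.sub h1).add h0, ?_⟩
    rw [heq]
    refine (integral_add (h2.sub h1) h0).trans ?_
    refine (congrArg₂ (· + ·) (integral_sub h2 h1) rfl).trans ?_
    rw [integral_const_mul, integral_const_mul]
    rfl
  have hconst : Integrable (fun y => prodHeatKernel β t x y • g x) μ :=
    (hK.integrable_right x).smul_const (g x)
  have hgx : ∫ y, prodHeatKernel β t x y • g x ∂μ = T t (gaussian 0) • g x := by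
    rw [integral_smul_const]
    congr 1
    simp only [T, kernelOp, gaussian_zero, smul_eq_mul, mul_one]
  have hdiff : kernelOp μ (prodHeatKernel β t) g x - T t (gaussian 0) • g x =
      ∫ y, prodHeatKernel β t x y • (g y - g x) ∂μ := by
    rw [← hgx, kernelOp, ← integral_sub (hK.integrable hg1 x) hconst]
    simp_rw [smul_sub]
    rfl
  have hmain : ‖∫ y, prodHeatKernel β t x y • (g y - g x) ∂μ‖ ≤
      ε / 2 * T t (gaussian 0) + A * ∑ i, V i t := by
    have hsumint : Integrable (fun y => ∑ i, prodHeatKernel β t x y *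
        (Real.exp (-(1 / 2) * y i ^ 2) - e i) ^ 2) μ :=
      integrable_finsetSum _ fun i _ => (hVint i).1
    have h0 := (hint (l := 0) (fun _ => le_rfl)).const_mul (ε / 2)
    have e1 : ε / 2 * T t (gaussian 0) + A * ∑ i, V i t =
        ∫ y, (ε / 2 * (prodHeatKernel β t x y * gaussian 0 y) +
          A * ∑ i, prodHeatKernel β t x y * (Real.exp (-(1 / 2) * y i ^ 2) - e i) ^ 2) ∂μ := by
      rw [integral_add h0 (hsumint.const_mul A), integral_const_mul, integral_const_mul,
        integral_finsetSum _ fun i _ => (hVint i).1,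
        Finset.sum_congr rfl fun i _ => (hVint i).2]
      rfl
    rw [e1]
    refine norm_integral_le_of_norm_le (h0.add (hsumint.const_mul A)) ?_
    filter_upwards [muAlpha_ae_pos β] with y hy
    rw [norm_smul, Real.norm_of_nonneg (hK.nonneg x y), gaussian_zero, ← Finset.mul_sum]
    have := mul_le_mul_of_nonneg_left (hbound y hy) (hK.nonneg x y)
    refine this.trans (le_of_eq ?_)
    simp only [he]; ring
  rw [dist_eq_norm]
  have esplit : kernelOp μ (prodHeatKernel β t) g x - g x =
      (kernelOp μ (prodHeatKernel β t) g x - T t (gaussian 0) • g x) +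
        (T t (gaussian 0) - 1) • g x := by
    rw [sub_smul, one_smul]; abel
  rw [esplit]
  refine (norm_add_le _ _).trans (add_le_add ?_ ?_)
  · rw [hdiff]; exact hmain
  · rw [norm_smul, Real.norm_eq_abs, mul_comm]

/-- Compact support gives |g| ≤ M exp(-|x|²/2), and positivity together with the ground state bound
propagates this to all t > 0. The squared difference is then dominated by the integrable (2M)²
exp(-|x|²). -/
theorem tendsto_eLpNorm_prodHeatKernel_of_hasCompactSupport (hβ : ∀ i, -1 < β i)
    {g : (Fin d → ℝ) → 𝕜} (hg : Continuous g) (hgc : HasCompactSupport g) :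
    Tendsto (fun t => eLpNorm (kernelOp (muAlpha β) (prodHeatKernel β t) g - g) 2 (muAlpha β))
      (𝓝[>] 0) (𝓝 0) := by
  set μ := muAlpha β
  set l : Fin d → ℝ := fun _ => 1 / 2 with hl
  have hl0 : ∀ i, 0 ≤ l i := fun i => by norm_num [hl]
  have hB : ∃ B, ∀ y, ‖g y‖ ≤ B := hgc.exists_bound_of_continuous hg
  obtain ⟨B, hB⟩ := hB
  obtain ⟨M, hM⟩ : ∃ M, ∀ y, ‖(gaussian l y)⁻¹ • g y‖ ≤ M := by
    have hc : Continuous fun y => (gaussian l y)⁻¹ • g y :=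
      ((continuous_gaussian l).inv₀ fun y => (gaussian_pos l y).ne').smul hg
    exact (hgc.smul_left (f := fun y => (gaussian l y)⁻¹)).exists_bound_of_continuous hc
  have hM0 : 0 ≤ M := (norm_nonneg _).trans (hM 0)
  have hM' : ∀ y, ‖g y‖ ≤ M * gaussian l y := by
    intro y
    have h := hM y
    have hp := gaussian_pos l y
    rw [norm_smul, norm_inv, Real.norm_of_nonneg hp.le, inv_mul_le_iff₀ hp] at h
    rwa [mul_comm]
  have hg1 : MemL1AddLinf μ g := .of_memLp_top
    (memLp_top_of_bound hg.aestronglyMeasurable B (Eventually.of_forall hB))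
  have hTb : ∀ t, 0 < t → ∀ x : Fin d → ℝ, (∀ i, 0 < x i) →
      ‖kernelOp μ (prodHeatKernel β t) g x‖ ≤ M * gaussian l x := by
    intro t ht x hx
    have hK := isSymmKernel_prodHeatKernel hβ ht
    calc ‖kernelOp μ (prodHeatKernel β t) g x‖
        ≤ ∫ y, M * (prodHeatKernel β t x y * gaussian l y) ∂μ := by
          refine norm_integral_le_of_norm_le
            ((hK.integrable (memL1AddLinf_gaussian μ hl0) x).const_mul M)
            (Eventually.of_forall fun y => ?_)
          rw [norm_smul, Real.norm_of_nonneg (hK.nonneg x y)]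
          calc _ ≤ prodHeatKernel β t x y * (M * gaussian l y) :=
                mul_le_mul_of_nonneg_left (hM' y) (hK.nonneg x y)
            _ = _ := by ring
      _ = M * ∏ i, gaussImage (β i) (l i) t (x i) := by
          rw [integral_const_mul, ← kernelOp_gaussian hβ ht hl0 hx]; rfl
      _ ≤ M * gaussian l x := by
          gcongr
          exact Finset.prod_le_prod (fun i _ => gaussImage_nonneg ht (hl0 i))
            fun i _ => gaussImage_half_le (hβ i) ht
  have hlim : Tendsto (fun t => ∫⁻ x, ‖(kernelOp μ (prodHeatKernel β t) g - g) x‖ₑ ^ (2 : ℝ) ∂μ)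
      (𝓝[>] 0) (𝓝 (∫⁻ _, 0 ∂μ)) := by
    refine tendsto_lintegral_filter_of_dominated_convergence'
      (fun x => ENNReal.ofReal ((2 * M) ^ 2) * ENNReal.ofReal (gaussian (fun _ => 1) x)) ?_ ?_ ?_ ?_
    · filter_upwards [self_mem_nhdsWithin] with t ht
      have hK := isSymmKernel_prodHeatKernel hβ ht
      exact ((hK.aestronglyMeasurable hg1.aestronglyMeasurable).sub
        hg1.aestronglyMeasurable).enorm.pow_const _
    · filter_upwards [self_mem_nhdsWithin] with t ht
      filter_upwards [muAlpha_ae_pos β] with x hx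
      have h1 : ‖(kernelOp μ (prodHeatKernel β t) g - g) x‖ ≤ 2 * M * gaussian l x := by
        rw [Pi.sub_apply]
        linarith [norm_sub_le (kernelOp μ (prodHeatKernel β t) g x) (g x), hTb t ht x hx, hM' x]
      have h2 : gaussian l x ^ 2 = gaussian (fun _ => 1) x := by
        rw [gaussian, gaussian, ← Finset.prod_pow]
        refine Finset.prod_congr rfl fun i _ => ?_
        rw [← Real.exp_nat_mul]; congr 1; push_cast; ring
      rw [← ENNReal.ofReal_mul (by positivity), ← h2, ← mul_pow, ← ofReal_norm,
        ENNReal.rpow_two, ← ENNReal.ofReal_pow (norm_nonneg _)]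
      exact ENNReal.ofReal_le_ofReal (pow_le_pow_left₀ (norm_nonneg _) h1 2)
    · rw [lintegral_const_mul' _ _ ENNReal.ofReal_ne_top]
      exact ENNReal.mul_ne_top ENNReal.ofReal_ne_top
        (lintegral_gaussian_lt_top hβ fun _ => one_pos).ne
    · filter_upwards [muAlpha_ae_pos β] with x hx
      have h1 := ((tendsto_prodHeatKernel_apply hβ hg hB hx).sub_const (g x)).enorm
      rw [sub_self, enorm_zero] at h1
      have h2 := (ENNReal.continuous_rpow_const (y := 2)).continuousAt.tendsto.comp h1
      simpa [Function.comp_def] using h2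
  simp only [lintegral_zero] at hlim
  have h3 := (ENNReal.continuous_rpow_const (y := 1 / 2)).continuousAt.tendsto.comp hlim
  rw [ENNReal.zero_rpow_of_pos (by norm_num)] at h3
  refine h3.congr fun t => ?_
  rw [eLpNorm_eq_lintegral_rpow_enorm_toReal (by norm_num) (by norm_num)]
  simp

/-- Strong continuity at zero of the heat semigroup on `L²`. -/
theorem tendsto_eLpNorm_prodHeatKernel (hβ : ∀ i, -1 < β i)
    {f : (Fin d → ℝ) → 𝕜} (hf : MemLp f 2 (muAlpha β)) :
    Tendsto (fun t => eLpNorm (kernelOp (muAlpha β) (prodHeatKernel β t) f - f) 2 (muAlpha β))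
      (𝓝[>] 0) (𝓝 0) := by
  set μ := muAlpha β
  have hlf : IsLocallyFiniteMeasure μ := isLocallyFiniteMeasure_muAlpha hβ
  rw [ENNReal.tendsto_nhds_zero]
  intro ε hε
  have hε3 : 0 < ε / 3 := ENNReal.div_pos hε.ne' (by norm_num)
  obtain ⟨g, hgc, hfg, hg, hgm⟩ := hf.exists_hasCompactSupport_eLpNorm_sub_le
    (by norm_num) hε3.ne'
  have hlim := ENNReal.tendsto_nhds_zero.1
    (tendsto_eLpNorm_prodHeatKernel_of_hasCompactSupport hβ hg hgc) _ hε3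
  filter_upwards [hlim, self_mem_nhdsWithin] with t ht ht0
  have ht0 : 0 < t := ht0
  have hK := isSymmKernel_prodHeatKernel hβ ht0
  have hfgm := hf.sub hgm
  have e : kernelOp μ (prodHeatKernel β t) f - f =
      kernelOp μ (prodHeatKernel β t) (f - g) +
        (kernelOp μ (prodHeatKernel β t) g - g) - (f - g) := by
    have h1 := hK.kernelOp_add (𝕜 := 𝕜) (.of_memLp (by norm_num) hfgm)
      (.of_memLp (by norm_num) hgm)
    rw [sub_add_cancel] at h1
    rw [h1]; abel
  have m1 := (hK.memLp (by norm_num) hfgm).1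
  have m2 := ((hK.memLp (by norm_num) hgm).sub hgm).1
  have h1 : eLpNorm (kernelOp μ (prodHeatKernel β t) (f - g)) 2 μ ≤ ε / 3 := by
    refine (hK.eLpNorm_le (by norm_num) hfgm.1).trans ?_
    calc _ ≤ 1 * (ε / 3) := by
          gcongr
          exact_mod_cast prod_toNNReal_cosh_le_one hβ t
      _ = _ := one_mul _
  calc _ ≤ eLpNorm (kernelOp μ (prodHeatKernel β t) (f - g) +
        (kernelOp μ (prodHeatKernel β t) g - g)) 2 μ + eLpNorm (f - g) 2 μ := by
        rw [e]; exact eLpNorm_sub_le (m1.add m2) hfgm.1 (by norm_num)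
    _ ≤ ε / 3 + ε / 3 + ε / 3 := by
        gcongr
        exact (eLpNorm_add_le m1 m2 (by norm_num)).trans (add_le_add h1 ht)
    _ = ε := ENNReal.add_thirds ε

end Continuity

/-! ### Transfer from μ_{α+e_j} to μ_α -/

section Transfer

variable {d : ℕ} {𝕜 : Type*} [RCLike 𝕜]

theorem muAlpha_add_single (α : Fin d → ℝ) (j : Fin d) :
    muAlpha (α + Pi.single j 1) = (muAlpha α).withDensity fun x => ENNReal.ofReal (x j ^ 2) := by
  rw [muAlpha, muAlpha, ← withDensity_mul _ (measurable_weight α) (by fun_prop)]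
  refine withDensity_congr_ae ?_
  filter_upwards [ae_restrict_mem measurableSet_forall_pos] with x hx
  have hx : ∀ i, 0 < x i := hx
  rw [Pi.mul_apply, ← ENNReal.ofReal_mul
    (Finset.prod_nonneg fun i _ => Real.rpow_nonneg (hx i).le _)]
  congr 1
  have e : x j ^ 2 = ∏ i, if i = j then x i ^ 2 else 1 := by
    rw [Finset.prod_ite_eq' Finset.univ j, if_pos (Finset.mem_univ j)]
  rw [e, ← Finset.prod_mul_distrib]
  refine Finset.prod_congr rfl fun i _ => ?_
  split_ifs with h
  · subst h
    rw [← Real.rpow_two, ← Real.rpow_add (hx i)]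
    congr 1
    simp only [Pi.add_apply, Pi.single_eq_same]
    ring
  · simp [Pi.single_eq_of_ne h]

theorem eLpNorm_two_coord_smul (α : Fin d → ℝ) (j : Fin d) (h : (Fin d → ℝ) → 𝕜) :
    eLpNorm (fun x => x j • h x) 2 (muAlpha α) = eLpNorm h 2 (muAlpha (α + Pi.single j 1)) := by
  rw [eLpNorm_eq_lintegral_rpow_enorm_toReal (by norm_num) (by norm_num),
    eLpNorm_eq_lintegral_rpow_enorm_toReal (by norm_num) (by norm_num), muAlpha_add_single,
    lintegral_withDensity_eq_lintegral_mul_non_measurable _ (by fun_prop)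
      (Eventually.of_forall fun _ => ENNReal.ofReal_lt_top)]
  congr 2; funext x
  rw [enorm_smul, ENNReal.mul_rpow_of_nonneg _ _ (by norm_num), Pi.mul_apply]
  congr 1
  rw [ENNReal.toReal_ofNat, ENNReal.rpow_two, ← ofReal_norm, ← ENNReal.ofReal_pow (norm_nonneg _),
    Real.norm_eq_abs, sq_abs]

/-- Conjugation by multiplication with x_j: writing y_j f = y_j²(f/y_j), the factor y_j² becomes the
density of μ_{α+e_j} relative to μ_α. -/
theorem kernelOp_modKernel_eq (α : Fin d → ℝ) (j : Fin d) (t : ℝ) (f : (Fin d → ℝ) → 𝕜)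
    (x : Fin d → ℝ) :
    kernelOp (muAlpha α) (modKernel α j t) f x =
      x j • Real.exp (-2 * t) • kernelOp (muAlpha (α + Pi.single j 1))
        (prodHeatKernel (α + Pi.single j 1) t) (fun y => (y j)⁻¹ • f y) x := by
  rw [kernelOp, kernelOp, muAlpha_add_single,
    integral_withDensity_eq_integral_toReal_smul (by fun_prop)
      (Eventually.of_forall fun _ => ENNReal.ofReal_lt_top), ← integral_smul, ← integral_smul]
  refine integral_congr_ae ?_
  filter_upwards [muAlpha_ae_pos α] with y hy
  have hyj := (hy j).ne'
  rw [ENNReal.toReal_ofReal (sq_nonneg _), modKernel, prodKernel_factorKernel]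
  simp only [smul_smul]
  congr 1
  rw [prodHeatKernel]
  field_simp

/-- Strong continuity at zero of the modified semigroup on `L²`. -/
theorem tendsto_eLpNorm_modifiedSemigroup {α : Fin d → ℝ} {j : Fin d} (hj : -2 < α j)
    (hα : ∀ i, i ≠ j → -1 < α i) {f : (Fin d → ℝ) → 𝕜} (hf : MemLp f 2 (muAlpha α)) :
    Tendsto (fun t => eLpNorm (modifiedSemigroup α j t f - f) 2 (muAlpha α)) (𝓝[>] 0) (𝓝 0) := by
  set β : Fin d → ℝ := α + Pi.single j 1 with hβdef
  have hβ : ∀ i, -1 < β i := by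
    intro i
    by_cases h : i = j
    · subst h; simp only [hβdef, Pi.add_apply, Pi.single_eq_same]; linarith
    · simpa [hβdef, h] using hα i h
  set h : (Fin d → ℝ) → 𝕜 := fun y => (y j)⁻¹ • f y with hh
  have hfe : (fun x : Fin d → ℝ => x j • h x) =ᵐ[muAlpha α] f := by
    filter_upwards [muAlpha_ae_pos α] with x hx
    rw [hh, smul_smul, mul_inv_cancel₀ (hx j).ne', one_smul]
  have hmem : MemLp h 2 (muAlpha β) := by
    refine ⟨?_, ?_⟩
    · refine AEStronglyMeasurable.smul
        (measurable_pi_apply j).inv.aestronglyMeasurable (hf.1.mono_ac ?_)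
      rw [hβdef, muAlpha_add_single]
      exact withDensity_absolutelyContinuous _ _
    · rw [hβdef, ← eLpNorm_two_coord_smul, eLpNorm_congr_ae hfe]
      exact hf.2
  have hlim : Tendsto (fun t => eLpNorm (kernelOp (muAlpha β) (prodHeatKernel β t) h - h) 2
      (muAlpha β) + ENNReal.ofReal (1 - Real.exp (-2 * t)) * eLpNorm h 2 (muAlpha β))
      (𝓝[>] 0) (𝓝 0) := by
    have h1 : Tendsto (fun t : ℝ => ENNReal.ofReal (1 - Real.exp (-2 * t))) (𝓝[>] 0) (𝓝 0) := by
      have : Continuous fun t : ℝ => ENNReal.ofReal (1 - Real.exp (-2 * t)) :=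
        ENNReal.continuous_ofReal.comp (by fun_prop)
      have h2 := this.tendsto 0
      simp only [mul_zero, Real.exp_zero, sub_self, ENNReal.ofReal_zero] at h2
      exact h2.mono_left nhdsWithin_le_nhds
    have h2 := (tendsto_eLpNorm_prodHeatKernel hβ hmem).add
      (ENNReal.Tendsto.mul_const h1 (Or.inr hmem.2.ne))
    simpa using h2
  refine tendsto_of_tendsto_of_tendsto_of_le_of_le' tendsto_const_nhds hlim
    (Eventually.of_forall fun _ => zero_le) ?_
  filter_upwards [self_mem_nhdsWithin] with t ht
  have ht : 0 < t := ht
  have hK := isSymmKernel_prodHeatKernel hβ ht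
  set g := kernelOp (muAlpha β) (prodHeatKernel β t) h
  have hg : MemLp g 2 (muAlpha β) := hK.memLp (by norm_num) hmem
  have he0 : 0 ≤ 1 - Real.exp (-2 * t) := by
    have : Real.exp (-2 * t) ≤ 1 := Real.exp_le_one_iff.2 (by linarith)
    linarith
  -- The scalar e^(-2t) is split off as e^(-2t)g - h = e^(-2t)(g-h) - (1-e^(-2t))h.
  have e1 : modifiedSemigroup α j t f - f =ᵐ[muAlpha α]
      fun x => x j • (Real.exp (-2 * t) • (g - h) - (1 - Real.exp (-2 * t)) • h) x := by
    filter_upwards [modifiedSemigroup_ae_eq α j ht f, hfe] with x h1 h2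
    rw [Pi.sub_apply, h1, kernelOp_modKernel_eq]
    rw [← h2]
    simp only [Pi.sub_apply, Pi.smul_apply, ← smul_sub]
    congr 1
    change Real.exp (-2 * t) • g x - h x = _
    simp only [smul_sub, sub_smul, one_smul]; abel
  rw [eLpNorm_congr_ae e1, eLpNorm_two_coord_smul]
  refine (eLpNorm_sub_le ((hg.sub hmem).1.const_smul _) (hmem.1.const_smul _) (by norm_num)).trans ?_
  rw [eLpNorm_const_smul, eLpNorm_const_smul, Real.enorm_of_nonneg he0,
    Real.enorm_of_nonneg (Real.exp_pos _).le]
  refine add_le_add ?_ le_rfl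
  refine mul_le_of_le_one_left zero_le ?_
  exact ENNReal.ofReal_le_one.2 (Real.exp_le_one_iff.2 (by linarith))

/-- The density is positive on the orthant, so nonempty open subsets have positive measure; this
turns almost everywhere statements into a point where a contradiction can be computed. -/
theorem exists_mem_of_ae_muAlpha {α : Fin d → ℝ} {P : (Fin d → ℝ) → Prop}
    (hP : ∀ᵐ x ∂muAlpha α, P x) {O : Set (Fin d → ℝ)} (hO : IsOpen O) (hne : O.Nonempty)
    (hpos : ∀ x ∈ O, ∀ i, 0 < x i) : ∃ x ∈ O, P x := by
  rw [muAlpha, ae_withDensity_iff (measurable_weight α),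
    ae_restrict_iff' measurableSet_forall_pos] at hP
  by_contra! hcon
  refine (hO.measure_pos volume hne).ne' (measure_mono_null ?_ hP)
  intro x hx hx'
  refine hcon x hx (hx' (hpos x hx) ?_)
  have : 0 < ∏ i, x i ^ (2 * α i + 1) :=
    Finset.prod_pos fun i _ => Real.rpow_pos_of_pos (hpos x hx i) _
  simpa using this

end Transfer

/-! ### Assembly: submarkovianity, failure of conservation and of contractivity -/

section Main

variable {d : ℕ} {𝕜 : Type*} [RCLike 𝕜] {α : Fin d → ℝ} {j : Fin d}

theorem exists_massProfile_bound {ν : ℝ} (hν : -(1 / 2) < ν) :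
    ∃ M : NNReal, ∀ u, 0 < u → massProfile ν u ≤ M := by
  rcases le_total ν (1 / 2) with h | h
  · exact exists_massProfile_le hν h
  · exact ⟨1, fun u hu => by exact_mod_cast massProfile_le_one h hu⟩

theorem modifiedSemigroup_zero (f : (Fin d → ℝ) → 𝕜) : modifiedSemigroup α j 0 f = f := by
  funext x; simp [modifiedSemigroup]

/-- The constant `e^{-2t} (cosh 2t)^{-(|α| + d)}`. -/
noncomputable def decayRate (α : Fin d → ℝ) (t : ℝ) : ℝ :=
  Real.exp (-2 * t) * Real.cosh (2 * t) ^ (-((∑ i, α i) + (d : ℝ)))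

theorem decayRate_lt_one (hα : ∀ i, -1 < α i) {t : ℝ} (ht : 0 < t) : decayRate α t < 1 := by
  have h1 : Real.exp (-2 * t) < 1 := Real.exp_lt_one_iff.2 (by linarith)
  have h2 : (∑ i, α i) + (d : ℝ) = ∑ i, (α i + 1) := by
    rw [Finset.sum_add_distrib]; simp
  have h3 : 0 ≤ (∑ i, α i) + (d : ℝ) := by
    rw [h2]; exact Finset.sum_nonneg fun i _ => by linarith [hα i]
  have h4 : Real.cosh (2 * t) ^ (-((∑ i, α i) + (d : ℝ))) ≤ 1 :=
    Real.rpow_le_one_of_one_le_of_nonpos (Real.one_le_cosh _) (by linarith)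
  exact lt_of_le_of_lt (mul_le_of_le_one_right (Real.exp_pos _).le h4) h1

theorem mapsLp_modifiedSemigroup {C : NNReal} {t : ℝ} (ht : 0 < t)
    (hK : IsSymmKernel (muAlpha α) (modKernel α j t) C) {p : ℝ≥0∞} (hp : 1 ≤ p) :
    MapsLp (𝕜 := 𝕜) (muAlpha α) p (modifiedSemigroup α j t) := fun f hf =>
  (hK.memLp hp hf).ae_eq (modifiedSemigroup_ae_eq α j ht f).symm

theorem lpOpNorm_modifiedSemigroup_le {C : NNReal} {t : ℝ} (ht : 0 < t)
    (hK : IsSymmKernel (muAlpha α) (modKernel α j t) C) {p : ℝ≥0∞} (hp : 1 ≤ p) :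
    lpOpNorm (𝕜 := 𝕜) (muAlpha α) p (modifiedSemigroup α j t) ≤ C := by
  refine sInf_le fun f hf => ?_
  rw [eLpNorm_congr_ae (modifiedSemigroup_ae_eq α j ht f)]
  exact hK.eLpNorm_le hp hf.1

theorem isLinearOperator_congr {μ : Measure (Fin d → ℝ)}
    {S T : ((Fin d → ℝ) → 𝕜) → (Fin d → ℝ) → 𝕜}
    (hS : IsLinearOperator μ S) (h : ∀ f, T f =ᵐ[μ] S f) : IsLinearOperator μ T where
  measurable f hf := (hS.measurable f hf).congr (h f).symm
  congr_ae f g hf hfg := (h f).trans ((hS.congr_ae f g hf hfg).trans (h g).symm)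
  map_add f g hf hg := (h _).trans ((hS.map_add f g hf hg).trans ((h f).add (h g)).symm)
  map_smul c f hf := (h _).trans ((hS.map_smul c f hf).trans ((h f).const_smul c).symm)

theorem isLinearOperator_id {μ : Measure (Fin d → ℝ)} :
    IsLinearOperator μ (fun f : (Fin d → ℝ) → 𝕜 => f) where
  measurable _ hf := hf.aestronglyMeasurable
  congr_ae _ _ _ h := h
  map_add _ _ _ _ := EventuallyEq.rfl
  map_smul _ _ _ := EventuallyEq.rfl

theorem isSymmKernel_modKernel_one (hj : -(1 / 2 : ℝ) ≤ α j) (hα : ∀ i, i ≠ j → -1 < α i) {t : ℝ}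
    (ht : 0 < t) : IsSymmKernel (muAlpha α) (modKernel α j t) (decayRate α t).toNNReal := by
  have h := isSymmKernel_modKernel (α := α) (j := j) (by linarith) hα ht (M := 1) fun u hu => by
    exact_mod_cast massProfile_le_one (by linarith) hu
  rwa [one_mul] at h

theorem isSymmetricDiffusionSemigroup_modifiedSemigroup (hj : -(1 / 2 : ℝ) ≤ α j)
    (hα : ∀ i, i ≠ j → -1 < α i) :
    IsSymmetricDiffusionSemigroup (𝕜 := 𝕜) (muAlpha α) (modifiedSemigroup α j) := by
  have hα' : ∀ i, -1 < α i := fun i => by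
    by_cases h : i = j
    · subst h; linarith
    · exact hα i h
  have hK := fun t (ht : 0 < t) => isSymmKernel_modKernel_one hj hα ht
  have hae := fun t (ht : 0 < t) (f : (Fin d → ℝ) → 𝕜) => modifiedSemigroup_ae_eq α j ht f
  constructor
  · intro t ht
    obtain rfl | ht := ht.eq_or_lt
    · exact isLinearOperator_congr isLinearOperator_id fun f => by rw [modifiedSemigroup_zero]
    · exact isLinearOperator_congr (hK t ht).isLinearOperator (hae t ht)
  · intro f _
    rw [modifiedSemigroup_zero]
  · intro p hp t ht f hf
    obtain rfl | ht := ht.eq_or_lt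
    · rw [modifiedSemigroup_zero]; exact ⟨hf, le_rfl⟩
    · refine ⟨mapsLp_modifiedSemigroup ht (hK t ht) hp f hf, ?_⟩
      rw [eLpNorm_congr_ae (hae t ht f)]
      refine ((hK t ht).eLpNorm_le hp hf.1).trans (mul_le_of_le_one_left zero_le ?_)
      exact_mod_cast Real.toNNReal_le_one.2 (decayRate_lt_one hα' ht).le
  · intro p hp s t hs ht f hf
    obtain rfl | hs := hs.eq_or_lt
    · rw [zero_add, modifiedSemigroup_zero]
    obtain rfl | ht := ht.eq_or_lt
    · rw [add_zero, modifiedSemigroup_zero]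
    refine (hae _ (add_pos hs ht) f).trans (EventuallyEq.trans ?_ (hae s hs _).symm)
    rw [kernelOp_congr_ae (hae t ht f), (hK _ (add_pos hs ht)).kernelOp_comp (hK s hs) (hK t ht)
      (lintegral_modKernel_mul (by linarith) hα hs ht) (.of_memLp hp hf)]
  · intro t ht f g hf hg
    obtain rfl | ht := ht.eq_or_lt
    · rw [modifiedSemigroup_zero, modifiedSemigroup_zero]
    · refine Eq.trans (integral_congr_ae ?_)
        (((hK t ht).selfAdjoint hf hg).trans (integral_congr_ae ?_))
      · filter_upwards [hae t ht f] with x hx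
        rw [hx]
      · filter_upwards [hae t ht g] with x hx
        rw [hx]
  · intro f hf
    exact tendsto_eLpNorm_modifiedSemigroup (by linarith) hα hf

theorem isSubmarkovian_modifiedSemigroup (hj : -(1 / 2 : ℝ) ≤ α j)
    (hα : ∀ i, i ≠ j → -1 < α i) :
    IsSubmarkovian (𝕜 := 𝕜) (muAlpha α) (modifiedSemigroup α j) where
  diffusion := isSymmetricDiffusionSemigroup_modifiedSemigroup hj hα
  positive t ht f _ h0 := by
    obtain rfl | ht := ht.eq_or_lt
    · rwa [modifiedSemigroup_zero]
    · filter_upwards [modifiedSemigroup_ae_eq α j ht f] with x hx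
      rw [hx]
      exact kernelOp_nonneg (isSymmKernel_modKernel_one hj hα ht).nonneg h0 x
  map_one_le t ht := by
    have hα' : ∀ i, -1 < α i := fun i => by
      by_cases h : i = j
      · subst h; linarith
      · exact hα i h
    obtain rfl | ht := ht.eq_or_lt
    · rw [modifiedSemigroup_zero]; exact Eventually.of_forall fun _ => le_rfl
    · filter_upwards [modifiedSemigroup_ae_eq α j ht (fun _ => (1 : 𝕜))] with x hx
      have e := kernelOp_ofReal (𝕜 := 𝕜) (μ := muAlpha α) (K := modKernel α j t) (fun _ => 1) x
      rw [RCLike.ofReal_one] at e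
      rw [hx, e]
      refine ((RCLike.ofReal_le_ofReal (y := 1)).2 ?_).trans_eq RCLike.ofReal_one
      refine ((isSymmKernel_modKernel_one hj hα ht).kernelOp_one_le x).trans ?_
      exact_mod_cast Real.toNNReal_le_one.2 (decayRate_lt_one hα' ht).le

/-- Already at t = 1 the image of the constant 1 is at most the decay rate, which is below 1. -/
theorem not_isMarkovian_modifiedSemigroup (hj : -(1 / 2 : ℝ) ≤ α j)
    (hα : ∀ i, i ≠ j → -1 < α i) :
    ¬ IsMarkovian (𝕜 := 𝕜) (muAlpha α) (modifiedSemigroup α j) := by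
  intro h
  have hα' : ∀ i, -1 < α i := fun i => by
    by_cases h : i = j
    · subst h; linarith
    · exact hα i h
  have ht : (0 : ℝ) < 1 := one_pos
  obtain ⟨x, hx, h1⟩ := exists_mem_of_ae_muAlpha (h.conservative 1 ht.le)
    (O := Set.univ.pi fun _ => Set.Ioi 0) (isOpen_set_pi Set.finite_univ fun _ _ => isOpen_Ioi)
    ⟨fun _ => 1, fun _ _ => Set.mem_Ioi.2 one_pos⟩ (fun x hx i => hx i trivial)
  rw [modifiedSemigroup_eq_kernelOp α j ht _ fun i => hx i trivial] at h1
  have e := kernelOp_ofReal (𝕜 := 𝕜) (μ := muAlpha α) (K := modKernel α j 1) (fun _ => 1) x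
  rw [RCLike.ofReal_one, h1, ← RCLike.ofReal_one, RCLike.ofReal_inj] at e
  have h2 := (isSymmKernel_modKernel_one hj hα ht).kernelOp_one_le x
  rw [← e] at h2
  have h3 : (decayRate α 1).toNNReal < 1 := Real.toNNReal_lt_one.2 (decayRate_lt_one hα' ht)
  exact absurd h2 (not_le.2 (by exact_mod_cast h3))

theorem not_isLpContractive_modifiedSemigroup (hj : -(3 / 2 : ℝ) < α j) (hj' : α j < -(1 / 2))
    (hα : ∀ i, i ≠ j → -1 < α i) :
    ¬ IsLpContractive (𝕜 := 𝕜) (muAlpha α) (modifiedSemigroup α j) := by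
  intro hcontr
  obtain ⟨M, hM⟩ := exists_massProfile_bound (ν := α j + 1) (by linarith)
  obtain ⟨u₀, η, hu₀, hη, hmass⟩ := exists_lt_massProfile (ν := α j + 1) (by linarith)
  -- Lower bounds for the coordinate masses, uniform over x_i in (0,1) for i ≠ j and u in [u₀, 2u₀]
  -- for coordinate j. Being independent of x, their product tends to 1 + η as t → 0, which allows t
  -- to be fixed before x.
  set R : Fin d → ℝ → ℝ := fun i t => if i = j then
      Real.cosh (2 * t) ^ (-(α i + 1)) * Real.exp (-(Real.sinh (2 * t) ^ 2 * (2 * u₀))) * (1 + η)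
    else Real.cosh (2 * t) ^ (-(α i + 1)) *
      Real.exp (-(1 / 2) * (Real.sinh (2 * t) / Real.cosh (2 * t))) with hR
  have hR0 : ∀ i t, 0 ≤ R i t := by
    intro i t
    have := Real.cosh_pos (2 * t)
    simp only [hR]
    split_ifs <;> positivity
  have hcosh : ∀ i, ContinuousAt (fun t => Real.cosh (2 * t) ^ (-(α i + 1))) 0 := fun i =>
    ContinuousAt.rpow_const (by fun_prop) (Or.inl (Real.cosh_pos _).ne')
  have hRc : ∀ i, ContinuousAt (R i) 0 := by
    intro i
    simp only [hR]
    by_cases h : i = j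
    · simp only [h, if_true]
      exact ((hcosh j).mul (by fun_prop)).mul continuousAt_const
    · simp only [h, if_false]
      refine (hcosh i).mul (Real.continuous_exp.continuousAt.comp
        (ContinuousAt.mul continuousAt_const ?_))
      exact ContinuousAt.div (by fun_prop) (by fun_prop) (Real.cosh_pos _).ne'
  have hlim : Tendsto (fun t => Real.exp (-2 * t) * ∏ i, R i t) (𝓝[>] 0) (𝓝 (1 + η)) := by
    have hc : ContinuousAt (fun t => Real.exp (-2 * t) * ∏ i, R i t) 0 :=
      ContinuousAt.mul (by fun_prop) (tendsto_finsetProd _ fun i _ => hRc i)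
    have h0 : Real.exp (-2 * 0) * ∏ i, R i 0 = 1 + η := by
      have : ∀ i, R i 0 = if i = j then 1 + η else 1 := fun i => by simp [hR]
      simp [this]
    rw [← h0]
    exact hc.tendsto.mono_left nhdsWithin_le_nhds
  obtain ⟨t, hRt, ht⟩ := ((hlim.eventually (lt_mem_nhds (by linarith : 1 < 1 + η))).and
    self_mem_nhdsWithin).exists
  have ht : 0 < t := ht
  have hK := isSymmKernel_modKernel hj hα ht hM
  have hle := hK.mass_le_one_of_contractive (𝕜 := 𝕜) fun f h2 ht' => by
    rw [← eLpNorm_congr_ae (modifiedSemigroup_ae_eq α j ht f)]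
    exact hcontr ∞ le_top t ht.le f h2 ht'
  have hS := sinh_two_mul_pos ht
  have hC := Real.cosh_pos (2 * t)
  set q := 2 * Real.sinh (2 * t) * Real.cosh (2 * t) with hq
  have hq0 : 0 < q := by positivity
  -- In coordinate j the open box is the condition u₀ < x_j²/q < 2u₀, the range where the profile is
  -- at least 1 + η.
  obtain ⟨x, hx, hx1⟩ := exists_mem_of_ae_muAlpha hle
    (O := Set.univ.pi fun i => if i = j then
      Set.Ioo (Real.sqrt (u₀ * q)) (Real.sqrt (2 * u₀ * q)) else Set.Ioo 0 1)
    (isOpen_set_pi Set.finite_univ fun i _ => by split_ifs <;> exact isOpen_Ioo)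
    (Set.univ_pi_nonempty_iff.2 fun i => by
      split_ifs
      · refine Set.nonempty_Ioo.2 (Real.sqrt_lt_sqrt (by positivity) ?_)
        nlinarith [mul_pos hu₀ hq0]
      · exact Set.nonempty_Ioo.2 one_pos)
    (fun x hx i => by
      have h := hx i trivial
      simp only at h
      split_ifs at h
      · exact lt_of_le_of_lt (Real.sqrt_nonneg _) h.1
      · exact h.1)
  refine absurd hx1 (not_le.2 ?_)
  simp only [modKernel]
  simp_rw [ENNReal.ofReal_mul (Real.exp_pos (-2 * t)).le]
  rw [lintegral_const_mul' _ _ ENNReal.ofReal_ne_top,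
    lintegral_prodKernel (measurable_factorKernel hj hα t) (factorKernel_nonneg hj hα ht)]
  have hfac : ∀ i, ENNReal.ofReal (R i t) ≤
      ∫⁻ y, ENNReal.ofReal (factorKernel α j t i (x i) y) ∂halfMeasure (α i) := by
    intro i
    have h := hx i trivial
    simp only [hR, factorKernel]
    simp only at h
    split_ifs at h ⊢ with hij
    · subst hij
      have hxi : 0 < x i := lt_of_le_of_lt (Real.sqrt_nonneg _) h.1
      have hu1 : u₀ ≤ x i ^ 2 / q := by
        rw [le_div_iff₀ hq0]; exact ((Real.sqrt_lt' hxi).1 h.1).le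
      have hu2 : x i ^ 2 / q ≤ 2 * u₀ := by
        rw [div_le_iff₀ hq0]; exact ((Real.lt_sqrt hxi.le).1 h.2).le
      rw [lintegral_modHalfKernel hj ht hxi, ENNReal.ofReal_mul (by positivity)]
      refine mul_le_mul' (ENNReal.ofReal_le_ofReal ?_) (hmass _ hu1 hu2)
      gcongr
    · rw [lintegral_halfKernel (hα i hij) ht h.1]
      refine ENNReal.ofReal_le_ofReal ?_
      gcongr
      have hr : 0 < Real.sinh (2 * t) / Real.cosh (2 * t) := by positivity
      have hx2 : x i ^ 2 ≤ 1 := pow_le_one₀ h.1.le h.2.le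
      nlinarith
  calc (1 : ℝ≥0∞) < ENNReal.ofReal (Real.exp (-2 * t) * ∏ i, R i t) := by
        rw [← ENNReal.ofReal_one]
        exact (ENNReal.ofReal_lt_ofReal_iff (by linarith)).2 hRt
    _ = ENNReal.ofReal (Real.exp (-2 * t)) * ∏ i, ENNReal.ofReal (R i t) := by
        rw [ENNReal.ofReal_mul (Real.exp_pos _).le,
          ENNReal.ofReal_prod_of_nonneg fun i _ => hR0 i t]
    _ ≤ _ := by
        gcongr with i
        exact hfac i

end Main

end LaguerreSemigroup

theorem mainTheorem7 {𝕜 : Type*} [RCLike 𝕜] {d : ℕ} (j : Fin d) (α : Fin d → ℝ)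
    (hj : -(3 / 2 : ℝ) < α j) (hα : ∀ i, i ≠ j → -1 < α i) :
    (∀ t : ℝ, 0 < t → ∀ f : (Fin d → ℝ) → 𝕜,
      LaguerreSemigroup.MemL1AddLinf (LaguerreSemigroup.muAlpha α) f →
      ∀ x : Fin d → ℝ, (∀ i, 0 < x i) →
        Integrable (fun y => LaguerreSemigroup.modifiedKernel α j t x y • f y)
          (LaguerreSemigroup.muAlpha α)) ∧
    (-(1 / 2 : ℝ) ≤ α j →
      LaguerreSemigroup.IsSubmarkovian (𝕜 := 𝕜) (LaguerreSemigroup.muAlpha α)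
        (LaguerreSemigroup.modifiedSemigroup α j) ∧
      ¬ LaguerreSemigroup.IsMarkovian (𝕜 := 𝕜) (LaguerreSemigroup.muAlpha α)
        (LaguerreSemigroup.modifiedSemigroup α j) ∧
      ∀ p : ℝ≥0∞, 1 ≤ p → ∀ t : ℝ, 0 < t →
        LaguerreSemigroup.MapsLp (𝕜 := 𝕜) (LaguerreSemigroup.muAlpha α) p
          (LaguerreSemigroup.modifiedSemigroup α j t) ∧
        LaguerreSemigroup.lpOpNorm (𝕜 := 𝕜) (LaguerreSemigroup.muAlpha α) p
            (LaguerreSemigroup.modifiedSemigroup α j t) ≤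
          ENNReal.ofReal (Real.exp (-2 * t) * Real.cosh (2 * t) ^ (-((∑ i, α i) + (d : ℝ))))) ∧
    (α j < -(1 / 2 : ℝ) →
      ¬ LaguerreSemigroup.IsLpContractive (𝕜 := 𝕜) (LaguerreSemigroup.muAlpha α)
        (LaguerreSemigroup.modifiedSemigroup α j) ∧
      ∃ c : ℝ, 1 < c ∧ ∀ p : ℝ≥0∞, 1 ≤ p → ∀ t : ℝ, 0 < t →
        LaguerreSemigroup.MapsLp (𝕜 := 𝕜) (LaguerreSemigroup.muAlpha α) p
          (LaguerreSemigroup.modifiedSemigroup α j t) ∧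
        LaguerreSemigroup.lpOpNorm (𝕜 := 𝕜) (LaguerreSemigroup.muAlpha α) p
            (LaguerreSemigroup.modifiedSemigroup α j t) ≤
          ENNReal.ofReal
            (c * (Real.exp (-2 * t) * Real.cosh (2 * t) ^ (-((∑ i, α i) + (d : ℝ)))))) := by
  obtain ⟨M, hM⟩ := LaguerreSemigroup.exists_massProfile_bound (ν := α j + 1) (by linarith)
  refine ⟨fun t ht f hf x hx => ?_, fun hj' => ⟨?_, ?_, fun p hp t ht => ?_⟩, fun hj' => ⟨?_, ?_⟩⟩
  · refine ((LaguerreSemigroup.isSymmKernel_modKernel hj hα ht hM).integrable hf x).congr ?_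
    filter_upwards [LaguerreSemigroup.muAlpha_ae_pos α] with y hy
    rw [LaguerreSemigroup.modifiedKernel_eq_modKernel α j ht hx hy]
  · exact LaguerreSemigroup.isSubmarkovian_modifiedSemigroup hj' hα
  · exact LaguerreSemigroup.not_isMarkovian_modifiedSemigroup hj' hα
  · have hK := LaguerreSemigroup.isSymmKernel_modKernel_one hj' hα ht
    exact ⟨LaguerreSemigroup.mapsLp_modifiedSemigroup ht hK hp,
      LaguerreSemigroup.lpOpNorm_modifiedSemigroup_le ht hK hp⟩
  · exact LaguerreSemigroup.not_isLpContractive_modifiedSemigroup hj hj' hα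
  · have hM0 : (0 : ℝ) ≤ M := M.coe_nonneg
    -- M bounds the profile but is only known to be nonnegative; adding 2 makes the constant exceed
    -- 1.
    refine ⟨M + 2, by linarith, fun p hp t ht => ?_⟩
    have hK := LaguerreSemigroup.isSymmKernel_modKernel hj hα ht hM
    refine ⟨LaguerreSemigroup.mapsLp_modifiedSemigroup ht hK hp,
      (LaguerreSemigroup.lpOpNorm_modifiedSemigroup_le ht hK hp).trans ?_⟩
    rw [ENNReal.ofReal_mul (by positivity)]
    push_cast
    refine mul_le_mul' ?_ le_rfl
    rw [← ENNReal.ofReal_coe_nnreal]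
    exact ENNReal.ofReal_le_ofReal (by linarith)
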